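/- Let $(a)_n=a(a+1)\cdots(a+n-1)$ and $(a)_{-m}=1/((a-1)(a-2)\cdots(a-m))$. For parameters $\rho_1,\rho_2,r_1,r_2$ put $g=\rho_1+\rho_2-r_1-r_2$ and write $n=2n_e+n_p$ with $n_p\in\{0,1\}$. The monic Bannai-Ito (BI) polynomial $B_n(x)=B_n(x;\rho_1,\rho_2,r_1,r_2)$ is \begin{align*} B_n(x)=\eta_n\Big[&{}_4F_3\Big({-n_e,\;n_e+g+1,\;x-r_1+\tfrac12,\;-x-r_1+\tfrac12\atop 1-r_1-r_2,\;\rho_1-r_1+\tfrac12,\;\rho_2-r_1+\tfrac12};1\Big)\\ &+\frac{(-1)^n(n_e+n_p+gn_p)(x-r_1+\frac12)}{(\rho_1-r_1+\frac12)(\rho_2-r_1+\frac12)}\,{}_4F_3\Big({-n_e-n_p+1,\;n_e+n_p+g+1,\;x-r_1+\tfrac32,\;-x-r_1+\tfrac12\atop 1-r_1-r_2,\;\rho_1-r_1+\tfrac32,\;\rho_2-r_1+\tfrac32};1\Big)\Big],\\ \eta_n=(-1)^n&\frac{(\rho_1-r_1+\frac12)_{n_e+n_p}(\rho_2-r_1+\frac12)_{n_e+n_p}(1-r_1-r_2)_{n_e}}{(n_e+g+1)_{n_e+n_p}},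 \end{align*} where the lower Pochhammer symbols of the terminating series are cancelled against those in the numerator of $\eta_n$ (by $(a)_m/(a)_k=(a+k)_{m-k}$), so that $B_n(x)$ is defined whenever $(n_e+g+1)_{n_e+n_p}\neq0$. (For $n=0$ the second term is absent and $B_0=1$.) Let $N\ge0$ be an integer and let $p_1,p_2,p_3,c$ be real or complex parameters. For $n_1+n_2\le N$ the truncated bivariate Bannai-Ito polynomial is $$B_{n_1,n_2}(z_1,z_2)=B_{n_1}\big(z_1-\tfrac14;\rho^{(1)}_1,\rho^{(1)}_2,r^{(1)}_1,r^{(1)}_2\big)\,B_{n_2}\big((-1)^{n_1}z_2-\tfrac14;\rho^{(2)}_1,\rho^{(2)}_2,r^{(2)}_1,r^{(2)}_2\big),$$ $$\rho^{(1)}_1=c-p_1+\tfrac12,\quad r^{(1)}_1=\tfrac12-p_1,\quad \rho^{(1)}_2=z_2+p_2-\tfrac14,\quad r^{(1)}_2=z_2-p_2+\tfrac14,$$ $$\rho^{(2)}_1=\tfrac{n_1+1}2+c+p_2-p_1,\qquad r^{(2)}_1=\tfrac{1-n_1}2-p_1-p_2,$$ $$\rho^{(2)}_2=p_3-(-1)^{n_1+N}\big(\tfrac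 N2+p_1+p_2+p_3\big),\qquad r^{(2)}_2=-p_3-(-1)^{n_1+N}\big(\tfrac N2+p_1+p_2+p_3\big).$$ Assume that no denominator in the formulas above and below vanishes (for $n_1+n_2\le N$, $0\le s\le N$, $0\le r\le N-s$). Explicitly, for all integers $k$, \begin{align*} &c+\tfrac12+k\ne0\ \ (0\le k<\lfloor (N+1)/2\rfloor),\qquad 2p_1+2p_2+2p_3+\tfrac12+k\neq0\ \ (\lfloor N/2\rfloor\le k<N),\\ &2p_1+k\ne0,\quad 2p_1+2p_2+k\neq0,\quad c+2p_2+\tfrac12+k\ne0,\quad c+2p_2+2p_3+1+k\ne0\ \ (0\le k<N). \end{align*} Then for all $n_1,n_2\ge 0$ with $n_1+n_2\le N$ the two factors $B_{n_1}(x;\rho^{(1)}_1,\dots)$ (for every $z_2$) and $B_{n_2}(x;\rho^{(2)}_1,\dots)$ are monic polynomials in $x$ of degree $n_1$ and $n_2$. For all $n_1,n_2,m_1,m_2\ge0$ with $n_1+n_2\le N$ and $m_1+m_2\le N$, $$\sum_{s=0}^{N}\sum_{r=0}^{N}w^{(1)}_{r,N-s}\,w^{(2)}_{s,N}\,B_{n_1,n_2}(z_1(r),z_2(s))\,B_{m_1,m_2}(z_1(r),z_2(s))=H_{n_1,n_2,N}\,\delta_{n_1,m_1}\delta_{n_2,m_2},$$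 where the grids are $$z_1(r)=\tfrac12(-1)^{r+s+N}\big(r+s-N-2p_1+\tfrac12\big),\qquad z_2(s)=\tfrac12(-1)^{s+N}\big(s-N-2p_1-2p_2+\tfrac12\big)$$ (so $z_1(r)$ also depends on $s$), the weights are \begin{align*} w^{(1)}_{2r,2\tilde{s}} &= \frac{(2p_2)_{r} (-\tilde{s})_{r} (1-2p_1-2\tilde{s})_{r} (\frac32+c-2p_1-\tilde{s})_{r}}{r!(\frac12-c-\tilde{s})_{r} (1-2p_1-\tilde{s})_{r} (1-2p_1-2p_2-2\tilde{s})_{r}} \\[0.5em] w^{(1)}_{2r+1,2\tilde{s}} &= -\frac{(2p_2)_{r+1} (-\tilde{s})_{r+1} (1-2p_1-2\tilde{s})_{r} (\frac32+c-2p_1-\tilde{s})_{r}}{r!(\frac12-c-\tilde{s})_{r} (1-2p_1-\tilde{s})_{r+1} (1-2p_1-2p_2-2\tilde{s})_{r+1}} \\[0.5em] w^{(1)}_{2r,2\tilde{s}+1} &= \frac{(2p_2)_{r} (-\tilde{s})_{r} (-2p_1-2\tilde{s})_{r} (\frac12+c-2p_1-\tilde{s})_{r}}{r!(-\frac12-c-\tilde{s})_{r}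 (1-2p_1-\tilde{s})_{r} (-2p_1-2p_2-2\tilde{s})_{r}} \\[0.5em] w^{(1)}_{2r+1,2\tilde{s}+1} &= -\frac{(2p_2)_{r+1} (-\tilde{s})_{r} (-2p_1-2\tilde{s})_{r} (\frac12+c-2p_1-\tilde{s})_{r+1}}{r!(-\frac12-c-\tilde{s})_{r+1} (1-2p_1-\tilde{s})_{r} (-2p_1-2p_2-2\tilde{s})_{r+1}} \end{align*} (with $w^{(1)}_{r,S}=0$ for $r>S$, where the numerator contains the factor $0$) and \begin{align*} w^{(2)}_{2s,2N} &= \frac{ (-1)^s \binom{N}{s} (\frac32+c-2p_1-N)_{s} (1-2p_1-2p_2-2N)_{s} (\frac12+2p_3)_{s} }{ N! (\frac12-c-N)_{s} (1-2p_1-2p_2-2N)_{2s} (\frac12-2p_1-2p_2-2p_3-2N)_{s} (1-2p_1-2N+2s)_{N-s} } \\[0.5em] w^{(2)}_{2s+1,2N} &= \frac{ (-1)^s \binom{N-1}{s}(\frac32+c-2p_1-N)_{s} (1-2p_1-2p_2-2N)_{s} (\frac12+2p_3)_{s+1} }{ (N-1)! (\frac12-c-N)_{s} (1-2p_1-2p_2-2N)_{2s+1}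 (\frac12-2p_1-2p_2-2p_3-2N)_{s+1} (2-2p_1-2N+2s)_{N-s} } \\[0.5em] w^{(2)}_{2s,2N+1} &= \frac{ (-1)^s \binom{N}{s}(\frac12+c-2p_1-N)_{s} (-2p_1-2p_2-2N)_{s} (\frac12+2p_3)_{s} }{ N! (-\frac12-c-N)_{s} (-2p_1-2p_2-2N)_{2s} (-\frac12-2p_1-2p_2-2p_3-2N)_{s} (-2p_1-2N+2s)_{N+1-s} } \\[0.5em] w^{(2)}_{2s+1,2N+1} &= \frac{ (-1)^{s+1} \binom{N}{s} (\frac12+c-2p_1-N)_{s+1} (-2p_1-2p_2-2N)_{s} (\frac12+2p_3)_{s+1} }{ N! (-\frac12-c-N)_{s+1} (-2p_1-2p_2-2N)_{2s+1} (-\frac12-2p_1-2p_2-2p_3-2N)_{s+1} (1-2p_1-2N+2s)_{N-s} } \end{align*} and the normalization coefficients are \begin{align*} H_{2n_1,2n_2,2N} &= \frac{n_1!n_2! (2 p_2)_{n_1} (2 p_3+\frac{1}{2})_{n_2} (c+n_1+2 p_2+\frac{1}{2})_N (c-N-2 p_1+\frac{3}{2})_{n_1+n_2} }{ (N-n_1-n_2)!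 (c+n_1+\frac{1}{2})_{N-n_1} (c+n_1+2 p_2+\frac{1}{2})_{n_1}^2 (c+2 n_1+n_2+2 p_2+\frac{1}{2})_{N-n_1-n_2} } \\[0.5em] &\quad\times \frac{(c+N+n_1+2 p_2+2 p_3+1)_{n_2} (c+2 n_1+n_2+2 p_2+2 p_3+1)_{N-n_1-n_2} }{ (c+2 n_1+n_2+2 p_2+2 p_3+1)_{n_2}^2 (-2 N-2 p_1-2 p_2-2 p_3+\frac{1}{2})_{N-n_1-n_2} } \\[0.5em] H_{2n_1+1,2n_2,2N} &= \frac{n_1!n_2! (2 p_2)_{n_1+1} (2 p_3+\frac{1}{2})_{n_2} (c+n_1+2 p_2+\frac{1}{2})_N (c-N-2 p_1+\frac{3}{2})_{n_1+n_2} }{ (N-n_1-n_2-1)!(c+n_1+\frac{3}{2})_{N-n_1-1} (c+n_1+2 p_2+\frac{1}{2})_{n_1+1}^2 (c+2 n_1+n_2+2 p_2+\frac{3}{2})_{N-n_1-n_2-1} } \\[0.5em] &\quad\times \frac{ (c+N+n_1+2 p_2+2 p_3+2)_{n_2} (c+2 n_1+n_2+2 p_2+2 p_3+2)_{N-n_1-n_2}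 }{ (c+2 n_1+n_2+2 p_2+2 p_3+2)_{n_2}^2 (-2 N-2 p_1-2 p_2-2 p_3+\frac{1}{2})_{N-n_1-n_2} } \\[0.5em] H_{2n_1,2n_2+1,2N} &= \frac{n_1!n_2! (2 p_2)_{n_1} (2 p_3+\frac{1}{2})_{n_2+1} (c+n_1+2 p_2+\frac{1}{2})_N (c-N-2 p_1+\frac{3}{2})_{n_1+n_2} }{ (N-n_1-n_2-1)!(c+n_1+\frac{1}{2})_{N-n_1} (c+n_1+2 p_2+\frac{1}{2})_{n_1}^2 (c+2 n_1+n_2+2 p_2+\frac{3}{2})_{N-n_1-n_2-1} } \\[0.5em] &\quad\times \frac{ (c+N+n_1+2 p_2+2 p_3+1)_{n_2+1} (c+2 n_1+n_2+2 p_2+2 p_3+1)_{N-n_1-n_2} }{ (c+2 n_1+n_2+2 p_2+2 p_3+1)_{n_2+1}^2 (-2 N-2 p_1-2 p_2-2 p_3+\frac{1}{2})_{N-n_1-n_2} } \\[0.5em] H_{2n_1+1,2n_2+1,2N} &= \frac{n_1!n_2! (2 p_2)_{n_1+1} (2 p_3+\frac{1}{2})_{n_2+1} (c+n_1+2 p_2+\frac{1}{2})_N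 (c-N-2 p_1+\frac{3}{2})_{n_1+n_2+1} }{ (N-n_1-n_2-1)!(c+n_1+\frac{3}{2})_{N-n_1-1} (c+n_1+2 p_2+\frac{1}{2})_{n_1+1}^2 (c+2 n_1+n_2+2 p_2+\frac{5}{2})_{N-n_1-n_2-2} } \\[0.5em] &\quad\times \frac{ (c+N+n_1+2 p_2+2 p_3+2)_{n_2} (c+2 n_1+n_2+2 p_2+2 p_3+2)_{N-n_1-n_2} }{ (c+2 n_1+n_2+2 p_2+2 p_3+2)_{n_2+1}^2 (-2 N-2 p_1-2 p_2-2 p_3+\frac{1}{2})_{N-n_1-n_2-1} } \\[0.5em] H_{2n_1,2n_2,2N+1} &= \frac{n_1!n_2! (2 p_2)_{n_1} (2 p_3+\frac{1}{2})_{n_2} (c+n_1+2 p_2+\frac{1}{2})_N (c-N-2 p_1+\frac{1}{2})_{n_1+n_2} }{ (N-n_1-n_2)! (c+n_1+\frac{1}{2})_{N-n_1+1} (c+n_1+2 p_2+\frac{1}{2})_{n_1}^2 (c+2 n_1+n_2+2 p_2+\frac{1}{2})_{N-n_1-n_2} } \\[0.5em] &\quad\times \frac{ (c+N+n_1+2 p_2+2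 p_3+2)_{n_2} (c+2 n_1+n_2+2 p_2+2 p_3+1)_{N-n_1-n_2+1} }{ (c+2 n_1+n_2+2 p_2+2 p_3+1)_{n_2}^2 (-2 N-2 p_1-2 p_2-2 p_3-\frac{1}{2})_{N-n_1-n_2+1} } \\[0.5em] H_{2n_1+1,2n_2,2N+1} &= \frac{n_1!n_2! (2 p_2)_{n_1+1} (2 p_3+\frac{1}{2})_{n_2} (c+n_1+2 p_2+\frac{1}{2})_N (c-N-2 p_1+\frac{1}{2})_{n_1+n_2+1} }{ (N-n_1-n_2)! (c+n_1+\frac{3}{2})_{N-n_1} (c+n_1+2 p_2+\frac{1}{2})_{n_1+1}^2 (c+2 n_1+n_2+2 p_2+\frac{3}{2})_{N-n_1-n_2-1} } \\[0.5em] &\quad\times \frac{ (c+N+n_1+2 p_2+2 p_3+2)_{n_2} (c+2 n_1+n_2+2 p_2+2 p_3+2)_{N-n_1-n_2} }{ (c+2 n_1+n_2+2 p_2+2 p_3+2)_{n_2}^2 (-2 N-2 p_1-2 p_2-2 p_3-\frac{1}{2})_{N-n_1-n_2} } \\[0.5em] H_{2n_1,2n_2+1,2N+1} &= \frac{n_1!n_2!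 (2 p_2)_{n_1} (2 p_3+\frac{1}{2})_{n_2+1} (c+n_1+2 p_2+\frac{1}{2})_N (c-N-2 p_1+\frac{1}{2})_{n_1+n_2+1} }{ (N-n_1-n_2)! (c+n_1+\frac{1}{2})_{N-n_1+1} (c+n_1+2 p_2+\frac{1}{2})_{n_1}^2 (c+2 n_1+n_2+2 p_2+\frac{3}{2})_{N-n_1-n_2-1} } \\[0.5em] &\quad\times \frac{ (c+N+n_1+2 p_2+2 p_3+1)_{n_2+1} (c+2 n_1+n_2+2 p_2+2 p_3+1)_{N-n_1-n_2} }{ (c+2 n_1+n_2+2 p_2+2 p_3+1)_{n_2+1}^2 (-2 N-2 p_1-2 p_2-2 p_3-\frac{1}{2})_{N-n_1-n_2} } \\[0.5em] H_{2n_1+1,2n_2+1,2N+1} &= \frac{n_1!n_2! (2 p_2)_{n_1+1} (2 p_3+\frac{1}{2})_{n_2+1} (c+n_1+2 p_2+\frac{1}{2})_N (c-N-2 p_1+\frac{1}{2})_{n_1+n_2+1} }{ (N-n_1-n_2-1)!(c+n_1+\frac{3}{2})_{N-n_1} (c+n_1+2 p_2+\frac{1}{2})_{n_1+1}^2 (c+2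 n_1+n_2+2 p_2+\frac{5}{2})_{N-n_1-n_2-2} } \\[0.5em] &\quad\times \frac{ (c+N+n_1+2 p_2+2 p_3+2)_{n_2+1} (c+2 n_1+n_2+2 p_2+2 p_3+2)_{N-n_1-n_2} }{ (c+2 n_1+n_2+2 p_2+2 p_3+2)_{n_2+1}^2 (-2 N-2 p_1-2 p_2-2 p_3-\frac{1}{2})_{N-n_1-n_2} } \end{align*} -/

import Mathlib

open scoped Nat

namespace BivariateBI

variable {K : Type*} [Field K]

/-- Pochhammer symbol `(a)_n = a (a+1) ⋯ (a+n-1)`. -/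
def poch (a : K) (n : ℕ) : K := ∏ i ∈ Finset.range n, (a + i)

/-- Pochhammer symbol with integer index, `(a)_{-m} = 1 / ((a-1)(a-2)⋯(a-m))`. -/
def pochZ (a : K) : ℤ → K
  | Int.ofNat n => poch a n
  | Int.negSucc n => (∏ i ∈ Finset.range (n + 1), (a - (i + 1)))⁻¹

/-- The terminating series `₄F₃(-m, b, c, d; e, f, g; 1)`. -/
def hyp43 (m : ℕ) (b c d e f g : K) : K :=
  ∑ k ∈ Finset.range (m + 1),
    (poch (-(m : K)) k * poch b k * poch c k * poch d k) /
      ((k ! : K) * poch e k * poch f k * poch g k)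

/-- The normalization coefficient `η_n`; here `n = 2 (n / 2) + n % 2`. -/
def eta (n : ℕ) (ρ₁ ρ₂ r₁ r₂ : K) : K :=
  (-1) ^ n * (poch (ρ₁ - r₁ + 1 / 2) (n / 2 + n % 2) * poch (ρ₂ - r₁ + 1 / 2) (n / 2 + n % 2) *
      poch (1 - r₁ - r₂) (n / 2)) /
    poch (((n / 2 : ℕ) : K) + (ρ₁ + ρ₂ - r₁ - r₂) + 1) (n / 2 + n % 2)

/-- The value at `x` of the monic Bannai-Ito polynomial `B_n(x; ρ₁, ρ₂, r₁, r₂)`.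
It is `η_n` times the combination of two `₄F₃` series, where in every term the Pochhammer symbols
in the denominators of the series have been cancelled against those in the numerator of `η_n`,
by `(a)_m / (a)_k = (a+k)_{m-k}`. So it is defined (as a polynomial in `x`) whenever the
denominator of `η_n` is nonzero, in particular at truncating parameters. See
`bannaiIto_eq_hypergeometric` for the uncancelled form. -/
def bannaiIto (n : ℕ) (ρ₁ ρ₂ r₁ r₂ x : K) : K :=
  let e := n / 2
  let p := n % 2
  let g := ρ₁ + ρ₂ - r₁ - r₂
  (-1) ^ n / poch ((e : K) + g + 1) (e + p) *
    ((∑ k ∈ Finset.range (e + 1),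
        poch (-(e : K)) k * poch (e + g + 1) k * poch (x - r₁ + 1 / 2) k *
          poch (-x - r₁ + 1 / 2) k / (k ! : K) *
          (poch (ρ₁ - r₁ + 1 / 2 + k) (e + p - k) * poch (ρ₂ - r₁ + 1 / 2 + k) (e + p - k) *
            poch (1 - r₁ - r₂ + k) (e - k))) +
      (-1) ^ n * ((e : K) + p + g * p) * (x - r₁ + 1 / 2) *
        ∑ k ∈ Finset.range (e + p),
          poch (-(e : K) - p + 1) k * poch (e + p + g + 1) k * poch (x - r₁ + 3 / 2) k *
            poch (-x - r₁ + 1 / 2) k / (k ! : K) *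
            (poch (ρ₁ - r₁ + 1 / 2 + (k + 1)) (e + p - (k + 1)) *
              poch (ρ₂ - r₁ + 1 / 2 + (k + 1)) (e + p - (k + 1)) *
              poch (1 - r₁ - r₂ + k) (e - k)))

theorem poch_add (a : K) (m k : ℕ) : poch a (m + k) = poch a m * poch (a + m) k := by
  unfold poch
  rw [Finset.prod_range_add]
  congr 1
  apply Finset.prod_congr rfl
  intro i _
  push_cast
  ring

theorem poch_split (a : K) {m k : ℕ} (h : k ≤ m) :
    poch a m = poch a k * poch (a + k) (m - k) := by
  rw [← poch_add, Nat.add_sub_cancel' h]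

theorem poch_succ_left (a : K) (k : ℕ) : poch a (k + 1) = a * poch (a + 1) k := by
  rw [add_comm k 1, poch_add]
  simp [poch]

theorem poch_ne_zero_of_le {a : K} {m k : ℕ} (h : k ≤ m) (ha : poch a m ≠ 0) : poch a k ≠ 0 := by
  rw [poch_split a h] at ha
  exact left_ne_zero_of_mul ha

/-- Where no denominator vanishes, `bannaiIto` is `η_n` times the sum of the two `₄F₃` series. -/
theorem bannaiIto_eq_hypergeometric [CharZero K] (n : ℕ) (ρ₁ ρ₂ r₁ r₂ x : K)
    (h₁ : poch (ρ₁ - r₁ + 1 / 2) (n / 2 + n % 2) ≠ 0)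
    (h₂ : poch (ρ₂ - r₁ + 1 / 2) (n / 2 + n % 2) ≠ 0)
    (h₃ : poch (1 - r₁ - r₂) (n / 2) ≠ 0) :
    bannaiIto n ρ₁ ρ₂ r₁ r₂ x =
      eta n ρ₁ ρ₂ r₁ r₂ *
        (hyp43 (n / 2) (((n / 2 : ℕ) : K) + (ρ₁ + ρ₂ - r₁ - r₂) + 1)
            (x - r₁ + 1 / 2) (-x - r₁ + 1 / 2)
            (1 - r₁ - r₂) (ρ₁ - r₁ + 1 / 2) (ρ₂ - r₁ + 1 / 2) +
          (-1) ^ n * (((n / 2 : ℕ) : K) + ((n % 2 : ℕ) : K) +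
              (ρ₁ + ρ₂ - r₁ - r₂) * ((n % 2 : ℕ) : K)) * (x - r₁ + 1 / 2) /
            ((ρ₁ - r₁ + 1 / 2) * (ρ₂ - r₁ + 1 / 2)) *
          hyp43 (n / 2 + n % 2 - 1)
            (((n / 2 : ℕ) : K) + ((n % 2 : ℕ) : K) + (ρ₁ + ρ₂ - r₁ - r₂) + 1)
            (x - r₁ + 3 / 2) (-x - r₁ + 1 / 2)
            (1 - r₁ - r₂) (ρ₁ - r₁ + 3 / 2) (ρ₂ - r₁ + 3 / 2)) := by
  rcases Nat.eq_zero_or_pos n with rfl | hn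
  · simp [bannaiIto, eta, hyp43, poch]
  unfold bannaiIto eta hyp43
  dsimp only
  have hp : n % 2 < 2 := Nat.mod_lt _ (by norm_num)
  have hpos : 1 ≤ n / 2 + n % 2 := by omega
  generalize n / 2 = e at *
  generalize n % 2 = p at *
  rw [Nat.sub_add_cancel hpos]
  have hcast : (-((e + p - 1 : ℕ) : K)) = -(e : K) - p + 1 := by
    rw [Nat.cast_sub hpos]
    push_cast
    ring
  rw [hcast]
  generalize ρ₁ + ρ₂ - r₁ - r₂ = g
  have e₁ : ρ₁ - r₁ + 3 / 2 = ρ₁ - r₁ + 1 / 2 + 1 := by ring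
  have e₂ : ρ₂ - r₁ + 3 / 2 = ρ₂ - r₁ + 1 / 2 + 1 := by ring
  rw [e₁, e₂]
  generalize ρ₁ - r₁ + 1 / 2 = a at *
  generalize ρ₂ - r₁ + 1 / 2 = b at *
  generalize 1 - r₁ - r₂ = d at *
  have key : ∀ S₁ S₂ T₁ T₂ u v D : K,
      S₁ = poch a (e + p) * poch b (e + p) * poch d e * T₁ →
      S₂ = poch a (e + p) * poch b (e + p) * poch d e * (T₂ / (a * b)) →
      u / D * (S₁ + v * S₂) =
        u * (poch a (e + p) * poch b (e + p) * poch d e) / D * (T₁ + v / (a * b) * T₂) := by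
    rintro S₁ S₂ T₁ T₂ u v D rfl rfl
    ring
  apply key
  · rw [Finset.mul_sum]
    refine Finset.sum_congr rfl fun k hk => ?_
    have hk' : k ≤ e := Nat.lt_succ_iff.mp (Finset.mem_range.mp hk)
    have ha := poch_ne_zero_of_le (le_trans hk' (Nat.le_add_right e p)) h₁
    have hb := poch_ne_zero_of_le (le_trans hk' (Nat.le_add_right e p)) h₂
    have hd := poch_ne_zero_of_le hk' h₃
    have hf : ((k ! : ℕ) : K) ≠ 0 := Nat.cast_ne_zero.mpr (Nat.factorial_ne_zero k)
    rw [poch_split a (le_trans hk' (Nat.le_add_right e p)),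
      poch_split b (le_trans hk' (Nat.le_add_right e p)), poch_split d hk']
    field_simp
  · rw [Finset.sum_div, Finset.mul_sum]
    refine Finset.sum_congr rfl fun k hk => ?_
    have hk₁ : k + 1 ≤ e + p := Finset.mem_range.mp hk
    have hk' : k ≤ e := by omega
    have ha := poch_ne_zero_of_le hk₁ h₁
    have hb := poch_ne_zero_of_le hk₁ h₂
    have hd := poch_ne_zero_of_le hk' h₃
    have hf : ((k ! : ℕ) : K) ≠ 0 := Nat.cast_ne_zero.mpr (Nat.factorial_ne_zero k)
    rw [poch_split a hk₁, poch_split b hk₁, poch_split d hk']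
    rw [poch_succ_left] at ha hb
    rw [poch_succ_left a, poch_succ_left b]
    have ha₁ := left_ne_zero_of_mul ha
    have ha₂ := right_ne_zero_of_mul ha
    have hb₁ := left_ne_zero_of_mul hb
    have hb₂ := right_ne_zero_of_mul hb
    push_cast
    field_simp

/-- The first factor `B_{n₁}(z₁ - 1/4; ρ₁⁽¹⁾, ρ₂⁽¹⁾, r₁⁽¹⁾, r₂⁽¹⁾)` is `firstBI` evaluated at
`x = z₁ - 1/4`; its parameters involve `z₂`. -/
def firstBI (p₁ p₂ c : K) (n₁ : ℕ) (z₂ x : K) : K :=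
  bannaiIto n₁ (c - p₁ + 1 / 2) (z₂ + p₂ - 1 / 4) (1 / 2 - p₁) (z₂ - p₂ + 1 / 4) x

/-- The second factor `B_{n₂}((-1)^{n₁} z₂ - 1/4; ρ₁⁽²⁾, ρ₂⁽²⁾, r₁⁽²⁾, r₂⁽²⁾)` is `secondBI`
evaluated at `x = (-1)^{n₁} z₂ - 1/4`; its parameters involve `n₁` and `N`. -/
def secondBI (p₁ p₂ p₃ c : K) (N n₁ n₂ : ℕ) (x : K) : K :=
  bannaiIto n₂
    (((n₁ : K) + 1) / 2 + c + p₂ - p₁)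
    (p₃ - (-1) ^ (n₁ + N) * ((N : K) / 2 + p₁ + p₂ + p₃))
    ((1 - (n₁ : K)) / 2 - p₁ - p₂)
    (-p₃ - (-1) ^ (n₁ + N) * ((N : K) / 2 + p₁ + p₂ + p₃)) x

/-- The truncated bivariate Bannai-Ito polynomial `B_{n₁,n₂}(z₁,z₂)`. -/
def bivariateBI (p₁ p₂ p₃ c : K) (N n₁ n₂ : ℕ) (z₁ z₂ : K) : K :=
  firstBI p₁ p₂ c n₁ z₂ (z₁ - 1 / 4) * secondBI p₁ p₂ p₃ c N n₁ n₂ ((-1) ^ n₁ * z₂ - 1 / 4)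

/-- The grid `z₁(r)`, which also depends on `s`. -/
def gridZ1 (p₁ : K) (N r s : ℕ) : K :=
  1 / 2 * ((-1) ^ (r + s + N) * ((r : K) + s - N - 2 * p₁ + 1 / 2))

/-- The grid `z₂(s)`. -/
def gridZ2 (p₁ p₂ : K) (N s : ℕ) : K :=
  1 / 2 * ((-1) ^ (s + N) * ((s : K) - N - 2 * p₁ - 2 * p₂ + 1 / 2))

/-- The weight `w⁽¹⁾_{2r,2s}`. -/
def weight1EE (p₁ p₂ c : K) (r s : ℕ) : K :=
  (poch (2 * p₂) r * poch (-(s : K)) r * poch (1 - 2 * p₁ - 2 * s) r *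
      poch (3 / 2 + c - 2 * p₁ - s) r) /
    ((r ! : K) * poch (1 / 2 - c - s) r * poch (1 - 2 * p₁ - s) r *
      poch (1 - 2 * p₁ - 2 * p₂ - 2 * s) r)

/-- The weight `w⁽¹⁾_{2r+1,2s}`. -/
def weight1OE (p₁ p₂ c : K) (r s : ℕ) : K :=
  -((poch (2 * p₂) (r + 1) * poch (-(s : K)) (r + 1) * poch (1 - 2 * p₁ - 2 * s) r *
      poch (3 / 2 + c - 2 * p₁ - s) r) /
    ((r ! : K) * poch (1 / 2 - c - s) r * poch (1 - 2 * p₁ - s) (r + 1) *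
      poch (1 - 2 * p₁ - 2 * p₂ - 2 * s) (r + 1)))

/-- The weight `w⁽¹⁾_{2r,2s+1}`. -/
def weight1EO (p₁ p₂ c : K) (r s : ℕ) : K :=
  (poch (2 * p₂) r * poch (-(s : K)) r * poch (-2 * p₁ - 2 * s) r *
      poch (1 / 2 + c - 2 * p₁ - s) r) /
    ((r ! : K) * poch (-(1 / 2) - c - s) r * poch (1 - 2 * p₁ - s) r *
      poch (-2 * p₁ - 2 * p₂ - 2 * s) r)

/-- The weight `w⁽¹⁾_{2r+1,2s+1}`. -/
def weight1OO (p₁ p₂ c : K) (r s : ℕ) : K :=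
  -((poch (2 * p₂) (r + 1) * poch (-(s : K)) r * poch (-2 * p₁ - 2 * s) r *
      poch (1 / 2 + c - 2 * p₁ - s) (r + 1)) /
    ((r ! : K) * poch (-(1 / 2) - c - s) (r + 1) * poch (1 - 2 * p₁ - s) r *
      poch (-2 * p₁ - 2 * p₂ - 2 * s) (r + 1)))

/-- The weight `w⁽¹⁾_{R,S}`. For `R > S` the numerator contains a vanishing factor, and the weight
is `0`. -/
def weight1 (p₁ p₂ c : K) (R S : ℕ) : K :=
  if S % 2 = 0 then
    if R % 2 = 0 then weight1EE p₁ p₂ c (R / 2) (S / 2) else weight1OE p₁ p₂ c (R / 2) (S / 2)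
  else
    if R % 2 = 0 then weight1EO p₁ p₂ c (R / 2) (S / 2) else weight1OO p₁ p₂ c (R / 2) (S / 2)

/-- The weight `w⁽²⁾_{2s,2N}`, `s ≤ N`. -/
def weight2EE (p₁ p₂ p₃ c : K) (s N : ℕ) : K :=
  ((-1) ^ s * (N.choose s : K) * poch (3 / 2 + c - 2 * p₁ - N) s *
      poch (1 - 2 * p₁ - 2 * p₂ - 2 * N) s * poch (1 / 2 + 2 * p₃) s) /
    ((N ! : K) * poch (1 / 2 - c - N) s * poch (1 - 2 * p₁ - 2 * p₂ - 2 * N) (2 * s) *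
      poch (1 / 2 - 2 * p₁ - 2 * p₂ - 2 * p₃ - 2 * N) s *
      poch (1 - 2 * p₁ - 2 * N + 2 * s) (N - s))

/-- The weight `w⁽²⁾_{2s+1,2N}`, `s ≤ N - 1`. -/
def weight2OE (p₁ p₂ p₃ c : K) (s N : ℕ) : K :=
  ((-1) ^ s * ((N - 1).choose s : K) * poch (3 / 2 + c - 2 * p₁ - N) s *
      poch (1 - 2 * p₁ - 2 * p₂ - 2 * N) s * poch (1 / 2 + 2 * p₃) (s + 1)) /
    (((N - 1) ! : K) * poch (1 / 2 - c - N) s *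
      poch (1 - 2 * p₁ - 2 * p₂ - 2 * N) (2 * s + 1) *
      poch (1 / 2 - 2 * p₁ - 2 * p₂ - 2 * p₃ - 2 * N) (s + 1) *
      poch (2 - 2 * p₁ - 2 * N + 2 * s) (N - s))

/-- The weight `w⁽²⁾_{2s,2N+1}`, `s ≤ N`. -/
def weight2EO (p₁ p₂ p₃ c : K) (s N : ℕ) : K :=
  ((-1) ^ s * (N.choose s : K) * poch (1 / 2 + c - 2 * p₁ - N) s *
      poch (-2 * p₁ - 2 * p₂ - 2 * N) s * poch (1 / 2 + 2 * p₃) s) /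
    ((N ! : K) * poch (-(1 / 2) - c - N) s * poch (-2 * p₁ - 2 * p₂ - 2 * N) (2 * s) *
      poch (-(1 / 2) - 2 * p₁ - 2 * p₂ - 2 * p₃ - 2 * N) s *
      poch (-2 * p₁ - 2 * N + 2 * s) (N + 1 - s))

/-- The weight `w⁽²⁾_{2s+1,2N+1}`, `s ≤ N`. -/
def weight2OO (p₁ p₂ p₃ c : K) (s N : ℕ) : K :=
  ((-1) ^ (s + 1) * (N.choose s : K) * poch (1 / 2 + c - 2 * p₁ - N) (s + 1) *
      poch (-2 * p₁ - 2 * p₂ - 2 * N) s * poch (1 / 2 + 2 * p₃) (s + 1)) /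
    ((N ! : K) * poch (-(1 / 2) - c - N) (s + 1) *
      poch (-2 * p₁ - 2 * p₂ - 2 * N) (2 * s + 1) *
      poch (-(1 / 2) - 2 * p₁ - 2 * p₂ - 2 * p₃ - 2 * N) (s + 1) *
      poch (1 - 2 * p₁ - 2 * N + 2 * s) (N - s))

/-- The weight `w⁽²⁾_{S,M}`, `S ≤ M`. -/
def weight2 (p₁ p₂ p₃ c : K) (S M : ℕ) : K :=
  if M % 2 = 0 then
    if S % 2 = 0 then weight2EE p₁ p₂ p₃ c (S / 2) (M / 2)
    else weight2OE p₁ p₂ p₃ c (S / 2) (M / 2)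
  else
    if S % 2 = 0 then weight2EO p₁ p₂ p₃ c (S / 2) (M / 2)
    else weight2OO p₁ p₂ p₃ c (S / 2) (M / 2)

/-- The normalization coefficient `H_{2n₁,2n₂,2N}`. -/
def normEEE (p₁ p₂ p₃ c : K) (n₁ n₂ N : ℕ) : K :=
    ((n₁ ! : K) * (n₂ ! : K) * pochZ (2 * p₂) (n₁) * pochZ (2 * p₃ + 1 / 2) (n₂) *
      pochZ (c + n₁ + 2 * p₂ + 1 / 2) (N) * pochZ (c - N - 2 * p₁ + 3 / 2) (n₁ + n₂) *
      pochZ (c + N + n₁ + 2 * p₂ + 2 * p₃ + 1) (n₂) *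
      pochZ (c + 2 * n₁ + n₂ + 2 * p₂ + 2 * p₃ + 1) (N - n₁ - n₂)) /
    (((N - n₁ - n₂) ! : K) * pochZ (c + n₁ + 1 / 2) (N - n₁) *
      (pochZ (c + n₁ + 2 * p₂ + 1 / 2) (n₁)) ^ 2 *
      pochZ (c + 2 * n₁ + n₂ + 2 * p₂ + 1 / 2) (N - n₁ - n₂) *
      (pochZ (c + 2 * n₁ + n₂ + 2 * p₂ + 2 * p₃ + 1) (n₂)) ^ 2 *
      pochZ (-2 * N - 2 * p₁ - 2 * p₂ - 2 * p₃ + 1 / 2) (N - n₁ - n₂))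

/-- The normalization coefficient `H_{2n₁+1,2n₂,2N}`. -/
def normOEE (p₁ p₂ p₃ c : K) (n₁ n₂ N : ℕ) : K :=
    ((n₁ ! : K) * (n₂ ! : K) * pochZ (2 * p₂) (n₁ + 1) * pochZ (2 * p₃ + 1 / 2) (n₂) *
      pochZ (c + n₁ + 2 * p₂ + 1 / 2) (N) * pochZ (c - N - 2 * p₁ + 3 / 2) (n₁ + n₂) *
      pochZ (c + N + n₁ + 2 * p₂ + 2 * p₃ + 2) (n₂) *
      pochZ (c + 2 * n₁ + n₂ + 2 * p₂ + 2 * p₃ + 2) (N - n₁ - n₂)) /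
    (((N - n₁ - n₂ - 1) ! : K) * pochZ (c + n₁ + 3 / 2) (N - n₁ - 1) *
      (pochZ (c + n₁ + 2 * p₂ + 1 / 2) (n₁ + 1)) ^ 2 *
      pochZ (c + 2 * n₁ + n₂ + 2 * p₂ + 3 / 2) (N - n₁ - n₂ - 1) *
      (pochZ (c + 2 * n₁ + n₂ + 2 * p₂ + 2 * p₃ + 2) (n₂)) ^ 2 *
      pochZ (-2 * N - 2 * p₁ - 2 * p₂ - 2 * p₃ + 1 / 2) (N - n₁ - n₂))

/-- The normalization coefficient `H_{2n₁,2n₂+1,2N}`. -/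
def normEOE (p₁ p₂ p₃ c : K) (n₁ n₂ N : ℕ) : K :=
    ((n₁ ! : K) * (n₂ ! : K) * pochZ (2 * p₂) (n₁) * pochZ (2 * p₃ + 1 / 2) (n₂ + 1) *
      pochZ (c + n₁ + 2 * p₂ + 1 / 2) (N) * pochZ (c - N - 2 * p₁ + 3 / 2) (n₁ + n₂) *
      pochZ (c + N + n₁ + 2 * p₂ + 2 * p₃ + 1) (n₂ + 1) *
      pochZ (c + 2 * n₁ + n₂ + 2 * p₂ + 2 * p₃ + 1) (N - n₁ - n₂)) /
    (((N - n₁ - n₂ - 1) ! : K) * pochZ (c + n₁ + 1 / 2) (N - n₁) *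
      (pochZ (c + n₁ + 2 * p₂ + 1 / 2) (n₁)) ^ 2 *
      pochZ (c + 2 * n₁ + n₂ + 2 * p₂ + 3 / 2) (N - n₁ - n₂ - 1) *
      (pochZ (c + 2 * n₁ + n₂ + 2 * p₂ + 2 * p₃ + 1) (n₂ + 1)) ^ 2 *
      pochZ (-2 * N - 2 * p₁ - 2 * p₂ - 2 * p₃ + 1 / 2) (N - n₁ - n₂))

/-- The normalization coefficient `H_{2n₁+1,2n₂+1,2N}`. -/
def normOOE (p₁ p₂ p₃ c : K) (n₁ n₂ N : ℕ) : K :=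
    ((n₁ ! : K) * (n₂ ! : K) * pochZ (2 * p₂) (n₁ + 1) * pochZ (2 * p₃ + 1 / 2) (n₂ + 1) *
      pochZ (c + n₁ + 2 * p₂ + 1 / 2) (N) * pochZ (c - N - 2 * p₁ + 3 / 2) (n₁ + n₂ + 1) *
      pochZ (c + N + n₁ + 2 * p₂ + 2 * p₃ + 2) (n₂) *
      pochZ (c + 2 * n₁ + n₂ + 2 * p₂ + 2 * p₃ + 2) (N - n₁ - n₂)) /
    (((N - n₁ - n₂ - 1) ! : K) * pochZ (c + n₁ + 3 / 2) (N - n₁ - 1) *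
      (pochZ (c + n₁ + 2 * p₂ + 1 / 2) (n₁ + 1)) ^ 2 *
      pochZ (c + 2 * n₁ + n₂ + 2 * p₂ + 5 / 2) (N - n₁ - n₂ - 2) *
      (pochZ (c + 2 * n₁ + n₂ + 2 * p₂ + 2 * p₃ + 2) (n₂ + 1)) ^ 2 *
      pochZ (-2 * N - 2 * p₁ - 2 * p₂ - 2 * p₃ + 1 / 2) (N - n₁ - n₂ - 1))

/-- The normalization coefficient `H_{2n₁,2n₂,2N+1}`. -/
def normEEO (p₁ p₂ p₃ c : K) (n₁ n₂ N : ℕ) : K :=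
    ((n₁ ! : K) * (n₂ ! : K) * pochZ (2 * p₂) (n₁) * pochZ (2 * p₃ + 1 / 2) (n₂) *
      pochZ (c + n₁ + 2 * p₂ + 1 / 2) (N) * pochZ (c - N - 2 * p₁ + 1 / 2) (n₁ + n₂) *
      pochZ (c + N + n₁ + 2 * p₂ + 2 * p₃ + 2) (n₂) *
      pochZ (c + 2 * n₁ + n₂ + 2 * p₂ + 2 * p₃ + 1) (N - n₁ - n₂ + 1)) /
    (((N - n₁ - n₂) ! : K) * pochZ (c + n₁ + 1 / 2) (N - n₁ + 1) *
      (pochZ (c + n₁ + 2 * p₂ + 1 / 2) (n₁)) ^ 2 *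
      pochZ (c + 2 * n₁ + n₂ + 2 * p₂ + 1 / 2) (N - n₁ - n₂) *
      (pochZ (c + 2 * n₁ + n₂ + 2 * p₂ + 2 * p₃ + 1) (n₂)) ^ 2 *
      pochZ (-2 * N - 2 * p₁ - 2 * p₂ - 2 * p₃ - 1 / 2) (N - n₁ - n₂ + 1))

/-- The normalization coefficient `H_{2n₁+1,2n₂,2N+1}`. -/
def normOEO (p₁ p₂ p₃ c : K) (n₁ n₂ N : ℕ) : K :=
    ((n₁ ! : K) * (n₂ ! : K) * pochZ (2 * p₂) (n₁ + 1) * pochZ (2 * p₃ + 1 / 2) (n₂) *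
      pochZ (c + n₁ + 2 * p₂ + 1 / 2) (N) * pochZ (c - N - 2 * p₁ + 1 / 2) (n₁ + n₂ + 1) *
      pochZ (c + N + n₁ + 2 * p₂ + 2 * p₃ + 2) (n₂) *
      pochZ (c + 2 * n₁ + n₂ + 2 * p₂ + 2 * p₃ + 2) (N - n₁ - n₂)) /
    (((N - n₁ - n₂) ! : K) * pochZ (c + n₁ + 3 / 2) (N - n₁) *
      (pochZ (c + n₁ + 2 * p₂ + 1 / 2) (n₁ + 1)) ^ 2 *
      pochZ (c + 2 * n₁ + n₂ + 2 * p₂ + 3 / 2) (N - n₁ - n₂ - 1) *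
      (pochZ (c + 2 * n₁ + n₂ + 2 * p₂ + 2 * p₃ + 2) (n₂)) ^ 2 *
      pochZ (-2 * N - 2 * p₁ - 2 * p₂ - 2 * p₃ - 1 / 2) (N - n₁ - n₂))

/-- The normalization coefficient `H_{2n₁,2n₂+1,2N+1}`. -/
def normEOO (p₁ p₂ p₃ c : K) (n₁ n₂ N : ℕ) : K :=
    ((n₁ ! : K) * (n₂ ! : K) * pochZ (2 * p₂) (n₁) * pochZ (2 * p₃ + 1 / 2) (n₂ + 1) *
      pochZ (c + n₁ + 2 * p₂ + 1 / 2) (N) * pochZ (c - N - 2 * p₁ + 1 / 2) (n₁ + n₂ + 1) *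
      pochZ (c + N + n₁ + 2 * p₂ + 2 * p₃ + 1) (n₂ + 1) *
      pochZ (c + 2 * n₁ + n₂ + 2 * p₂ + 2 * p₃ + 1) (N - n₁ - n₂)) /
    (((N - n₁ - n₂) ! : K) * pochZ (c + n₁ + 1 / 2) (N - n₁ + 1) *
      (pochZ (c + n₁ + 2 * p₂ + 1 / 2) (n₁)) ^ 2 *
      pochZ (c + 2 * n₁ + n₂ + 2 * p₂ + 3 / 2) (N - n₁ - n₂ - 1) *
      (pochZ (c + 2 * n₁ + n₂ + 2 * p₂ + 2 * p₃ + 1) (n₂ + 1)) ^ 2 *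
      pochZ (-2 * N - 2 * p₁ - 2 * p₂ - 2 * p₃ - 1 / 2) (N - n₁ - n₂))

/-- The normalization coefficient `H_{2n₁+1,2n₂+1,2N+1}`. -/
def normOOO (p₁ p₂ p₃ c : K) (n₁ n₂ N : ℕ) : K :=
    ((n₁ ! : K) * (n₂ ! : K) * pochZ (2 * p₂) (n₁ + 1) * pochZ (2 * p₃ + 1 / 2) (n₂ + 1) *
      pochZ (c + n₁ + 2 * p₂ + 1 / 2) (N) * pochZ (c - N - 2 * p₁ + 1 / 2) (n₁ + n₂ + 1) *
      pochZ (c + N + n₁ + 2 * p₂ + 2 * p₃ + 2) (n₂ + 1) *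
      pochZ (c + 2 * n₁ + n₂ + 2 * p₂ + 2 * p₃ + 2) (N - n₁ - n₂)) /
    (((N - n₁ - n₂ - 1) ! : K) * pochZ (c + n₁ + 3 / 2) (N - n₁) *
      (pochZ (c + n₁ + 2 * p₂ + 1 / 2) (n₁ + 1)) ^ 2 *
      pochZ (c + 2 * n₁ + n₂ + 2 * p₂ + 5 / 2) (N - n₁ - n₂ - 2) *
      (pochZ (c + 2 * n₁ + n₂ + 2 * p₂ + 2 * p₃ + 2) (n₂ + 1)) ^ 2 *
      pochZ (-2 * N - 2 * p₁ - 2 * p₂ - 2 * p₃ - 1 / 2) (N - n₁ - n₂))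

/-- The normalization coefficient `H_{m₁,m₂,M}`, `m₁ + m₂ ≤ M`. -/
def bivariateNorm (p₁ p₂ p₃ c : K) (m₁ m₂ M : ℕ) : K :=
  if M % 2 = 0 then
    if m₁ % 2 = 0 then
      if m₂ % 2 = 0 then normEEE p₁ p₂ p₃ c (m₁ / 2) (m₂ / 2) (M / 2)
      else normEOE p₁ p₂ p₃ c (m₁ / 2) (m₂ / 2) (M / 2)
    else
      if m₂ % 2 = 0 then normOEE p₁ p₂ p₃ c (m₁ / 2) (m₂ / 2) (M / 2)
      else normOOE p₁ p₂ p₃ c (m₁ / 2) (m₂ / 2) (M / 2)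
  else
    if m₁ % 2 = 0 then
      if m₂ % 2 = 0 then normEEO p₁ p₂ p₃ c (m₁ / 2) (m₂ / 2) (M / 2)
      else normEOO p₁ p₂ p₃ c (m₁ / 2) (m₂ / 2) (M / 2)
    else
      if m₂ % 2 = 0 then normOEO p₁ p₂ p₃ c (m₁ / 2) (m₂ / 2) (M / 2)
      else normOOO p₁ p₂ p₃ c (m₁ / 2) (m₂ / 2) (M / 2)

/-- The function `f` is given by a monic polynomial of degree `n`. -/
def IsMonicPolynomialFun (f : K → K) (n : ℕ) : Prop :=
  ∃ P : Polynomial K, P.Monic ∧ P.natDegree = n ∧ ∀ x, f x = P.eval x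

end BivariateBI

/-!
# Orthogonality of the truncated bivariate Bannai-Ito polynomials

The double sum is evaluated one variable at a time, and both steps are instances of the same
univariate orthogonality relation.

**Univariate orthogonality.** Let `T` be the first-order Dunkl-type operator `biOp`, built from the
reflections `x ↦ -x` and `x ↦ -x - 1`. The grid `gridPt r₁` starts at the fixed point `r₁ - 1 / 2`
and visits the points obtained from it by applying the two reflections alternately. On the Newton
polynomials of this grid `T` is triangular with a single off-diagonal (`biOp_newton_succ`).
The two hypergeometric sums defining a Bannai-Ito polynomial are precisely the even and the odd
part of an expansion in these Newton polynomials (`bannaiIto_eq_sum`), and its coefficients satisfy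
the two-term recursion characterizing an eigenvector of `T` (`biCoeff_recursion`). Since the
expansion has leading coefficient one, the polynomials are monic.

If a parameter is chosen so that `T` does not leave the first `S + 1` grid points, then `T` acts on
functions on these points as a tridiagonal operator (`IsTruncated.tridiag_onGrid`). The first weight
satisfies detailed balance for it (`IsRegular.isBalanced`), so `T` is symmetric for the
corresponding bilinear form, and eigenvectors with different eigenvalues are orthogonal.
The norm of the eigenvector of degree `n` is found without any summation. Its pairings with
consecutive Newton polynomials have known ratios, and the Newton polynomial of degree `S` vanishes
at all grid points but the last (`form_eigen_norm`). What is left is the value of the polynomial at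
the last point, which is the leading term of its expansion in the Newton basis that starts at the
other end of the grid (`IsTruncated.bannaiIto_last_of_basis`).

**The two sums.** For fixed `s` the sum over `r` is the univariate relation on a grid of size
`N - s + 1`, so it contributes a Kronecker delta and a norm `uniNorm p₁ p₂ c n (N - s)`, which
vanishes when `N - s < n`. The key point is that `w⁽²⁾` times this norm is, as a function of `s`,
a multiple of the *first* weight for the parameters
`p₁ + p₂ + n / 2`, `p₃ + 1 / 4`, `c + n + 2 p₂` (`IsAdmissible.weight2_mul_uniNorm`). The factor
depending on `z₂` alone is a first factor for these same parameters (`secondBI_eq_firstBI`), hence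
the sum over `s` is again the univariate relation.
The constant `H` is therefore the product of `w⁽²⁾` at `s = 0` and two univariate norms
(`IsAdmissible.norm_eq`).

The suffixes `EE`, `OE`, `EO`, `OO` record the parity (even or odd) of the degree or grid index,
followed by that of the size of the grid, as they do for the weights; `normEEO` and the like record
the parities of the two degrees and of `N`.
-/

namespace BivariateBI

/-! ### Operators that are triangular in a sequence of vectors and symmetric for a form -/

section Triangular

variable {K V : Type*} [Field K] [AddCommGroup V] [Module K V]
  {T : V →ₗ[K] V} {vec : ℕ → V} {ev low : ℕ → K}

/-- A combination `∑ b_k vec_k` whose coefficients satisfy the two-term recursion is an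
eigenvector: the term that `T` lowers from `vec_{k+1}` to `vec_k` compensates the wrong eigenvalue
of `vec_k`. -/
theorem eigen_of_recursion (h₀ : T (vec 0) = ev 0 • vec 0)
    (hs : ∀ n, T (vec (n + 1)) = ev (n + 1) • vec (n + 1) + low n • vec n)
    {n : ℕ} {b : ℕ → K} (hb : ∀ k < n, b k * (ev n - ev k) = low k * b (k + 1)) :
    T (∑ k ∈ Finset.range (n + 1), b k • vec k) =
      ev n • ∑ k ∈ Finset.range (n + 1), b k • vec k := by
  -- A partial sum is an eigenvector up to its topmost term, and the defect vanishes at `m = n`.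
  have key : ∀ m ≤ n, T (∑ k ∈ Finset.range (m + 1), b k • vec k) =
      ev n • (∑ k ∈ Finset.range (m + 1), b k • vec k) - (b m * (ev n - ev m)) • vec m := by
    intro m
    induction m with
    | zero =>
      intro _
      simp only [zero_add, Finset.sum_range_one, map_smul, h₀]
      module
    | succ m ih =>
      intro hm
      rw [Finset.sum_range_succ, map_add, ih (by omega), map_smul, hs, hb m (by omega)]
      module
  rw [key n le_rfl]
  simp

/-- An eigenvector in the span of `vec_0, …, vec_{m-1}` whose eigenvalue is not among
`ev 0, …, ev (m - 1)` vanishes. -/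
theorem eigen_eq_zero (h₀ : T (vec 0) = ev 0 • vec 0)
    (hs : ∀ n, T (vec (n + 1)) = ev (n + 1) • vec (n + 1) + low n • vec n) (μ : K) :
    ∀ (m : ℕ) (c : ℕ → K), (∀ k < m, μ ≠ ev k) →
      T (∑ k ∈ Finset.range m, c k • vec k) = μ • ∑ k ∈ Finset.range m, c k • vec k →
      ∑ k ∈ Finset.range m, c k • vec k = 0 := by
  intro m
  induction m with
  | zero => intro c _ _; simp
  | succ m ih =>
    intro c hμ hT
    -- `T - ev m` maps the span of `vec_0, …, vec_m` into the span of `vec_0, …, vec_{m-1}`.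
    have hlow : ∀ m : ℕ, ∃ c' : ℕ → K, ∀ a : K,
        T (∑ k ∈ Finset.range (m + 1), c k • vec k) - a • ∑ k ∈ Finset.range (m + 1), c k • vec k =
          ∑ k ∈ Finset.range m, (c' k - a * c k) • vec k + (c m * (ev m - a)) • vec m := by
      intro m
      induction m with
      | zero =>
        refine ⟨0, fun a => ?_⟩
        simp only [zero_add, Finset.sum_range_one, map_smul, h₀, Finset.sum_range_zero]
        module
      | succ m ih =>
        obtain ⟨c', hc'⟩ := ih
        refine ⟨fun k => if k = m then c m * ev m + c (m + 1) * low m else c' k, fun a => ?_⟩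
        rw [Finset.sum_range_succ _ (m + 1), map_add, smul_add, add_sub_add_comm, hc',
          Finset.sum_range_succ _ m, map_smul, hs]
        have : ∑ k ∈ Finset.range m, ((if k = m then c m * ev m + c (m + 1) * low m else c' k) -
            a * c k) • vec k = ∑ k ∈ Finset.range m, (c' k - a * c k) • vec k := by
          refine Finset.sum_congr rfl fun k hk => ?_
          rw [if_neg (Finset.mem_range.mp hk).ne]
        simp only [this, ↓reduceIte]
        module
    obtain ⟨c', hc'⟩ := hlow m
    have hne : μ - ev m ≠ 0 := sub_ne_zero.mpr (hμ m (Nat.lt_succ_self m))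
    have h1 := hc' (ev m)
    rw [hT, sub_self, mul_zero, zero_smul, add_zero, ← sub_smul] at h1
    have h2 := ih (fun k => c' k - ev m * c k) (fun k hk => hμ k (by omega)) (by
      simp only [← h1]
      rw [map_smul, hT, smul_comm])
    rw [h2] at h1
    exact (smul_eq_zero.mp h1).resolve_left hne

variable {B : V →ₗ[K] V →ₗ[K] K}

theorem form_eigen_zero (h₀ : T (vec 0) = ev 0 • vec 0) (hB : ∀ v w, B (T v) w = B v (T w))
    {P : V} {μ : K} (hP : T P = μ • P) (hμ : μ ≠ ev 0) : B P (vec 0) = 0 := by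
  have h := hB P (vec 0)
  rw [hP, h₀] at h
  simp only [map_smul, LinearMap.smul_apply, smul_eq_mul] at h
  have : (μ - ev 0) * B P (vec 0) = 0 := by linear_combination h
  exact (mul_eq_zero.mp this).resolve_left (sub_ne_zero.mpr hμ)

theorem form_eigen_succ (hs : ∀ n, T (vec (n + 1)) = ev (n + 1) • vec (n + 1) + low n • vec n)
    (hB : ∀ v w, B (T v) w = B v (T w)) {P : V} {μ : K} (hP : T P = μ • P) (n : ℕ) :
    (μ - ev (n + 1)) * B P (vec (n + 1)) = low n * B P (vec n) := by
  have h := hB P (vec (n + 1))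
  rw [hP, hs] at h
  simp only [map_smul, map_add, LinearMap.smul_apply, smul_eq_mul] at h
  linear_combination h

theorem form_eigen_eq_zero (h₀ : T (vec 0) = ev 0 • vec 0)
    (hs : ∀ n, T (vec (n + 1)) = ev (n + 1) • vec (n + 1) + low n • vec n)
    (hB : ∀ v w, B (T v) w = B v (T w)) {P : V} {μ : K} (hP : T P = μ • P) {n : ℕ}
    (hμ : ∀ k < n, μ ≠ ev k) : ∀ k < n, B P (vec k) = 0 := by
  intro k
  induction k with
  | zero => exact fun hk => form_eigen_zero h₀ hB hP (hμ 0 hk)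
  | succ k ih =>
    intro hk
    have h := form_eigen_succ hs hB hP k
    rw [ih (by omega), mul_zero] at h
    exact (mul_eq_zero.mp h).resolve_left (sub_ne_zero.mpr (hμ _ hk))

theorem form_eigen_orthogonal (hB : ∀ v w, B (T v) w = B v (T w)) {P Q : V} {μ ν : K}
    (hP : T P = μ • P) (hQ : T Q = ν • Q) (hμν : μ ≠ ν) : B P Q = 0 := by
  have h := hB P Q
  rw [hP, hQ] at h
  simp only [map_smul, LinearMap.smul_apply, smul_eq_mul] at h
  have : (μ - ν) * B P Q = 0 := by linear_combination h
  exact (mul_eq_zero.mp this).resolve_left (sub_ne_zero.mpr hμν)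

/-- The norm of the monic eigenvector `P_n`, expressed by its pairing with a later vector `vec_S`.
As `P_n` is orthogonal to the earlier vectors, its norm is its pairing with `vec_n`; symmetry of `T`
gives the ratios of the pairings with `vec_n, vec_{n+1}, …, vec_S`. -/
theorem form_eigen_norm (h₀ : T (vec 0) = ev 0 • vec 0)
    (hs : ∀ n, T (vec (n + 1)) = ev (n + 1) • vec (n + 1) + low n • vec n)
    (hB : ∀ v w, B (T v) w = B v (T w)) {n S : ℕ} (hnS : n ≤ S) {b : ℕ → K} (hbn : b n = 1)
    (hb : ∀ k < n, b k * (ev n - ev k) = low k * b (k + 1))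
    (hev : ∀ k ≤ S, k ≠ n → ev n ≠ ev k) (hlow : ∀ k < S, low k ≠ 0) :
    B (∑ k ∈ Finset.range (n + 1), b k • vec k) (∑ k ∈ Finset.range (n + 1), b k • vec k) =
      B (∑ k ∈ Finset.range (n + 1), b k • vec k) (vec S) *
        ∏ k ∈ Finset.Ico n S, (ev n - ev (k + 1)) / low k := by
  have hP := eigen_of_recursion h₀ hs hb
  generalize hPdef : ∑ k ∈ Finset.range (n + 1), b k • vec k = P at hP
  have hz := form_eigen_eq_zero h₀ hs hB hP (n := n) (fun k hk => hev k (by omega) (by omega))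
  have h1 : B P P = B P (vec n) := by
    have h2 : B P (∑ k ∈ Finset.range (n + 1), b k • vec k) = B P P := by rw [hPdef]
    rw [← h2, Finset.sum_range_succ, map_add, map_sum, Finset.sum_eq_zero, hbn]
    · simp
    · intro k hk
      rw [map_smul, hz k (Finset.mem_range.mp hk), smul_zero]
  rw [h1]
  induction S, hnS using Nat.le_induction with
  | base => simp
  | succ S hS ih =>
    rw [ih (fun k hk => hev k (by omega)) (fun k hk => hlow k (by omega)),
      Finset.prod_Ico_succ_top hS]
    have h := form_eigen_succ hs hB hP S
    have hl := hlow S (by omega)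
    field_simp
    linear_combination -(∏ k ∈ Finset.Ico n S, (ev n - ev (k + 1)) / low k) * h

end Triangular

/-! ### The Dunkl-type Bannai-Ito operator on Newton polynomials -/

section Operator

variable {K : Type*} [Field K]

/-- The Bannai-Ito grid that starts at `r - 1 / 2`. Its points are linked alternately by the
reflections `x ↦ -x` and `x ↦ -x - 1`. -/
def gridPt (r : K) (k : ℕ) : K := if Even k then r - 1 / 2 - k / 2 else (k : K) / 2 - r

/-- The Newton polynomial that vanishes at the first `n` points of `gridPt r`. -/
def newton (r : K) (n : ℕ) (x : K) : K := ∏ k ∈ Finset.range n, (x - gridPt r k)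

/-- The first-order Dunkl-type difference operator whose eigenfunctions are the Bannai-Ito
polynomials. -/
def biOp (ρ₁ ρ₂ r₁ r₂ : K) (f : K → K) (x : K) : K :=
  (x - ρ₁) * (x - ρ₂) / (2 * x) * (f x - f (-x)) +
    (x - r₁ + 1 / 2) * (x - r₂ + 1 / 2) / (2 * x + 1) * (f (-x - 1) - f x)

/-- The eigenvalues of `biOp`, with `g = ρ₁ + ρ₂ - r₁ - r₂`. -/
def biEig (g : K) (n : ℕ) : K := if Even n then (n : K) / 2 else -((n : K) + 1) / 2 - g

/-- The coefficient of `newton r₁ k` in the image of `newton r₁ (k + 1)` under `biOp`. -/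
def biLow (ρ₁ ρ₂ r₁ r₂ : K) (k : ℕ) : K :=
  if Even k then (ρ₁ - r₁ + 1 / 2 + k / 2) * (ρ₂ - r₁ + 1 / 2 + k / 2)
  else ((k : K) + 1) / 2 * (((k : K) + 1) / 2 - r₁ - r₂)

theorem gridPt_even (r : K) (m : ℕ) [CharZero K] : gridPt r (2 * m) = r - 1 / 2 - m := by
  rw [gridPt, if_pos (even_two_mul m)]
  push_cast
  ring

theorem gridPt_odd (r : K) (m : ℕ) [CharZero K] : gridPt r (2 * m + 1) = m + 1 / 2 - r := by
  rw [gridPt, if_neg (by simp)]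
  push_cast
  ring

theorem biEig_even (g : K) (m : ℕ) [CharZero K] : biEig g (2 * m) = m := by
  rw [biEig, if_pos (even_two_mul m)]
  push_cast
  ring

theorem biEig_odd (g : K) (m : ℕ) [CharZero K] : biEig g (2 * m + 1) = -(m : K) - 1 - g := by
  rw [biEig, if_neg (by simp)]
  push_cast
  ring

theorem biLow_even (ρ₁ ρ₂ r₁ r₂ : K) (m : ℕ) [CharZero K] :
    biLow ρ₁ ρ₂ r₁ r₂ (2 * m) = (ρ₁ - r₁ + 1 / 2 + m) * (ρ₂ - r₁ + 1 / 2 + m) := by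
  rw [biLow, if_pos (even_two_mul m)]
  push_cast
  ring

theorem biLow_odd (ρ₁ ρ₂ r₁ r₂ : K) (m : ℕ) [CharZero K] :
    biLow ρ₁ ρ₂ r₁ r₂ (2 * m + 1) = ((m : K) + 1) * ((m : K) + 1 - r₁ - r₂) := by
  rw [biLow, if_neg (by simp)]
  push_cast
  ring

theorem newton_zero (r x : K) : newton r 0 x = 1 := by simp [newton]

theorem newton_succ (r : K) (n : ℕ) (x : K) :
    newton r (n + 1) x = newton r n x * (x - gridPt r n) := Finset.prod_range_succ _ _

theorem newton_gridPt_of_lt {r : K} {k n : ℕ} (h : k < n) : newton r n (gridPt r k) = 0 :=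
  Finset.prod_eq_zero (Finset.mem_range.mpr h) (sub_self _)

theorem biOp_newton_zero (ρ₁ ρ₂ r₁ r₂ x : K) : biOp ρ₁ ρ₂ r₁ r₂ (newton r₁ 0) x = 0 := by
  simp [biOp, newton_zero]

theorem biOp_swap (ρ₁ ρ₂ r₁ r₂ : K) (f : K → K) (x : K) :
    biOp ρ₁ ρ₂ r₂ r₁ f x = biOp ρ₁ ρ₂ r₁ r₂ f x := by
  unfold biOp
  ring

variable [CharZero K]

theorem newton_even_neg (r : K) (m : ℕ) (x : K) :
    newton r (2 * m) (-x) = newton r (2 * m) x := by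
  induction m with
  | zero => simp [newton]
  | succ m ih =>
    rw [show 2 * (m + 1) = 2 * m + 1 + 1 by ring, newton_succ, newton_succ, newton_succ,
      newton_succ, ih, gridPt_even, gridPt_odd]
    ring

/-- Apart from its first factor, a Newton polynomial of odd degree is invariant under
`x ↦ -x - 1`. -/
theorem newton_odd_eq (r : K) (m : ℕ) : ∃ q : K → K, (∀ x, q (-x - 1) = q x) ∧
    ∀ x, newton r (2 * m + 1) x = (x - (r - 1 / 2)) * q x := by
  induction m with
  | zero =>
    refine ⟨fun _ => 1, fun _ => rfl, fun x => ?_⟩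
    have := gridPt_even r 0
    simp only [mul_zero, Nat.cast_zero, sub_zero] at this
    rw [mul_zero, newton_succ, newton_zero, this]
    ring
  | succ m ih =>
    obtain ⟨q, hq, hn⟩ := ih
    refine ⟨fun x => q x * ((x - gridPt r (2 * m + 1)) * (x - gridPt r (2 * (m + 1)))),
      fun x => ?_, fun x => ?_⟩
    · simp only [hq, gridPt_even, gridPt_odd]
      push_cast
      ring
    · rw [newton_succ, show 2 * (m + 1) = 2 * m + 1 + 1 by ring, newton_succ, hn]
      ring

/-- The operator is triangular on Newton polynomials. Where a denominator of the operator vanishes,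
the corresponding numerator has to vanish as well. -/
theorem biOp_newton_succ {ρ₁ ρ₂ r₁ r₂ x : K} (hx : x ≠ 0 ∨ (x - ρ₁) * (x - ρ₂) = 0)
    (hx' : 2 * x + 1 ≠ 0 ∨ x - r₁ + 1 / 2 = 0 ∨ x - r₂ + 1 / 2 = 0) (n : ℕ) :
    biOp ρ₁ ρ₂ r₁ r₂ (newton r₁ (n + 1)) x =
      biEig (ρ₁ + ρ₂ - r₁ - r₂) (n + 1) * newton r₁ (n + 1) x +
        biLow ρ₁ ρ₂ r₁ r₂ n * newton r₁ n x := by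
  have hF : ∀ y : K, (x - ρ₁) * (x - ρ₂) / (2 * x) * (y * (2 * x)) =
      (x - ρ₁) * (x - ρ₂) * y := by
    intro y
    rcases hx with hx | hx
    · field_simp
    · rw [hx]
      ring
  obtain ⟨m, rfl | rfl⟩ := Nat.even_or_odd' n
  · -- odd degree `2 m + 1`
    obtain ⟨q, hq, hn⟩ := newton_odd_eq r₁ m
    have hG : (x - r₁ + 1 / 2) * (x - r₂ + 1 / 2) / (2 * x + 1) * (q x * (-(2 * x + 1))) =
        -((x - r₁ + 1 / 2) * (x - r₂ + 1 / 2)) * q x := by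
      by_cases h0 : 2 * x + 1 = 0
      · have : (x - r₁ + 1 / 2) * (x - r₂ + 1 / 2) = 0 :=
          mul_eq_zero.mpr (hx'.resolve_left (not_not.mpr h0))
        rw [this]
        ring
      · rw [mul_neg, mul_neg, mul_comm (q x), ← mul_assoc, div_mul_cancel₀ _ h0]
        ring
    have e1 : newton r₁ (2 * m + 1) x - newton r₁ (2 * m + 1) (-x) =
        newton r₁ (2 * m) x * (2 * x) := by
      rw [newton_succ, newton_succ, newton_even_neg]
      ring
    have e2 : newton r₁ (2 * m + 1) (-x - 1) - newton r₁ (2 * m + 1) x =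
        q x * (-(2 * x + 1)) := by
      rw [hn, hn, hq]
      ring
    have e3 : -((x - r₁ + 1 / 2) * (x - r₂ + 1 / 2)) * q x =
        -(x - r₂ + 1 / 2) * newton r₁ (2 * m + 1) x := by
      rw [hn]
      ring
    rw [biOp, e1, e2, hF, hG, e3, newton_succ, gridPt_even, biEig_odd, biLow_even]
    ring
  · -- even degree `2 m + 2`
    obtain ⟨q, hq, hn⟩ := newton_odd_eq r₁ m
    have e1 : newton r₁ (2 * m + 1 + 1) (-x) = newton r₁ (2 * m + 1 + 1) x :=
      newton_even_neg r₁ (m + 1) x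
    have e2 : newton r₁ (2 * m + 1 + 1) (-x - 1) - newton r₁ (2 * m + 1 + 1) x =
        q x * ((2 * x + 1) * (m + 1)) := by
      rw [newton_succ _ (2 * m + 1), newton_succ _ (2 * m + 1), hn, hn, hq, gridPt_odd]
      ring
    have hG : (x - r₁ + 1 / 2) * (x - r₂ + 1 / 2) / (2 * x + 1) *
        (q x * ((2 * x + 1) * (m + 1))) =
        (m + 1) * (x - r₂ + 1 / 2) * newton r₁ (2 * m + 1) x := by
      rw [hn]
      by_cases h0 : 2 * x + 1 = 0
      · rw [h0]
        rcases hx'.resolve_left (not_not.mpr h0) with h | h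
        · rw [show x - (r₁ - 1 / 2) = x - r₁ + 1 / 2 by ring, h]
          ring
        · rw [h]
          ring
      · rw [mul_left_comm (q x), ← mul_assoc, div_mul_cancel₀ _ h0]
        ring
    have e3 : biEig (ρ₁ + ρ₂ - r₁ - r₂) (2 * m + 1 + 1) = (m : K) + 1 := by
      have := biEig_even (ρ₁ + ρ₂ - r₁ - r₂) (m + 1)
      push_cast at this
      exact this
    rw [biOp, e1, e2, hG, e3, biLow_odd, newton_succ, gridPt_odd]
    ring

/-- The substitution `x ↦ -x - 1 / 2` interchanges the two reflections, hence the roles of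
`ρ` and `r`. -/
theorem biOp_reflect (ρ₁ ρ₂ r₁ r₂ : K) (f : K → K) (x : K) :
    biOp ρ₁ ρ₂ r₁ r₂ (fun y => f (-y - 1 / 2)) x =
      biOp (-r₁) (-r₂) (-ρ₁) (-ρ₂) f (-x - 1 / 2) := by
  have e1 : 2 * (-x - 1 / 2) = -(2 * x + 1) := by ring
  have e2 : -(2 * x + 1) + 1 = -(2 * x) := by ring
  simp only [biOp, e1, e2, div_neg]
  rw [show -(-x) - 1 / 2 = -(-x - 1 / 2) - 1 by ring,
    show -(-x - 1) - 1 / 2 = -(-x - 1 / 2) by ring]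
  ring

end Operator

/-! ### Bannai-Ito polynomials in the Newton basis -/

section Expansion

variable {K : Type*} [Field K]

theorem poch_zero (a : K) : poch a 0 = 1 := by simp [poch]

theorem poch_succ (a : K) (n : ℕ) : poch a (n + 1) = poch a n * (a + n) :=
  Finset.prod_range_succ _ _

theorem poch_shift (a : K) (j : ℕ) : a * poch (a + 1) j = poch a j * (a + j) := by
  rw [← poch_succ, poch_succ_left]

theorem neg_one_pow_even (j : ℕ) : (-1 : K) ^ (2 * j) = 1 := by rw [pow_mul]; simp

theorem neg_one_pow_odd (j : ℕ) : (-1 : K) ^ (2 * j + 1) = -1 := by rw [pow_succ, pow_mul]; simp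

/-- The coefficient of `newton r₁ k` in `bannaiIto n ρ₁ ρ₂ r₁ r₂`. -/
def biCoeff (n : ℕ) (ρ₁ ρ₂ r₁ r₂ : K) (k : ℕ) : K :=
  let e := n / 2
  let p := n % 2
  let g := ρ₁ + ρ₂ - r₁ - r₂
  let j := k / 2
  (-1) ^ n / poch ((e : K) + g + 1) (e + p) *
    if k % 2 = 0 then
      (-1) ^ j * (poch (-(e : K)) j * poch (e + g + 1) j / (j ! : K) *
        (poch (ρ₁ - r₁ + 1 / 2 + j) (e + p - j) * poch (ρ₂ - r₁ + 1 / 2 + j) (e + p - j) *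
          poch (1 - r₁ - r₂ + j) (e - j)))
    else
      (-1) ^ n * ((e : K) + p + g * p) * ((-1) ^ j *
        (poch (-(e : K) - p + 1) j * poch (e + p + g + 1) j / (j ! : K) *
          (poch (ρ₁ - r₁ + 1 / 2 + (j + 1)) (e + p - (j + 1)) *
            poch (ρ₂ - r₁ + 1 / 2 + (j + 1)) (e + p - (j + 1)) *
            poch (1 - r₁ - r₂ + j) (e - j))))

theorem biCoeff_even_even (e j : ℕ) (ρ₁ ρ₂ r₁ r₂ : K) :
    biCoeff (2 * e) ρ₁ ρ₂ r₁ r₂ (2 * j) =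
      1 / poch (e + (ρ₁ + ρ₂ - r₁ - r₂) + 1) e * ((-1) ^ j *
        (poch (-(e : K)) j * poch (e + (ρ₁ + ρ₂ - r₁ - r₂) + 1) j * (j ! : K)⁻¹ *
          (poch (ρ₁ - r₁ + 1 / 2 + j) (e - j) * poch (ρ₂ - r₁ + 1 / 2 + j) (e - j) *
            poch (1 - r₁ - r₂ + j) (e - j)))) := by
  simp only [biCoeff, show 2 * e / 2 = e by omega, show 2 * e % 2 = 0 by omega,
    show 2 * j / 2 = j by omega, show 2 * j % 2 = 0 by omega, if_true, add_zero,
    neg_one_pow_even, div_eq_mul_inv]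

theorem biCoeff_even_odd (e j : ℕ) (ρ₁ ρ₂ r₁ r₂ : K) :
    biCoeff (2 * e) ρ₁ ρ₂ r₁ r₂ (2 * j + 1) =
      1 / poch (e + (ρ₁ + ρ₂ - r₁ - r₂) + 1) e * (e * ((-1) ^ j *
        (poch (-(e : K) + 1) j * poch (e + (ρ₁ + ρ₂ - r₁ - r₂) + 1) j * (j ! : K)⁻¹ *
          (poch (ρ₁ - r₁ + 1 / 2 + j + 1) (e - (j + 1)) *
            poch (ρ₂ - r₁ + 1 / 2 + j + 1) (e - (j + 1)) *
            poch (1 - r₁ - r₂ + j) (e - j))))) := by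
  simp only [biCoeff, show 2 * e / 2 = e by omega, show 2 * e % 2 = 0 by omega,
    show (2 * j + 1) / 2 = j by omega, show (2 * j + 1) % 2 = 1 by omega, one_ne_zero, if_false,
    add_zero, neg_one_pow_even, div_eq_mul_inv, Nat.cast_zero, mul_zero, sub_zero, one_mul,
    ← add_assoc]

theorem biCoeff_odd_even (e j : ℕ) (ρ₁ ρ₂ r₁ r₂ : K) :
    biCoeff (2 * e + 1) ρ₁ ρ₂ r₁ r₂ (2 * j) =
      -1 / poch (e + (ρ₁ + ρ₂ - r₁ - r₂) + 1) (e + 1) * ((-1) ^ j *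
        (poch (-(e : K)) j * poch (e + (ρ₁ + ρ₂ - r₁ - r₂) + 1) j * (j ! : K)⁻¹ *
          (poch (ρ₁ - r₁ + 1 / 2 + j) (e + 1 - j) * poch (ρ₂ - r₁ + 1 / 2 + j) (e + 1 - j) *
            poch (1 - r₁ - r₂ + j) (e - j)))) := by
  simp only [biCoeff, show (2 * e + 1) / 2 = e by omega, show (2 * e + 1) % 2 = 1 by omega,
    show 2 * j / 2 = j by omega, show 2 * j % 2 = 0 by omega, if_true, neg_one_pow_odd,
    div_eq_mul_inv]

theorem sum_range_even_odd (f : ℕ → K) (m : ℕ) :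
    ∑ k ∈ Finset.range (2 * m), f k =
      ∑ j ∈ Finset.range m, f (2 * j) + ∑ j ∈ Finset.range m, f (2 * j + 1) := by
  induction m with
  | zero => simp
  | succ m ih =>
    rw [show 2 * (m + 1) = 2 * m + 1 + 1 by ring, Finset.sum_range_succ, Finset.sum_range_succ,
      ih, Finset.sum_range_succ, Finset.sum_range_succ]
    ring

variable [CharZero K]

theorem newton_even_eq_poch (r x : K) (j : ℕ) :
    newton r (2 * j) x = (-1) ^ j * (poch (x - r + 1 / 2) j * poch (-x - r + 1 / 2) j) := by
  induction j with
  | zero => simp [newton_zero, poch_zero]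
  | succ j ih =>
    rw [show 2 * (j + 1) = 2 * j + 1 + 1 by ring, newton_succ, newton_succ, gridPt_even,
      gridPt_odd, poch_succ, poch_succ, ih]
    ring

theorem newton_odd_eq_poch (r x : K) (j : ℕ) :
    newton r (2 * j + 1) x =
      (-1) ^ j * ((x - r + 1 / 2) * poch (x - r + 3 / 2) j * poch (-x - r + 1 / 2) j) := by
  rw [newton_succ, newton_even_eq_poch, gridPt_even,
    show x - r + 3 / 2 = x - r + 1 / 2 + 1 by ring, ← poch_succ_left, poch_succ]
  ring

/-- The two hypergeometric sums are the even and the odd part of the expansion of a Bannai-Ito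
polynomial in Newton polynomials. -/
theorem bannaiIto_eq_sum (n : ℕ) (ρ₁ ρ₂ r₁ r₂ x : K) :
    bannaiIto n ρ₁ ρ₂ r₁ r₂ x =
      ∑ k ∈ Finset.range (n + 1), biCoeff n ρ₁ ρ₂ r₁ r₂ k * newton r₁ k x := by
  have hsplit : ∑ k ∈ Finset.range (n + 1), biCoeff n ρ₁ ρ₂ r₁ r₂ k * newton r₁ k x =
      ∑ j ∈ Finset.range (n / 2 + 1), biCoeff n ρ₁ ρ₂ r₁ r₂ (2 * j) * newton r₁ (2 * j) x +
      ∑ j ∈ Finset.range (n / 2 + n % 2),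
        biCoeff n ρ₁ ρ₂ r₁ r₂ (2 * j + 1) * newton r₁ (2 * j + 1) x := by
    obtain ⟨e, rfl | rfl⟩ := Nat.even_or_odd' n
    · rw [show 2 * e / 2 = e by omega, show 2 * e % 2 = 0 by omega, Finset.sum_range_succ,
        sum_range_even_odd, Finset.sum_range_succ, add_zero, add_right_comm]
    · rw [show (2 * e + 1) / 2 = e by omega, show (2 * e + 1) % 2 = 1 by omega,
        show 2 * e + 1 + 1 = 2 * (e + 1) by ring, sum_range_even_odd]
  rw [hsplit]
  simp only [bannaiIto, biCoeff, show ∀ j : ℕ, 2 * j / 2 = j by omega,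
    show ∀ j : ℕ, 2 * j % 2 = 0 by omega, show ∀ j : ℕ, (2 * j + 1) / 2 = j by omega,
    show ∀ j : ℕ, (2 * j + 1) % 2 = 1 by omega, one_ne_zero, if_true, if_false,
    newton_even_eq_poch, newton_odd_eq_poch]
  rw [mul_add, Finset.mul_sum, Finset.mul_sum, Finset.mul_sum]
  have hsq : ∀ j : ℕ, ((-1 : K) ^ j) * (-1) ^ j = 1 := fun j => by
    rw [← mul_pow]
    simp
  congr 1
  · refine Finset.sum_congr rfl fun j _ => ?_
    -- Both sides agree up to `(-1) ^ j * (-1) ^ j = 1`; the other factors are opaque for `ring`.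
    generalize poch (ρ₁ - r₁ + 1 / 2 + (j : K)) _ * _ * _ = Z
    generalize (-1 : K) ^ n / _ = W
    linear_combination -(W * (poch (-((n / 2 : ℕ) : K)) j *
      poch (((n / 2 : ℕ) : K) + (ρ₁ + ρ₂ - r₁ - r₂) + 1) j * poch (x - r₁ + 1 / 2) j *
          poch (-x - r₁ + 1 / 2) j / (j ! : K) * Z)) * hsq j
  · refine Finset.sum_congr rfl fun j _ => ?_
    generalize poch (ρ₁ - r₁ + 1 / 2 + ((j : K) + 1)) _ * _ * _ = Z
    generalize (-1 : K) ^ n / _ = W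
    linear_combination -(W * ((-1) ^ n * (((n / 2 : ℕ) : K) + ((n % 2 : ℕ) : K) +
      (ρ₁ + ρ₂ - r₁ - r₂) * ((n % 2 : ℕ) : K)) * (x - r₁ + 1 / 2) *
        (poch (-((n / 2 : ℕ) : K) - ((n % 2 : ℕ) : K) + 1) j *
          poch (((n / 2 : ℕ) : K) + ((n % 2 : ℕ) : K) + (ρ₁ + ρ₂ - r₁ - r₂) + 1) j *
            poch (x - r₁ + 3 / 2) j *
            poch (-x - r₁ + 1 / 2) j / (j ! : K) * Z))) * hsq j

theorem poch_neg_nat_self (e : ℕ) : poch (-(e : K)) e = (-1) ^ e * (e ! : K) := by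
  induction e with
  | zero => simp [poch_zero]
  | succ e ih =>
    rw [poch_succ_left, Nat.factorial_succ,
      show -((e + 1 : ℕ) : K) + 1 = -(e : K) by push_cast; ring, ih]
    push_cast
    ring

/-- The expansion in the Newton basis is monic. -/
theorem biCoeff_self {n : ℕ} {ρ₁ ρ₂ r₁ r₂ : K}
    (hD : poch (((n / 2 : ℕ) : K) + (ρ₁ + ρ₂ - r₁ - r₂) + 1) (n / 2 + n % 2) ≠ 0) :
    biCoeff n ρ₁ ρ₂ r₁ r₂ n = 1 := by
  have hf : ∀ e : ℕ, (e ! : K) ≠ 0 := fun e => Nat.cast_ne_zero.mpr (Nat.factorial_ne_zero e)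
  have hsq : ∀ j : ℕ, ((-1 : K) ^ j) ^ 2 = 1 := fun j => by
    rw [← pow_mul, mul_comm, pow_mul]
    simp
  obtain ⟨e, rfl | rfl⟩ := Nat.even_or_odd' n
  · simp only [biCoeff, show 2 * e / 2 = e by omega, show 2 * e % 2 = 0 by omega, if_true,
      add_zero, Nat.sub_self, poch_zero, poch_neg_nat_self] at hD ⊢
    rw [pow_mul]
    have := hf e
    field_simp
    simp [hsq]
  · simp only [biCoeff, show (2 * e + 1) / 2 = e by omega, show (2 * e + 1) % 2 = 1 by omega,
      one_ne_zero, if_false, Nat.sub_self, poch_zero] at hD ⊢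
    rw [show -(e : K) - ((1 : ℕ) : K) + 1 = -(e : K) by push_cast; ring, poch_neg_nat_self,
      show (e : K) + ((1 : ℕ) : K) + (ρ₁ + ρ₂ - r₁ - r₂) + 1 =
        e + (ρ₁ + ρ₂ - r₁ - r₂) + 1 + 1 by push_cast; ring]
    rw [poch_succ_left] at hD ⊢
    have h1 := left_ne_zero_of_mul hD
    have h2 := right_ne_zero_of_mul hD
    have := hf e
    rw [show (e : K) + ((1 : ℕ) : K) + (ρ₁ + ρ₂ - r₁ - r₂) * ((1 : ℕ) : K) =
      (e : K) + (ρ₁ + ρ₂ - r₁ - r₂) + 1 by push_cast; ring]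
    have h3 : ((-1 : K) ^ (2 * e + 1)) = -1 := by rw [pow_succ, pow_mul]; simp
    rw [h3]
    field_simp
    rw [hsq]

theorem biCoeff_odd_odd (e j : ℕ) (ρ₁ ρ₂ r₁ r₂ : K) :
    biCoeff (2 * e + 1) ρ₁ ρ₂ r₁ r₂ (2 * j + 1) =
      -1 / poch (e + (ρ₁ + ρ₂ - r₁ - r₂) + 1) (e + 1) *
        (-(e + (ρ₁ + ρ₂ - r₁ - r₂) + 1) * ((-1) ^ j *
          (poch (-(e : K)) j * poch (e + (ρ₁ + ρ₂ - r₁ - r₂) + 1 + 1) j * (j ! : K)⁻¹ *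
            (poch (ρ₁ - r₁ + 1 / 2 + j + 1) (e - j) * poch (ρ₂ - r₁ + 1 / 2 + j + 1) (e - j) *
              poch (1 - r₁ - r₂ + j) (e - j))))) := by
  simp only [biCoeff, show (2 * e + 1) / 2 = e by omega, show (2 * e + 1) % 2 = 1 by omega,
    show (2 * j + 1) / 2 = j by omega, show (2 * j + 1) % 2 = 1 by omega, one_ne_zero, if_false,
    neg_one_pow_odd, div_eq_mul_inv, show e + 1 - (j + 1) = e - j by omega, ← add_assoc]
  rw [show -(e : K) - ((1 : ℕ) : K) + 1 = -(e : K) by push_cast; ring,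
    show (e : K) + ((1 : ℕ) : K) + (ρ₁ + ρ₂ - r₁ - r₂) + 1 =
      e + (ρ₁ + ρ₂ - r₁ - r₂) + 1 + 1 by push_cast; ring]
  push_cast
  ring

/-- The recursion that makes `bannaiIto` an eigenfunction of `biOp`. Apart from common factors, in
each parity case it is the single contiguity `a * poch (a + 1) j = poch a j * (a + j)`. -/
theorem biCoeff_recursion {n k : ℕ} (hk : k < n) (ρ₁ ρ₂ r₁ r₂ : K) :
    biCoeff n ρ₁ ρ₂ r₁ r₂ k *
        (biEig (ρ₁ + ρ₂ - r₁ - r₂) n - biEig (ρ₁ + ρ₂ - r₁ - r₂) k) =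
      biLow ρ₁ ρ₂ r₁ r₂ k * biCoeff n ρ₁ ρ₂ r₁ r₂ (k + 1) := by
  have hfac : ∀ j : ℕ, (j ! : K)⁻¹ = ((j : K) + 1) * ((j + 1)! : K)⁻¹ := fun j => by
    have h1 : (j : K) + 1 ≠ 0 := Nat.cast_add_one_ne_zero j
    rw [Nat.factorial_succ]
    push_cast
    rw [mul_inv, mul_inv_cancel_left₀ h1]
  have hd : ∀ j : ℕ, 1 - r₁ - r₂ + ((j : K) + 1) = 1 - r₁ - r₂ + j + 1 := fun j => by ring
  have hd₁ : ∀ j : ℕ, ρ₁ - r₁ + 1 / 2 + ((j : K) + 1) = ρ₁ - r₁ + 1 / 2 + j + 1 :=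
    fun j => by ring
  have hd₂ : ∀ j : ℕ, ρ₂ - r₁ + 1 / 2 + ((j : K) + 1) = ρ₂ - r₁ + 1 / 2 + j + 1 :=
    fun j => by ring
  obtain ⟨e, rfl | rfl⟩ := Nat.even_or_odd' n <;> obtain ⟨j, rfl | rfl⟩ := Nat.even_or_odd' k
  · have h := poch_shift (-(e : K)) j
    rw [biEig_even, biEig_even, biLow_even, biCoeff_even_even, biCoeff_even_odd,
      show e - j = e - (j + 1) + 1 by omega, poch_succ_left (ρ₁ - r₁ + 1 / 2 + (j : K)),
      poch_succ_left (ρ₂ - r₁ + 1 / 2 + (j : K))]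
    generalize poch (e + (ρ₁ + ρ₂ - r₁ - r₂) + 1) j = A
    generalize poch (ρ₁ - r₁ + 1 / 2 + j + 1) (e - (j + 1)) = B
    generalize poch (ρ₂ - r₁ + 1 / 2 + j + 1) (e - (j + 1)) = C
    generalize 1 / poch (e + (ρ₁ + ρ₂ - r₁ - r₂) + 1) e = D
    generalize poch (1 - r₁ - r₂ + j) _ = E
    linear_combination ((ρ₁ - r₁ + 1 / 2 + j) * (ρ₂ - r₁ + 1 / 2 + j) * A * B * C * D * E *
      (-1) ^ j * (j ! : K)⁻¹) * h
  · have h := poch_shift (-(e : K)) j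
    rw [biEig_even, biEig_odd, biLow_odd, biCoeff_even_odd,
      show 2 * j + 1 + 1 = 2 * (j + 1) by ring,
      biCoeff_even_even, hfac, show e - j = e - (j + 1) + 1 by omega,
      poch_succ_left (1 - r₁ - r₂ + (j : K)), Nat.cast_succ, hd, hd₁, hd₂, poch_succ _ j,
      poch_succ _ j]
    generalize poch (e + (ρ₁ + ρ₂ - r₁ - r₂) + 1) j = A
    generalize poch (ρ₁ - r₁ + 1 / 2 + j + 1) (e - (j + 1)) = B
    generalize poch (ρ₂ - r₁ + 1 / 2 + j + 1) (e - (j + 1)) = C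
    generalize 1 / poch (e + (ρ₁ + ρ₂ - r₁ - r₂) + 1) e = D
    generalize poch (1 - r₁ - r₂ + j + 1) _ = E
    linear_combination (-(1 - r₁ - r₂ + j) * (e + j + 1 + (ρ₁ + ρ₂ - r₁ - r₂)) * A * B * C * D * E *
      (-1) ^ j * (((j : K) + 1) * ((j + 1)! : K)⁻¹)) * h
  · have h := poch_shift (e + (ρ₁ + ρ₂ - r₁ - r₂) + 1) j
    rw [biEig_odd, biEig_even, biLow_even, biCoeff_odd_even, biCoeff_odd_odd,
      show e + 1 - j = e - j + 1 by omega, poch_succ_left (ρ₁ - r₁ + 1 / 2 + (j : K)),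
      poch_succ_left (ρ₂ - r₁ + 1 / 2 + (j : K))]
    generalize poch (-(e : K)) j = A
    generalize poch (ρ₁ - r₁ + 1 / 2 + j + 1) (e - j) = B
    generalize poch (ρ₂ - r₁ + 1 / 2 + j + 1) (e - j) = C
    generalize -1 / poch (e + (ρ₁ + ρ₂ - r₁ - r₂) + 1) (e + 1) = D
    generalize poch (1 - r₁ - r₂ + j) _ = E
    linear_combination ((ρ₁ - r₁ + 1 / 2 + j) * (ρ₂ - r₁ + 1 / 2 + j) * A * B * C * D * E *
      (-1) ^ j * (j ! : K)⁻¹) * h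
  · have h := poch_shift (e + (ρ₁ + ρ₂ - r₁ - r₂) + 1) j
    rw [biEig_odd, biEig_odd, biLow_odd, biCoeff_odd_odd, show 2 * j + 1 + 1 = 2 * (j + 1) by ring,
      biCoeff_odd_even, hfac, show e + 1 - (j + 1) = e - j by omega,
      show e - j = e - (j + 1) + 1 by omega,
      poch_succ_left (1 - r₁ - r₂ + (j : K)), Nat.cast_succ, hd, hd₁, hd₂,
      poch_succ (-(e : K)) j, poch_succ (e + (ρ₁ + ρ₂ - r₁ - r₂) + 1) j]
    generalize poch (-(e : K)) j = A
    generalize poch (ρ₁ - r₁ + 1 / 2 + j + 1) _ = B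
    generalize poch (ρ₂ - r₁ + 1 / 2 + j + 1) _ = C
    generalize -1 / poch (e + (ρ₁ + ρ₂ - r₁ - r₂) + 1) (e + 1) = D
    generalize poch (1 - r₁ - r₂ + j + 1) _ = E
    linear_combination ((e - j) * (1 - r₁ - r₂ + j) * A * B * C * D * E *
      (-1) ^ j * (((j : K) + 1) * ((j + 1)! : K)⁻¹)) * h

end Expansion

/-! ### Tridiagonal operators on a finite grid -/

section Tridiagonal

variable {K : Type*} [Field K]

/-- The extension by zero of a function on the first `S + 1` indices. -/
def extendZero {S : ℕ} (f : Fin (S + 1) → K) (k : ℕ) : K :=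
  if h : k < S + 1 then f ⟨k, h⟩ else 0

theorem extendZero_val {S : ℕ} (f : Fin (S + 1) → K) (i : Fin (S + 1)) :
    extendZero f i = f i := dif_pos i.isLt

/-- The difference operator on `Fin (S + 1)` with rates `up` and `down` to the two neighbours. -/
def tridiag (S : ℕ) (up down : ℕ → K) : (Fin (S + 1) → K) →ₗ[K] (Fin (S + 1) → K) where
  toFun f i := up i * (extendZero f (i + 1) - extendZero f i) +
    down i * (extendZero f (i - 1) - extendZero f i)
  map_add' f g := by
    funext i
    have h : ∀ k, extendZero (f + g) k = extendZero f k + extendZero g k := fun k => by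
      unfold extendZero
      split <;> simp
    simp only [h, Pi.add_apply]
    ring
  map_smul' a f := by
    funext i
    have h : ∀ k, extendZero (a • f) k = a * extendZero f k := fun k => by
      unfold extendZero
      split <;> simp
    simp only [h, Pi.smul_apply, smul_eq_mul, RingHom.id_apply]
    ring

/-- The bilinear form on functions on `Fin (S + 1)` with weights `w`. -/
def gridForm (S : ℕ) (w : ℕ → K) :
    (Fin (S + 1) → K) →ₗ[K] (Fin (S + 1) → K) →ₗ[K] K :=
  LinearMap.mk₂ K (fun f g => ∑ i : Fin (S + 1), w i * f i * g i)
    (fun f f' g => by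
      rw [← Finset.sum_add_distrib]
      exact Finset.sum_congr rfl fun i _ => by rw [Pi.add_apply]; ring)
    (fun a f g => by
      rw [smul_eq_mul, Finset.mul_sum]
      exact Finset.sum_congr rfl fun i _ => by rw [Pi.smul_apply, smul_eq_mul]; ring)
    (fun f g g' => by
      rw [← Finset.sum_add_distrib]
      exact Finset.sum_congr rfl fun i _ => by rw [Pi.add_apply]; ring)
    (fun a f g => by
      rw [smul_eq_mul, Finset.mul_sum]
      exact Finset.sum_congr rfl fun i _ => by rw [Pi.smul_apply, smul_eq_mul]; ring)

theorem gridForm_apply (S : ℕ) (w : ℕ → K) (f g : Fin (S + 1) → K) :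
    gridForm S w f g = ∑ k ∈ Finset.range (S + 1), w k * extendZero f k * extendZero g k := by
  rw [← Fin.sum_univ_eq_sum_range (fun k => w k * extendZero f k * extendZero g k)]
  simp only [extendZero_val]
  rfl

/-- Summation by parts under detailed balance. -/
theorem sum_tridiag {S : ℕ} {up down w : ℕ → K} (h₀ : down 0 = 0)
    (hw : ∀ k < S, w k * up k = w (k + 1) * down (k + 1)) (F G : ℕ → K) :
    ∀ m ≤ S, ∑ k ∈ Finset.range (m + 1),
        w k * (up k * (F (k + 1) - F k) + down k * (F (k - 1) - F k)) * G k =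
      w m * up m * (F (m + 1) - F m) * G m -
        ∑ k ∈ Finset.range m, w k * up k * (F (k + 1) - F k) * (G (k + 1) - G k) := by
  intro m
  induction m with
  | zero =>
    intro _
    simp only [zero_add, Finset.sum_range_one, Finset.sum_range_zero, h₀]
    ring
  | succ m ih =>
    intro hm
    rw [Finset.sum_range_succ, ih (by omega), Finset.sum_range_succ _ m, Nat.add_sub_cancel]
    linear_combination ((F (m + 1) - F m) * G (m + 1)) * hw m (by omega)

/-- By detailed balance a tridiagonal operator is symmetric for the form with weights `w`. -/
theorem gridForm_tridiag {S : ℕ} {up down w : ℕ → K} (h₀ : down 0 = 0) (hS : up S = 0)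
    (hw : ∀ k < S, w k * up k = w (k + 1) * down (k + 1)) (f g : Fin (S + 1) → K) :
    gridForm S w (tridiag S up down f) g = gridForm S w f (tridiag S up down g) := by
  have key : ∀ f g : Fin (S + 1) → K, gridForm S w (tridiag S up down f) g =
      -∑ k ∈ Finset.range S, w k * up k * (extendZero f (k + 1) - extendZero f k) *
        (extendZero g (k + 1) - extendZero g k) := by
    intro f g
    rw [gridForm_apply]
    have h1 : ∀ k ∈ Finset.range (S + 1),
        w k * extendZero (tridiag S up down f) k * extendZero g k =
          w k * (up k * (extendZero f (k + 1) - extendZero f k) +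
            down k * (extendZero f (k - 1) - extendZero f k)) * extendZero g k := by
      intro k hk
      rw [show extendZero (tridiag S up down f) k = tridiag S up down f ⟨k, by simpa using hk⟩ from
        extendZero_val (tridiag S up down f) ⟨k, by simpa using hk⟩]
      rfl
    rw [Finset.sum_congr rfl h1, sum_tridiag h₀ hw _ _ S le_rfl, hS]
    ring
  have hsymm : gridForm S w f (tridiag S up down g) = gridForm S w (tridiag S up down g) f := by
    rw [gridForm_apply, gridForm_apply]
    exact Finset.sum_congr rfl fun k _ => by ring
  rw [hsymm, key, key]
  congr 1
  exact Finset.sum_congr rfl fun k _ => by ring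

/-- Change of Newton basis: the leading coefficient is preserved. -/
theorem exists_newton_change (x y : ℕ → K) (n : ℕ) : ∃ c : ℕ → K, c n = 1 ∧
    ∀ z, ∏ j ∈ Finset.range n, (z - y j) =
      ∑ k ∈ Finset.range (n + 1), c k * ∏ j ∈ Finset.range k, (z - x j) := by
  induction n with
  | zero => exact ⟨fun _ => 1, rfl, fun z => by simp⟩
  | succ n ih =>
    obtain ⟨c, hc, h⟩ := ih
    refine ⟨fun k => (if k = 0 then 0 else c (k - 1)) + (if k ≤ n then c k * (x k - y n) else 0),
      by simp [hc], fun z => ?_⟩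
    rw [Finset.prod_range_succ, h, Finset.sum_mul]
    simp only [add_mul, Finset.sum_add_distrib]
    rw [Finset.sum_range_succ' (fun k => (if k = 0 then 0 else c (k - 1)) * _),
      Finset.sum_range_succ (fun k => (if k ≤ n then c k * (x k - y n) else 0) * _) (n + 1)]
    simp only [Nat.succ_ne_zero, if_false, if_true, zero_mul, add_zero, Nat.add_sub_cancel,
      show ¬ n + 1 ≤ n by omega]
    rw [← Finset.sum_add_distrib]
    refine Finset.sum_congr rfl fun k hk => ?_
    rw [if_pos (Nat.lt_succ_iff.mp (Finset.mem_range.mp hk)), Finset.prod_range_succ]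
    ring

theorem exists_newton_change_sum (x y b : ℕ → K) (n : ℕ) : ∃ c : ℕ → K, c n = b n ∧
    ∀ z, ∑ k ∈ Finset.range (n + 1), b k * ∏ j ∈ Finset.range k, (z - y j) =
      ∑ k ∈ Finset.range (n + 1), c k * ∏ j ∈ Finset.range k, (z - x j) := by
  induction n with
  | zero => exact ⟨b, rfl, fun z => by simp⟩
  | succ n ih =>
    obtain ⟨c, -, h⟩ := ih
    obtain ⟨c', hc', h'⟩ := exists_newton_change x y (n + 1)
    refine ⟨fun k => (if k ≤ n then c k else 0) + b (n + 1) * c' k, by simp [hc'], fun z => ?_⟩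
    rw [Finset.sum_range_succ, h, h']
    simp only [add_mul, Finset.sum_add_distrib]
    rw [Finset.sum_range_succ (fun k => (if k ≤ n then c k else 0) * _) (n + 1), Finset.mul_sum,
      if_neg (by omega), zero_mul, add_zero]
    congr 1
    · refine Finset.sum_congr rfl fun k hk => ?_
      rw [if_pos (Nat.lt_succ_iff.mp (Finset.mem_range.mp hk))]
    · exact Finset.sum_congr rfl fun k _ => by ring

end Tridiagonal

/-! ### Finite orthogonality of univariate Bannai-Ito polynomials -/

section Univariate

variable {K : Type*} [Field K] {ρ₁ ρ₂ r₁ r₂ : K} {S : ℕ}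

/-- The rate from the grid point of index `k` to its successor in `biOp`. -/
def biUp (ρ₁ ρ₂ r₁ r₂ : K) (k : ℕ) : K :=
  let x := gridPt r₁ k
  if Even k then -((x - ρ₁) * (x - ρ₂) / (2 * x))
  else (x - r₁ + 1 / 2) * (x - r₂ + 1 / 2) / (2 * x + 1)

/-- The rate from the grid point of index `k` to its predecessor in `biOp`. -/
def biDown (ρ₁ ρ₂ r₁ r₂ : K) (k : ℕ) : K :=
  let x := gridPt r₁ k
  if Even k then (x - r₁ + 1 / 2) * (x - r₂ + 1 / 2) / (2 * x + 1)
  else -((x - ρ₁) * (x - ρ₂) / (2 * x))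

/-- Restriction of a function to the first `S + 1` points of `gridPt r`. -/
def onGrid (r : K) (S : ℕ) (f : K → K) : Fin (S + 1) → K := fun i => f (gridPt r i)

/-- The grid of size `S + 1` is truncated at its last point, and the denominators of `biOp` do
not vanish between neighbouring grid points. -/
structure IsTruncated (ρ₂ r₁ r₂ : K) (S : ℕ) : Prop where
  last_even : Even S → gridPt r₁ S = ρ₂
  last_odd : ¬Even S → gridPt r₁ S = r₂ - 1 / 2
  even_ne : ∀ m, 2 * m < S → gridPt r₁ (2 * m) ≠ 0
  odd_ne : ∀ m, 2 * m + 1 < S → 2 * gridPt r₁ (2 * m + 1) + 1 ≠ 0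

theorem IsTruncated.biUp_last (h : IsTruncated ρ₂ r₁ r₂ S) : biUp ρ₁ ρ₂ r₁ r₂ S = 0 := by
  by_cases hS : Even S
  · simp [biUp, hS, h.last_even hS]
  · simp [biUp, hS, h.last_odd hS]

theorem gridForm_onGrid (w : ℕ → K) (f g : K → K) :
    gridForm S w (onGrid r₁ S f) (onGrid r₁ S g) =
      ∑ k ∈ Finset.range (S + 1), w k * f (gridPt r₁ k) * g (gridPt r₁ k) := by
  rw [gridForm_apply]
  refine Finset.sum_congr rfl fun k hk => ?_
  have hk := Finset.mem_range.mp hk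
  rw [show extendZero (onGrid r₁ S f) k = f (gridPt r₁ k) from dif_pos hk,
    show extendZero (onGrid r₁ S g) k = g (gridPt r₁ k) from dif_pos hk]

variable [CharZero K]

theorem gridPt_odd_eq_neg (r : K) (m : ℕ) : gridPt r (2 * m + 1) = -gridPt r (2 * m) := by
  rw [gridPt_odd, gridPt_even]
  ring

theorem gridPt_even_succ (r : K) (m : ℕ) :
    gridPt r (2 * m + 2) = -gridPt r (2 * m + 1) - 1 := by
  rw [show 2 * m + 2 = 2 * (m + 1) by ring, gridPt_odd, gridPt_even]
  push_cast
  ring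

theorem biDown_zero : biDown ρ₁ ρ₂ r₁ r₂ 0 = 0 := by
  have := gridPt_even r₁ 0
  simp only [mul_zero, Nat.cast_zero, sub_zero] at this
  simp [biDown, this]

theorem IsTruncated.biLow_last (h : IsTruncated ρ₂ r₁ r₂ S) : biLow ρ₁ ρ₂ r₁ r₂ S = 0 := by
  obtain ⟨m, rfl | rfl⟩ := Nat.even_or_odd' S
  · have := h.last_even (even_two_mul m)
    rw [gridPt_even] at this
    rw [biLow_even, ← this]
    ring
  · have := h.last_odd (by simp)
    rw [gridPt_odd] at this
    rw [biLow_odd, show r₂ = m + 1 / 2 - r₁ + 1 / 2 by rw [this]; ring]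
    ring

/-- At each grid point a vanishing denominator of `biOp` comes with a vanishing numerator. -/
theorem IsTruncated.regular (h : IsTruncated ρ₂ r₁ r₂ S) {k : ℕ} (hk : k ≤ S) :
    (gridPt r₁ k ≠ 0 ∨ (gridPt r₁ k - ρ₁) * (gridPt r₁ k - ρ₂) = 0) ∧
      (2 * gridPt r₁ k + 1 ≠ 0 ∨ gridPt r₁ k - r₁ + 1 / 2 = 0 ∨
        gridPt r₁ k - r₂ + 1 / 2 = 0) := by
  obtain ⟨m, rfl | rfl⟩ := Nat.even_or_odd' k
  · constructor
    · rcases hk.lt_or_eq with hk | hk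
      · exact Or.inl (h.even_ne m hk)
      · right
        rw [hk, h.last_even (hk ▸ even_two_mul m), sub_self, mul_zero]
    · rcases m with _ | m
      · right
        left
        have := gridPt_even r₁ 0
        simp only [mul_zero, Nat.cast_zero, sub_zero] at this
        rw [mul_zero, this]
        ring
      · left
        have := h.odd_ne m (by omega)
        rw [show 2 * (m + 1) = 2 * m + 2 by ring, gridPt_even_succ]
        intro h0
        exact this (by linear_combination -h0)
  · constructor
    · left
      rw [gridPt_odd_eq_neg]
      exact neg_ne_zero.mpr (h.even_ne m (by omega))
    · rcases hk.lt_or_eq with hk | hk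
      · exact Or.inl (h.odd_ne m hk)
      · right
        right
        rw [hk, h.last_odd (by rw [← hk]; simp)]
        ring

/-- On a truncated grid `biOp` acts as a tridiagonal difference operator. -/
theorem IsTruncated.tridiag_onGrid (h : IsTruncated ρ₂ r₁ r₂ S) (f : K → K) :
    tridiag S (biUp ρ₁ ρ₂ r₁ r₂) (biDown ρ₁ ρ₂ r₁ r₂) (onGrid r₁ S f) =
      onGrid r₁ S (biOp ρ₁ ρ₂ r₁ r₂ f) := by
  funext ⟨k, hk⟩
  have hext : ∀ j < S + 1, extendZero (onGrid r₁ S f) j = f (gridPt r₁ j) := fun j hj =>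
    dif_pos hj
  change biUp ρ₁ ρ₂ r₁ r₂ k * (extendZero (onGrid r₁ S f) (k + 1) - extendZero (onGrid r₁ S f) k) +
    biDown ρ₁ ρ₂ r₁ r₂ k * (extendZero (onGrid r₁ S f) (k - 1) - extendZero (onGrid r₁ S f) k) =
    biOp ρ₁ ρ₂ r₁ r₂ f (gridPt r₁ k)
  -- The value beyond the last grid point is irrelevant, since the rate to it vanishes.
  have hup : biUp ρ₁ ρ₂ r₁ r₂ k * extendZero (onGrid r₁ S f) (k + 1) =
      biUp ρ₁ ρ₂ r₁ r₂ k * f (gridPt r₁ (k + 1)) := by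
    rcases (Nat.lt_succ_iff.mp hk).lt_or_eq with hk' | rfl
    · rw [hext (k + 1) (by omega)]
    · rw [h.biUp_last, zero_mul, zero_mul]
  rw [mul_sub, hup, ← mul_sub, hext k hk, hext (k - 1) (by omega)]
  obtain ⟨m, rfl | rfl⟩ := Nat.even_or_odd' k
  · rw [gridPt_odd_eq_neg]
    have hdown : biDown ρ₁ ρ₂ r₁ r₂ (2 * m) * f (gridPt r₁ (2 * m - 1)) =
        biDown ρ₁ ρ₂ r₁ r₂ (2 * m) * f (-gridPt r₁ (2 * m) - 1) := by
      rcases m with _ | m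
      · rw [mul_zero, biDown_zero, zero_mul, zero_mul]
      · rw [show 2 * (m + 1) - 1 = 2 * m + 1 by omega, show 2 * (m + 1) = 2 * m + 2 by ring,
          gridPt_even_succ]
        congr 2
        ring
    rw [mul_sub (biDown _ _ _ _ _), hdown, ← mul_sub]
    simp only [biUp, biDown, biOp, even_two_mul, if_true]
    ring
  · rw [show 2 * m + 1 + 1 = 2 * m + 2 by ring, gridPt_even_succ, Nat.add_sub_cancel,
      show gridPt r₁ (2 * m) = -gridPt r₁ (2 * m + 1) by rw [gridPt_odd_eq_neg, neg_neg]]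
    simp only [biUp, biDown, biOp, show ¬Even (2 * m + 1) by simp, if_false]
    ring

/-- Detailed balance for the rates of `biOp`, freed of denominators. -/
structure IsBalanced (ρ₁ ρ₂ r₁ r₂ : K) (S : ℕ) (w : ℕ → K) : Prop where
  even : ∀ m, 2 * m < S →
    w (2 * m) * ((gridPt r₁ (2 * m) - ρ₁) * (gridPt r₁ (2 * m) - ρ₂)) =
      -(w (2 * m + 1) * ((gridPt r₁ (2 * m) + ρ₁) * (gridPt r₁ (2 * m) + ρ₂)))
  odd : ∀ m, 2 * m + 1 < S →
    w (2 * m + 1) * ((gridPt r₁ (2 * m + 1) - r₁ + 1 / 2) *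
        (gridPt r₁ (2 * m + 1) - r₂ + 1 / 2)) =
      -(w (2 * m + 2) * ((gridPt r₁ (2 * m + 1) + r₁ + 1 / 2) *
        (gridPt r₁ (2 * m + 1) + r₂ + 1 / 2)))

theorem IsBalanced.detailed {w : ℕ → K} (h : IsBalanced ρ₁ ρ₂ r₁ r₂ S w) :
    ∀ k < S, w k * biUp ρ₁ ρ₂ r₁ r₂ k = w (k + 1) * biDown ρ₁ ρ₂ r₁ r₂ (k + 1) := by
  intro k hk
  obtain ⟨m, rfl | rfl⟩ := Nat.even_or_odd' k
  · have := h.even m hk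
    simp only [biUp, biDown, even_two_mul, show ¬Even (2 * m + 1) by simp, if_true, if_false,
      gridPt_odd_eq_neg, mul_neg, div_neg, neg_neg]
    rw [← mul_div_assoc, this, ← mul_div_assoc]
    ring
  · have := h.odd m hk
    have e : Even (2 * m + 1 + 1) := (even_two_mul (m + 1))
    simp only [biUp, biDown, e, show ¬Even (2 * m + 1) by simp, if_true, if_false]
    rw [show 2 * m + 1 + 1 = 2 * m + 2 by ring, gridPt_even_succ,
      show 2 * (-gridPt r₁ (2 * m + 1) - 1) + 1 = -(2 * gridPt r₁ (2 * m + 1) + 1) by ring,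
      div_neg, ← mul_div_assoc, this, mul_neg, ← mul_div_assoc]
    ring

/-- The vectors of values of the Newton polynomials on the grid. -/
def newtonVec (r : K) (S : ℕ) (n : ℕ) : Fin (S + 1) → K := onGrid r S (newton r n)

theorem onGrid_bannaiIto (n : ℕ) :
    onGrid r₁ S (bannaiIto n ρ₁ ρ₂ r₁ r₂) =
      ∑ k ∈ Finset.range (n + 1), biCoeff n ρ₁ ρ₂ r₁ r₂ k • newtonVec r₁ S k := by
  funext i
  simp only [onGrid, bannaiIto_eq_sum, Finset.sum_apply, Pi.smul_apply, smul_eq_mul, newtonVec]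

theorem IsTruncated.tridiag_newtonVec_zero (h : IsTruncated ρ₂ r₁ r₂ S) :
    tridiag S (biUp ρ₁ ρ₂ r₁ r₂) (biDown ρ₁ ρ₂ r₁ r₂) (newtonVec r₁ S 0) =
      biEig (ρ₁ + ρ₂ - r₁ - r₂) 0 • newtonVec r₁ S 0 := by
  rw [newtonVec, h.tridiag_onGrid]
  funext i
  simp [onGrid, biOp_newton_zero, biEig]

theorem IsTruncated.tridiag_newtonVec_succ (h : IsTruncated ρ₂ r₁ r₂ S) (n : ℕ) :
    tridiag S (biUp ρ₁ ρ₂ r₁ r₂) (biDown ρ₁ ρ₂ r₁ r₂) (newtonVec r₁ S (n + 1)) =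
      biEig (ρ₁ + ρ₂ - r₁ - r₂) (n + 1) • newtonVec r₁ S (n + 1) +
        biLow ρ₁ ρ₂ r₁ r₂ n • newtonVec r₁ S n := by
  rw [newtonVec, h.tridiag_onGrid]
  funext i
  obtain ⟨h1, h2⟩ := h.regular (ρ₁ := ρ₁) (Nat.lt_succ_iff.mp i.isLt)
  exact biOp_newton_succ h1 h2 n

theorem IsTruncated.tridiag_bannaiIto (h : IsTruncated ρ₂ r₁ r₂ S) (n : ℕ) :
    tridiag S (biUp ρ₁ ρ₂ r₁ r₂) (biDown ρ₁ ρ₂ r₁ r₂) (onGrid r₁ S (bannaiIto n ρ₁ ρ₂ r₁ r₂)) =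
      biEig (ρ₁ + ρ₂ - r₁ - r₂) n • onGrid r₁ S (bannaiIto n ρ₁ ρ₂ r₁ r₂) := by
  rw [onGrid_bannaiIto]
  exact eigen_of_recursion h.tridiag_newtonVec_zero h.tridiag_newtonVec_succ
    fun k hk => biCoeff_recursion hk ρ₁ ρ₂ r₁ r₂

/-- Beyond the truncation degree the polynomial vanishes on the whole grid: the lowering
coefficient at `S` is zero, so the coefficients of all `newton r₁ k` with `k ≤ S` are zero. -/
theorem IsTruncated.bannaiIto_eq_zero (h : IsTruncated ρ₂ r₁ r₂ S) {n : ℕ} (hn : S < n)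
    (hev : ∀ k < n, biEig (ρ₁ + ρ₂ - r₁ - r₂) n ≠ biEig (ρ₁ + ρ₂ - r₁ - r₂) k)
    {k : ℕ} (hk : k ≤ S) : bannaiIto n ρ₁ ρ₂ r₁ r₂ (gridPt r₁ k) = 0 := by
  -- Downward induction from the vanishing lowering coefficient.
  have hz : ∀ j ≤ S, biCoeff n ρ₁ ρ₂ r₁ r₂ (S - j) = 0 := by
    intro j
    have step : ∀ i < n, biLow ρ₁ ρ₂ r₁ r₂ i * biCoeff n ρ₁ ρ₂ r₁ r₂ (i + 1) = 0 →
        biCoeff n ρ₁ ρ₂ r₁ r₂ i = 0 := by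
      intro i hi h0
      rw [← biCoeff_recursion hi] at h0
      exact (mul_eq_zero.mp h0).resolve_right (sub_ne_zero.mpr (hev i hi))
    induction j with
    | zero =>
      intro _
      exact step S hn (by rw [h.biLow_last, zero_mul])
    | succ j ih =>
      intro hj
      refine step _ (by omega) ?_
      rw [show S - (j + 1) + 1 = S - j by omega, ih (by omega), mul_zero]
  rw [bannaiIto_eq_sum]
  refine Finset.sum_eq_zero fun i _ => ?_
  rcases le_or_gt i S with hi | hi
  · have := hz (S - i) (by omega)
    rw [show S - (S - i) = i by omega] at this
    rw [this, zero_mul]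
  · rw [newton_gridPt_of_lt (by omega), mul_zero]

theorem IsBalanced.orthogonal {w : ℕ → K} (hw : IsBalanced ρ₁ ρ₂ r₁ r₂ S w)
    (h : IsTruncated ρ₂ r₁ r₂ S) {n m : ℕ}
    (hev : biEig (ρ₁ + ρ₂ - r₁ - r₂) n ≠ biEig (ρ₁ + ρ₂ - r₁ - r₂) m) :
    ∑ k ∈ Finset.range (S + 1), w k * bannaiIto n ρ₁ ρ₂ r₁ r₂ (gridPt r₁ k) *
      bannaiIto m ρ₁ ρ₂ r₁ r₂ (gridPt r₁ k) = 0 := by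
  rw [← gridForm_onGrid]
  exact form_eigen_orthogonal (gridForm_tridiag biDown_zero h.biUp_last hw.detailed)
    (h.tridiag_bannaiIto n) (h.tridiag_bannaiIto m) hev

/-- The norm in terms of the last grid point: `newton r₁ S` vanishes at all the other ones. -/
theorem IsBalanced.norm {w : ℕ → K} (hw : IsBalanced ρ₁ ρ₂ r₁ r₂ S w)
    (h : IsTruncated ρ₂ r₁ r₂ S) {n : ℕ} (hn : n ≤ S)
    (hD : poch (((n / 2 : ℕ) : K) + (ρ₁ + ρ₂ - r₁ - r₂) + 1) (n / 2 + n % 2) ≠ 0)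
    (hev : ∀ k ≤ S, k ≠ n → biEig (ρ₁ + ρ₂ - r₁ - r₂) n ≠ biEig (ρ₁ + ρ₂ - r₁ - r₂) k)
    (hlow : ∀ k < S, biLow ρ₁ ρ₂ r₁ r₂ k ≠ 0) :
    ∑ k ∈ Finset.range (S + 1), w k * bannaiIto n ρ₁ ρ₂ r₁ r₂ (gridPt r₁ k) *
      bannaiIto n ρ₁ ρ₂ r₁ r₂ (gridPt r₁ k) =
      w S * bannaiIto n ρ₁ ρ₂ r₁ r₂ (gridPt r₁ S) * newton r₁ S (gridPt r₁ S) *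
        ∏ k ∈ Finset.Ico n S, (biEig (ρ₁ + ρ₂ - r₁ - r₂) n -
          biEig (ρ₁ + ρ₂ - r₁ - r₂) (k + 1)) / biLow ρ₁ ρ₂ r₁ r₂ k := by
  have h1 := form_eigen_norm (h.tridiag_newtonVec_zero (ρ₁ := ρ₁)) h.tridiag_newtonVec_succ
    (gridForm_tridiag biDown_zero h.biUp_last hw.detailed) hn (biCoeff_self hD)
    (fun k hk => biCoeff_recursion hk ρ₁ ρ₂ r₁ r₂) hev hlow
  rw [← onGrid_bannaiIto, gridForm_onGrid, newtonVec, gridForm_onGrid] at h1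
  rw [h1, Finset.sum_range_succ, Finset.sum_eq_zero, zero_add]
  intro k hk
  rw [newton_gridPt_of_lt (Finset.mem_range.mp hk), mul_zero]

/-- The value of `bannaiIto` at the last grid point `y 0`, read off from its expansion in any
Newton basis that starts there and on which `biOp` is triangular: by uniqueness of monic
eigenpolynomials, that expansion is determined by its own two-term recursion. -/
theorem IsTruncated.bannaiIto_last_of_basis (h : IsTruncated ρ₂ r₁ r₂ S) {ψ : ℕ → K → K}
    {y low' : ℕ → K} {s : K} (hs : s * s = 1)
    (hψ : ∀ k z, ψ k z = s ^ k * ∏ j ∈ Finset.range k, (z - y j))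
    (hop : ∀ k, ∀ i ≤ S, biOp ρ₁ ρ₂ r₁ r₂ (ψ (k + 1)) (gridPt r₁ i) =
      biEig (ρ₁ + ρ₂ - r₁ - r₂) (k + 1) * ψ (k + 1) (gridPt r₁ i) + low' k * ψ k (gridPt r₁ i))
    (hlast : y 0 = gridPt r₁ S) {n : ℕ}
    (hD : poch (((n / 2 : ℕ) : K) + (ρ₁ + ρ₂ - r₁ - r₂) + 1) (n / 2 + n % 2) ≠ 0)
    (hev : ∀ k < n, biEig (ρ₁ + ρ₂ - r₁ - r₂) n ≠ biEig (ρ₁ + ρ₂ - r₁ - r₂) k) :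
    bannaiIto n ρ₁ ρ₂ r₁ r₂ (gridPt r₁ S) = s ^ n * ∏ k ∈ Finset.range n,
      low' k / (biEig (ρ₁ + ρ₂ - r₁ - r₂) n - biEig (ρ₁ + ρ₂ - r₁ - r₂) k) := by
  set ev := biEig (ρ₁ + ρ₂ - r₁ - r₂) with hevdef
  set T := tridiag S (biUp ρ₁ ρ₂ r₁ r₂) (biDown ρ₁ ρ₂ r₁ r₂) with hT
  -- The coefficients in the basis `ψ` of the eigenvector that is monic as a polynomial.
  let b : ℕ → K := fun k => s ^ n * ∏ j ∈ Finset.Ico k n, low' j / (ev n - ev j)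
  have hb : ∀ k < n, b k * (ev n - ev k) = low' k * b (k + 1) := by
    intro k hk
    have hne := sub_ne_zero.mpr (hev k hk)
    simp only [b]
    rw [Finset.prod_eq_prod_Ico_succ_bot hk]
    field_simp
  have hψ0 : T (onGrid r₁ S (ψ 0)) = ev 0 • onGrid r₁ S (ψ 0) := by
    rw [hT, h.tridiag_onGrid]
    funext i
    simp [onGrid, biOp, hψ, hevdef, biEig]
  have hψs : ∀ k, T (onGrid r₁ S (ψ (k + 1))) =
      ev (k + 1) • onGrid r₁ S (ψ (k + 1)) + low' k • onGrid r₁ S (ψ k) := by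
    intro k
    rw [hT, h.tridiag_onGrid]
    funext i
    exact hop k i (Nat.lt_succ_iff.mp i.isLt)
  have hP' := eigen_of_recursion (vec := fun k => onGrid r₁ S (ψ k)) hψ0 hψs hb
  have hP := h.tridiag_bannaiIto (ρ₁ := ρ₁) n
  obtain ⟨c, hc, hcz⟩ := exists_newton_change_sum (gridPt r₁) y (fun k => s ^ k * b k) n
  -- The leading terms cancel, so the difference of the two monic eigenvectors lies in the span of
  -- Newton polynomials of lower degree, whose eigenvalues are different.
  have hdiff : onGrid r₁ S (bannaiIto n ρ₁ ρ₂ r₁ r₂) -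
      ∑ k ∈ Finset.range (n + 1), b k • onGrid r₁ S (ψ k) =
        ∑ k ∈ Finset.range n, (biCoeff n ρ₁ ρ₂ r₁ r₂ k - c k) • newtonVec r₁ S k := by
    funext i
    have h1 : ∑ k ∈ Finset.range (n + 1), b k * ψ k (gridPt r₁ i) =
        ∑ k ∈ Finset.range (n + 1), c k * newton r₁ k (gridPt r₁ i) := by
      have h2 := hcz (gridPt r₁ i)
      simp only [newton]
      rw [← h2]
      exact Finset.sum_congr rfl fun k _ => by rw [hψ]; ring
    have hcn : c n = 1 := by
      rw [hc]
      simp only [b, Finset.Ico_self, Finset.prod_empty, mul_one]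
      rw [← mul_pow, hs, one_pow]
    simp only [Pi.sub_apply, Finset.sum_apply, Pi.smul_apply, smul_eq_mul, onGrid, newtonVec]
    rw [h1, bannaiIto_eq_sum, ← Finset.sum_sub_distrib, Finset.sum_range_succ, biCoeff_self hD,
      hcn, sub_self, add_zero]
    exact Finset.sum_congr rfl fun k _ => by ring
  have hzero := eigen_eq_zero (h.tridiag_newtonVec_zero (ρ₁ := ρ₁)) h.tridiag_newtonVec_succ (ev n)
    n (fun k => biCoeff n ρ₁ ρ₂ r₁ r₂ k - c k) hev (by
      rw [← hdiff, map_sub, smul_sub, ← hP', hP])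
  rw [← hdiff, sub_eq_zero] at hzero
  -- At the last grid point all basis functions but `ψ 0` vanish.
  have hval := congrFun hzero (Fin.last S)
  simp only [Finset.sum_apply, Pi.smul_apply, smul_eq_mul, onGrid, Fin.val_last] at hval
  rw [hval, Finset.sum_range_succ', Finset.sum_eq_zero, zero_add]
  · simp only [b, hψ, Finset.range_zero, Finset.prod_empty, pow_zero, mul_one]
    rw [Finset.range_eq_Ico]
  · intro k _
    rw [hψ, Finset.prod_eq_zero (Finset.mem_range.mpr (Nat.succ_pos k)), mul_zero, mul_zero]
    rw [hlast, sub_self]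

/-- If the last point is `r₂ - 1 / 2`, the Newton basis at the other end of the grid comes from
the symmetry of `biOp` in `r₁` and `r₂`. -/
theorem IsTruncated.bannaiIto_last_odd (h : IsTruncated ρ₂ r₁ r₂ S) (hS : ¬Even S) {n : ℕ}
    (hD : poch (((n / 2 : ℕ) : K) + (ρ₁ + ρ₂ - r₁ - r₂) + 1) (n / 2 + n % 2) ≠ 0)
    (hev : ∀ k < n, biEig (ρ₁ + ρ₂ - r₁ - r₂) n ≠ biEig (ρ₁ + ρ₂ - r₁ - r₂) k) :
    bannaiIto n ρ₁ ρ₂ r₁ r₂ (gridPt r₁ S) = ∏ k ∈ Finset.range n,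
      biLow ρ₁ ρ₂ r₂ r₁ k / (biEig (ρ₁ + ρ₂ - r₁ - r₂) n - biEig (ρ₁ + ρ₂ - r₁ - r₂) k) := by
  have h1 := h.bannaiIto_last_of_basis (ρ₁ := ρ₁) (ψ := newton r₂) (y := gridPt r₂)
    (low' := biLow ρ₁ ρ₂ r₂ r₁) (s := 1) (one_mul 1) (fun k z => by rw [one_pow, one_mul]; rfl)
    (fun k i hi => by
      obtain ⟨h1, h2⟩ := h.regular (ρ₁ := ρ₁) hi
      rw [← biOp_swap, biOp_newton_succ h1 (h2.imp_right Or.symm), sub_right_comm (ρ₁ + ρ₂)])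
    (by
      rw [h.last_odd hS]
      simpa using gridPt_even r₂ 0) hD hev
  rw [h1, one_pow, one_mul]

/-- If the last point is `ρ₂`, the Newton basis at the other end of the grid comes from the
reflection `x ↦ -x - 1 / 2`, which turns `ρ₂` into `r - 1 / 2` with `r = -ρ₂`. -/
theorem IsTruncated.bannaiIto_last_even (h : IsTruncated ρ₂ r₁ r₂ S) (hS : Even S) {n : ℕ}
    (hD : poch (((n / 2 : ℕ) : K) + (ρ₁ + ρ₂ - r₁ - r₂) + 1) (n / 2 + n % 2) ≠ 0)
    (hev : ∀ k < n, biEig (ρ₁ + ρ₂ - r₁ - r₂) n ≠ biEig (ρ₁ + ρ₂ - r₁ - r₂) k) :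
    bannaiIto n ρ₁ ρ₂ r₁ r₂ (gridPt r₁ S) = (-1) ^ n * ∏ k ∈ Finset.range n,
      biLow (-r₁) (-r₂) (-ρ₂) (-ρ₁) k /
        (biEig (ρ₁ + ρ₂ - r₁ - r₂) n - biEig (ρ₁ + ρ₂ - r₁ - r₂) k) := by
  refine h.bannaiIto_last_of_basis (ρ₁ := ρ₁)
    (ψ := fun k z => newton (-ρ₂) k (-z - 1 / 2)) (y := fun j => -1 / 2 - gridPt (-ρ₂) j)
    (low' := biLow (-r₁) (-r₂) (-ρ₂) (-ρ₁)) (s := -1) (by ring) (fun k z => ?_)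
    (fun k i hi => ?_) ?_ hD hev
  · rw [newton, ← Finset.card_range k, ← Finset.prod_const, Finset.card_range,
      ← Finset.prod_mul_distrib]
    exact Finset.prod_congr rfl fun j _ => by ring
  · obtain ⟨h1, h2⟩ := h.regular (ρ₁ := ρ₁) hi
    rw [biOp_reflect, ← biOp_swap, biOp_newton_succ]
    · rw [show -r₁ + -r₂ - -ρ₂ - -ρ₁ = ρ₁ + ρ₂ - r₁ - r₂ by ring]
    · rcases h2 with h2 | h2 | h2
      · left
        intro h0
        exact h2 (by linear_combination -2 * h0)
      · right
        linear_combination (gridPt r₁ i - r₂ + 1 / 2) * h2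
      · right
        linear_combination (gridPt r₁ i - r₁ + 1 / 2) * h2
    · rcases h1 with h1 | h1
      · left
        intro h0
        exact h1 (by linear_combination -(1 / 2) * h0)
      · right
        rcases mul_eq_zero.mp h1 with h1 | h1
        · right
          linear_combination -h1
        · left
          linear_combination -h1
  · have := gridPt_even (-ρ₂) 0
    simp only [mul_zero, Nat.cast_zero, sub_zero] at this
    rw [h.last_even hS, this]
    ring

end Univariate

/-! ### The truncated polynomials and their weights -/

section Weights

variable {K : Type*} [Field K]

/-- The value of `z₂` at which the first factor is truncated at degree `S`. The second grid consists
of such values, with `S = N - s`. -/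
def truncZ (p₁ p₂ : K) (S : ℕ) : K := 1 / 2 * ((-1) ^ S * (1 / 2 - S - 2 * p₁ - 2 * p₂))

/-- The parameters for which the denominators of the univariate weights and norms of size `S` do
not vanish. -/
structure IsRegular (p₁ p₂ c : K) (S : ℕ) : Prop where
  c_ne : ∀ k : ℕ, k < (S + 1) / 2 → c + 1 / 2 + (k : K) ≠ 0
  one_ne : ∀ k : ℕ, k < S → 2 * p₁ + (k : K) ≠ 0
  two_ne : ∀ k : ℕ, S / 2 ≤ k → k < S → 2 * p₁ + 2 * p₂ + (k : K) ≠ 0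

theorem poch_ne_zero {a : K} {n : ℕ} (h : ∀ i < n, a + (i : K) ≠ 0) : poch a n ≠ 0 :=
  Finset.prod_ne_zero_iff.mpr fun i hi => h i (Finset.mem_range.mp hi)

/-- A Pochhammer symbol counted down from a shifted base, by reflection. -/
theorem poch_ne_zero_of_reflect {a b : K} {n m : ℕ} (hb : b = 1 - a - m) (hn : n ≤ m)
    (h : ∀ i < n, a + ((m - 1 - i : ℕ) : K) ≠ 0) : poch b n ≠ 0 := by
  refine poch_ne_zero fun i hi h0 => h i hi ?_
  rw [Nat.cast_sub (by omega), Nat.cast_sub (by omega)]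
  push_cast
  rw [hb] at h0
  linear_combination -h0

variable {p₁ p₂ c : K}

theorem IsRegular.poch_one {S s n : ℕ} (h : IsRegular p₁ p₂ c S) (hn : n ≤ s) (hs : s ≤ S) :
    poch (1 - 2 * p₁ - s) n ≠ 0 :=
  poch_ne_zero_of_reflect (a := 2 * p₁) (m := s) rfl hn fun i hi => h.one_ne _ (by omega)

theorem IsRegular.poch_two_even {s n : ℕ} (h : IsRegular p₁ p₂ c (2 * s)) (hn : n ≤ s) :
    poch (1 - 2 * p₁ - 2 * p₂ - 2 * s) n ≠ 0 :=
  poch_ne_zero_of_reflect (a := 2 * p₁ + 2 * p₂) (m := 2 * s) (by push_cast; ring) (by omega)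
    fun i hi => h.two_ne _ (by omega) (by omega)

theorem IsRegular.poch_two_odd {s n : ℕ} (h : IsRegular p₁ p₂ c (2 * s + 1)) (hn : n ≤ s + 1) :
    poch (-2 * p₁ - 2 * p₂ - 2 * s) n ≠ 0 :=
  poch_ne_zero_of_reflect (a := 2 * p₁ + 2 * p₂) (m := 2 * s + 1) (by push_cast; ring) (by omega)
    fun i hi => h.two_ne _ (by omega) (by omega)

theorem weight1_even_even (r s : ℕ) :
    weight1 p₁ p₂ c (2 * r) (2 * s) = weight1EE p₁ p₂ c r s := by
  simp [weight1]

theorem weight1_odd_even (r s : ℕ) :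
    weight1 p₁ p₂ c (2 * r + 1) (2 * s) = weight1OE p₁ p₂ c r s := by
  simp [weight1, show (2 * r + 1) / 2 = r by omega, show (2 * r + 1) % 2 = 1 by omega]

theorem weight1_even_odd (r s : ℕ) :
    weight1 p₁ p₂ c (2 * r) (2 * s + 1) = weight1EO p₁ p₂ c r s := by
  simp [weight1, show (2 * s + 1) / 2 = s by omega, show (2 * s + 1) % 2 = 1 by omega]

theorem weight1_odd_odd (r s : ℕ) :
    weight1 p₁ p₂ c (2 * r + 1) (2 * s + 1) = weight1OO p₁ p₂ c r s := by
  simp [weight1, show (2 * s + 1) / 2 = s by omega, show (2 * s + 1) % 2 = 1 by omega,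
    show (2 * r + 1) / 2 = r by omega, show (2 * r + 1) % 2 = 1 by omega]

theorem poch_neg_nat_of_lt {s r : ℕ} (h : s < r) : poch (-(s : K)) r = 0 :=
  Finset.prod_eq_zero (Finset.mem_range.mpr h) (neg_add_cancel _)

theorem weight1_of_lt {R S : ℕ} (h : S < R) : weight1 p₁ p₂ c R S = 0 := by
  obtain ⟨r, rfl | rfl⟩ := Nat.even_or_odd' R <;> obtain ⟨s, rfl | rfl⟩ := Nat.even_or_odd' S
  · simp [weight1_even_even, weight1EE, poch_neg_nat_of_lt (K := K) (show s < r by omega)]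
  · simp [weight1_even_odd, weight1EO, poch_neg_nat_of_lt (K := K) (show s < r by omega)]
  · simp [weight1_odd_even, weight1OE, poch_neg_nat_of_lt (K := K) (show s < r + 1 by omega)]
  · simp [weight1_odd_odd, weight1OO, poch_neg_nat_of_lt (K := K) (show s < r by omega)]

variable [CharZero K]

theorem truncZ_even (p₁ p₂ : K) (m : ℕ) : truncZ p₁ p₂ (2 * m) = 1 / 4 - m - p₁ - p₂ := by
  rw [truncZ, neg_one_pow_even]
  push_cast
  ring

theorem truncZ_odd (p₁ p₂ : K) (m : ℕ) : truncZ p₁ p₂ (2 * m + 1) = m + p₁ + p₂ + 1 / 4 := by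
  rw [truncZ, neg_one_pow_odd]
  push_cast
  ring

/-- At `z₂ = truncZ p₁ p₂ S` the grid of the first factor ends after `S + 1` points. -/
theorem IsRegular.isTruncated {S : ℕ} (h : IsRegular p₁ p₂ c S) :
    IsTruncated (truncZ p₁ p₂ S + p₂ - 1 / 4) (1 / 2 - p₁) (truncZ p₁ p₂ S - p₂ + 1 / 4) S where
  last_even hS := by
    obtain ⟨m, rfl⟩ := hS.exists_two_nsmul
    rw [smul_eq_mul, gridPt_even, truncZ_even]
    ring
  last_odd hS := by
    obtain ⟨m, rfl⟩ := Nat.not_even_iff_odd.mp hS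
    rw [gridPt_odd, truncZ_odd]
    ring
  even_ne m hm h0 := by
    refine h.one_ne (2 * m) hm ?_
    rw [gridPt_even] at h0
    push_cast
    linear_combination -2 * h0
  odd_ne m hm h0 := by
    refine h.one_ne (2 * m + 1) hm ?_
    rw [gridPt_odd] at h0
    push_cast
    linear_combination h0

theorem weight1EE_succ {r s : ℕ} (hD : poch (1 / 2 - c - s) (r + 1) ≠ 0)
    (hE : poch (1 - 2 * p₁ - s) (r + 1) ≠ 0)
    (hF : poch (1 - 2 * p₁ - 2 * p₂ - 2 * s) (r + 1) ≠ 0) :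
    weight1EE p₁ p₂ c (r + 1) s * ((r + 1) * (1 / 2 - c - s + r)) =
      -(weight1OE p₁ p₂ c r s * ((1 - 2 * p₁ - 2 * s + r) * (3 / 2 + c - 2 * p₁ - s + r))) := by
  have hr : (r : K) + 1 ≠ 0 := Nat.cast_add_one_ne_zero r
  have hf : (r ! : K) ≠ 0 := Nat.cast_ne_zero.mpr (Nat.factorial_ne_zero r)
  rw [poch_succ] at hD
  have hD₁ := left_ne_zero_of_mul hD
  have hD₂ := right_ne_zero_of_mul hD
  rw [weight1EE, weight1OE, Nat.factorial_succ, poch_succ (1 / 2 - c - (s : K)),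
    poch_succ (1 - 2 * p₁ - 2 * (s : K)), poch_succ (3 / 2 + c - 2 * p₁ - s)]
  push_cast
  generalize 1 / 2 - c - (s : K) + r = d at *
  generalize poch (1 / 2 - c - (s : K)) r = D at *
  generalize poch (1 - 2 * p₁ - (s : K)) (r + 1) = E at *
  generalize poch (1 - 2 * p₁ - 2 * p₂ - 2 * (s : K)) (r + 1) = F at *
  field_simp

theorem weight1OE_eq {r s : ℕ} (hD : poch (1 / 2 - c - s) r ≠ 0)
    (hE : poch (1 - 2 * p₁ - s) (r + 1) ≠ 0)
    (hF : poch (1 - 2 * p₁ - 2 * p₂ - 2 * s) (r + 1) ≠ 0) :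
    weight1OE p₁ p₂ c r s * ((1 - 2 * p₁ - s + r) * (1 - 2 * p₁ - 2 * p₂ - 2 * s + r)) =
      -(weight1EE p₁ p₂ c r s * ((2 * p₂ + r) * (-s + r))) := by
  have hf : (r ! : K) ≠ 0 := Nat.cast_ne_zero.mpr (Nat.factorial_ne_zero r)
  rw [poch_succ] at hE hF
  have hE₁ := left_ne_zero_of_mul hE
  have hE₂ := right_ne_zero_of_mul hE
  have hF₁ := left_ne_zero_of_mul hF
  have hF₂ := right_ne_zero_of_mul hF
  rw [weight1EE, weight1OE, poch_succ (2 * p₂), poch_succ (-(s : K)),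
    poch_succ (1 - 2 * p₁ - (s : K)), poch_succ (1 - 2 * p₁ - 2 * p₂ - 2 * (s : K))]
  generalize 1 - 2 * p₁ - (s : K) + r = e at *
  generalize 1 - 2 * p₁ - 2 * p₂ - 2 * (s : K) + r = f at *
  generalize poch (1 / 2 - c - (s : K)) r = D at *
  generalize poch (1 - 2 * p₁ - (s : K)) r = E at *
  generalize poch (1 - 2 * p₁ - 2 * p₂ - 2 * (s : K)) r = F at *
  field_simp

theorem weight1OO_eq {r s : ℕ} (hD : poch (-(1 / 2) - c - s) (r + 1) ≠ 0)
    (hE : poch (1 - 2 * p₁ - s) r ≠ 0)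
    (hF : poch (-2 * p₁ - 2 * p₂ - 2 * s) (r + 1) ≠ 0) :
    weight1OO p₁ p₂ c r s * ((-(1 / 2) - c - s + r) * (-2 * p₁ - 2 * p₂ - 2 * s + r)) =
      -(weight1EO p₁ p₂ c r s * ((2 * p₂ + r) * (1 / 2 + c - 2 * p₁ - s + r))) := by
  have hf : (r ! : K) ≠ 0 := Nat.cast_ne_zero.mpr (Nat.factorial_ne_zero r)
  rw [poch_succ] at hD hF
  have hD₁ := left_ne_zero_of_mul hD
  have hD₂ := right_ne_zero_of_mul hD
  have hF₁ := left_ne_zero_of_mul hF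
  have hF₂ := right_ne_zero_of_mul hF
  rw [weight1OO, weight1EO, poch_succ (2 * p₂), poch_succ (1 / 2 + c - 2 * p₁ - s),
    poch_succ (-(1 / 2) - c - (s : K)), poch_succ (-2 * p₁ - 2 * p₂ - 2 * (s : K))]
  generalize -(1 / 2) - c - (s : K) + r = d at *
  generalize -2 * p₁ - 2 * p₂ - 2 * (s : K) + r = f at *
  generalize poch (-(1 / 2) - c - (s : K)) r = D at *
  generalize poch (1 - 2 * p₁ - (s : K)) r = E at *
  generalize poch (-2 * p₁ - 2 * p₂ - 2 * (s : K)) r = F at *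
  field_simp

theorem weight1EO_succ {r s : ℕ} (hD : poch (-(1 / 2) - c - s) (r + 1) ≠ 0)
    (hE : poch (1 - 2 * p₁ - s) (r + 1) ≠ 0)
    (hF : poch (-2 * p₁ - 2 * p₂ - 2 * s) (r + 1) ≠ 0) :
    weight1EO p₁ p₂ c (r + 1) s * ((r + 1) * (1 - 2 * p₁ - s + r)) =
      -(weight1OO p₁ p₂ c r s * ((-s + r) * (-2 * p₁ - 2 * s + r))) := by
  have hr : (r : K) + 1 ≠ 0 := Nat.cast_add_one_ne_zero r
  have hf : (r ! : K) ≠ 0 := Nat.cast_ne_zero.mpr (Nat.factorial_ne_zero r)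
  rw [poch_succ] at hE
  have hE₁ := left_ne_zero_of_mul hE
  have hE₂ := right_ne_zero_of_mul hE
  rw [weight1OO, weight1EO, Nat.factorial_succ, poch_succ (-(s : K)),
    poch_succ (-2 * p₁ - 2 * (s : K)), poch_succ (1 - 2 * p₁ - (s : K))]
  push_cast
  generalize 1 - 2 * p₁ - (s : K) + r = e at *
  generalize poch (-(1 / 2) - c - (s : K)) (r + 1) = D at *
  generalize poch (1 - 2 * p₁ - (s : K)) r = E at *
  generalize poch (-2 * p₁ - 2 * p₂ - 2 * (s : K)) (r + 1) = F at *
  field_simp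

theorem IsRegular.poch_c_even {s n : ℕ} (h : IsRegular p₁ p₂ c (2 * s)) (hn : n ≤ s) :
    poch (1 / 2 - c - s) n ≠ 0 :=
  poch_ne_zero_of_reflect (a := c + 1 / 2) (m := s) (by ring) hn
    fun i hi => h.c_ne _ (by omega)

theorem IsRegular.poch_c_odd {s n : ℕ} (h : IsRegular p₁ p₂ c (2 * s + 1)) (hn : n ≤ s + 1) :
    poch (-(1 / 2) - c - s) n ≠ 0 :=
  poch_ne_zero_of_reflect (a := c + 1 / 2) (m := s + 1) (by push_cast; ring) hn
    fun i hi => h.c_ne _ (by omega)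

theorem weight1_zero (S : ℕ) : weight1 p₁ p₂ c 0 S = 1 := by
  obtain ⟨s, rfl | rfl⟩ := Nat.even_or_odd' S
  · rw [show (0 : ℕ) = 2 * 0 by rfl, weight1_even_even]
    simp [weight1EE, poch_zero]
  · rw [show (0 : ℕ) = 2 * 0 by rfl, weight1_even_odd]
    simp [weight1EO, poch_zero]

/-- The first weight satisfies detailed balance. The grid `gridPt (1 / 2 - p₁)` runs through the
points in the opposite order, from `r = S` down to `r = 0`. -/
theorem IsRegular.isBalanced {S : ℕ} (h : IsRegular p₁ p₂ c S) :
    IsBalanced (c - p₁ + 1 / 2) (truncZ p₁ p₂ S + p₂ - 1 / 4) (1 / 2 - p₁)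
      (truncZ p₁ p₂ S - p₂ + 1 / 4) S (fun k => weight1 p₁ p₂ c (S - k) S) where
  even m hm := by
    obtain ⟨s, rfl | rfl⟩ := Nat.even_or_odd' S
    · obtain ⟨r, rfl⟩ : ∃ r, s = m + 1 + r := ⟨s - (m + 1), by omega⟩
      have h1 := weight1EE_succ (r := r) (h.poch_c_even (n := r + 1) (by omega))
        (h.poch_one (n := r + 1) (s := m + 1 + r) (by omega) (by omega))
        (h.poch_two_even (by omega))
      simp only [show 2 * (m + 1 + r) - 2 * m = 2 * (r + 1) by omega,
        show 2 * (m + 1 + r) - (2 * m + 1) = 2 * r + 1 by omega, weight1_even_even,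
        weight1_odd_even, gridPt_even, truncZ_even]
      push_cast at h1 ⊢
      linear_combination h1
    · obtain ⟨r, rfl⟩ : ∃ r, s = m + r := ⟨s - m, by omega⟩
      have h1 := weight1OO_eq (r := r) (h.poch_c_odd (n := r + 1) (by omega))
        (h.poch_one (n := r) (s := m + r) (by omega) (by omega))
        (h.poch_two_odd (by omega))
      simp only [show 2 * (m + r) + 1 - 2 * m = 2 * r + 1 by omega,
        show 2 * (m + r) + 1 - (2 * m + 1) = 2 * r by omega, weight1_even_odd,
        weight1_odd_odd, gridPt_even, truncZ_odd]
      push_cast at h1 ⊢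
      linear_combination h1
  odd m hm := by
    obtain ⟨s, rfl | rfl⟩ := Nat.even_or_odd' S
    · obtain ⟨r, rfl⟩ : ∃ r, s = m + 1 + r := ⟨s - (m + 1), by omega⟩
      have h1 := weight1OE_eq (r := r) (h.poch_c_even (n := r) (by omega))
        (h.poch_one (n := r + 1) (s := m + 1 + r) (by omega) (by omega))
        (h.poch_two_even (by omega))
      simp only [show 2 * (m + 1 + r) - (2 * m + 1) = 2 * r + 1 by omega,
        show 2 * (m + 1 + r) - (2 * m + 2) = 2 * r by omega, weight1_even_even,
        weight1_odd_even, gridPt_odd, truncZ_even]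
      push_cast at h1 ⊢
      linear_combination h1
    · obtain ⟨r, rfl⟩ : ∃ r, s = m + 1 + r := ⟨s - (m + 1), by omega⟩
      have h1 := weight1EO_succ (r := r) (h.poch_c_odd (n := r + 1) (by omega))
        (h.poch_one (n := r + 1) (s := m + 1 + r) (by omega) (by omega))
        (h.poch_two_odd (by omega))
      simp only [show 2 * (m + 1 + r) + 1 - (2 * m + 1) = 2 * (r + 1) by omega,
        show 2 * (m + 1 + r) + 1 - (2 * m + 2) = 2 * r + 1 by omega, weight1_even_odd,
        weight1_odd_odd, gridPt_odd, truncZ_odd]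
      push_cast at h1 ⊢
      linear_combination h1

end Weights

/-! ### Closed form of the univariate norms -/

section Norms

variable {K : Type*} [Field K]

/-- The squared norm of the univariate polynomial of degree `2 e` on the grid of size `2 s + 1`. -/
def uniNormEE (p₁ p₂ c : K) (e s : ℕ) : K :=
  poch (2 * p₁ + s) s * poch (-(s : K)) e * poch (2 * p₂) e * e ! *
    poch (c - 2 * p₁ + 3 / 2 - s) e *
      poch (c + 2 * p₂ + 1 / 2 + 2 * e) (s - e) /
    (poch (c + 2 * p₂ + 1 / 2 + e) e * poch (c + 1 / 2 + e) (s - e) *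
      poch (2 * p₁ + 2 * p₂ + s + e) (s - e))

/-- The squared norm of the univariate polynomial of degree `2 e + 1` on the grid of size
`2 s + 1`. -/
def uniNormOE (p₁ p₂ c : K) (e s : ℕ) : K :=
  -(poch (2 * p₁ + s) s * poch (-(s : K)) (e + 1) * poch (2 * p₂) (e + 1) * e ! *
      poch (c - 2 * p₁ + 3 / 2 - s) e * poch (c + 2 * p₂ + 1 / 2 + 2 * e + 1) (s - e)) /
    (poch (c + 2 * p₂ + 1 / 2 + e) (e + 1) * poch (c + 1 / 2 + e + 1) (s - e - 1) *
      poch (2 * p₁ + 2 * p₂ + s + e) (s - e))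

/-- The squared norm of the univariate polynomial of degree `2 e` on the grid of size `2 s + 2`. -/
def uniNormEO (p₁ p₂ c : K) (e s : ℕ) : K :=
  poch (2 * p₁ + s) (s + 1) * poch (-(s : K)) e * poch (2 * p₂) e * e ! *
      poch (c - 2 * p₁ + 1 / 2 - s) e * poch (c + 2 * p₂ + 1 / 2 + 2 * e) (s - e + 1) /
    (poch (c + 2 * p₂ + 1 / 2 + e) e * poch (c + 1 / 2 + e) (s - e + 1) *
      poch (2 * p₁ + 2 * p₂ + s + e) (s - e + 1))

/-- The squared norm of the univariate polynomial of degree `2 e + 1` on the grid of size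
`2 s + 2`. -/
def uniNormOO (p₁ p₂ c : K) (e s : ℕ) : K :=
  -(poch (2 * p₁ + s) (s + 1) * poch (-(s : K)) e * poch (2 * p₂) (e + 1) * e ! *
      poch (c - 2 * p₁ + 1 / 2 - s) (e + 1) * poch (c + 2 * p₂ + 1 / 2 + 2 * e + 1) (s - e)) /
    (poch (c + 2 * p₂ + 1 / 2 + e) (e + 1) * poch (c + 1 / 2 + e + 1) (s - e) *
      poch (2 * p₁ + 2 * p₂ + s + e + 1) (s - e))

/-- The squared norm of the univariate polynomial of degree `n` on the grid of size `S + 1`. It is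
zero for `S < n`, where the polynomial vanishes on the grid. -/
def uniNorm (p₁ p₂ c : K) (n S : ℕ) : K :=
  if S % 2 = 0 then
    if n % 2 = 0 then uniNormEE p₁ p₂ c (n / 2) (S / 2) else uniNormOE p₁ p₂ c (n / 2) (S / 2)
  else
    if n % 2 = 0 then uniNormEO p₁ p₂ c (n / 2) (S / 2) else uniNormOO p₁ p₂ c (n / 2) (S / 2)

theorem uniNorm_even_even (p₁ p₂ c : K) (e s : ℕ) :
    uniNorm p₁ p₂ c (2 * e) (2 * s) = uniNormEE p₁ p₂ c e s := by
  simp [uniNorm]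

theorem uniNorm_odd_even (p₁ p₂ c : K) (e s : ℕ) :
    uniNorm p₁ p₂ c (2 * e + 1) (2 * s) = uniNormOE p₁ p₂ c e s := by
  simp [uniNorm, show (2 * e + 1) / 2 = e by omega, show (2 * e + 1) % 2 = 1 by omega]

theorem uniNorm_even_odd (p₁ p₂ c : K) (e s : ℕ) :
    uniNorm p₁ p₂ c (2 * e) (2 * s + 1) = uniNormEO p₁ p₂ c e s := by
  simp [uniNorm, show (2 * s + 1) / 2 = s by omega, show (2 * s + 1) % 2 = 1 by omega]

theorem uniNorm_odd_odd (p₁ p₂ c : K) (e s : ℕ) :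
    uniNorm p₁ p₂ c (2 * e + 1) (2 * s + 1) = uniNormOO p₁ p₂ c e s := by
  simp [uniNorm, show (2 * s + 1) / 2 = s by omega, show (2 * s + 1) % 2 = 1 by omega,
    show (2 * e + 1) / 2 = e by omega, show (2 * e + 1) % 2 = 1 by omega]

theorem uniNorm_of_lt {p₁ p₂ c : K} {n S : ℕ} (h : S < n) : uniNorm p₁ p₂ c n S = 0 := by
  obtain ⟨r, rfl | rfl⟩ := Nat.even_or_odd' n <;> obtain ⟨s, rfl | rfl⟩ := Nat.even_or_odd' S
  · simp [uniNorm_even_even, uniNormEE, poch_neg_nat_of_lt (K := K) (show s < r by omega)]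
  · simp [uniNorm_even_odd, uniNormEO, poch_neg_nat_of_lt (K := K) (show s < r by omega)]
  · simp [uniNorm_odd_even, uniNormOE, poch_neg_nat_of_lt (K := K) (show s < r + 1 by omega)]
  · simp [uniNorm_odd_odd, uniNormOO, poch_neg_nat_of_lt (K := K) (show s < r by omega)]

theorem prod_range_even_odd (f : ℕ → K) (m : ℕ) :
    ∏ k ∈ Finset.range (2 * m), f k =
      (∏ j ∈ Finset.range m, f (2 * j)) * ∏ j ∈ Finset.range m, f (2 * j + 1) := by
  induction m with
  | zero => simp
  | succ m ih =>
    rw [show 2 * (m + 1) = 2 * m + 1 + 1 by ring, Finset.prod_range_succ, Finset.prod_range_succ,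
      ih, Finset.prod_range_succ, Finset.prod_range_succ]
    ring

theorem prod_Ico_even_even (f : ℕ → K) (e t : ℕ) :
    ∏ k ∈ Finset.Ico (2 * e) (2 * (e + t)), f k =
      (∏ j ∈ Finset.range t, f (2 * e + 2 * j)) * ∏ j ∈ Finset.range t, f (2 * e + 2 * j + 1) := by
  induction t with
  | zero => simp
  | succ t ih =>
    rw [show 2 * (e + (t + 1)) = 2 * (e + t) + 1 + 1 by ring,
      Finset.prod_Ico_succ_top (by omega), Finset.prod_Ico_succ_top (by omega), ih,
      Finset.prod_range_succ, Finset.prod_range_succ, mul_add 2 e t]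
    ring

theorem prod_Ico_even_odd (f : ℕ → K) (e t : ℕ) :
    ∏ k ∈ Finset.Ico (2 * e) (2 * (e + t) + 1), f k =
      (∏ j ∈ Finset.range (t + 1), f (2 * e + 2 * j)) *
        ∏ j ∈ Finset.range t, f (2 * e + 2 * j + 1) := by
  rw [Finset.prod_Ico_succ_top (by omega), prod_Ico_even_even, Finset.prod_range_succ,
    mul_add 2 e t]
  ring

theorem prod_Ico_odd_odd (f : ℕ → K) (e t : ℕ) :
    ∏ k ∈ Finset.Ico (2 * e + 1) (2 * (e + t) + 1), f k =
      (∏ j ∈ Finset.range t, f (2 * (e + 1) + 2 * j)) *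
        ∏ j ∈ Finset.range t, f (2 * e + 2 * j + 1) := by
  induction t with
  | zero => simp
  | succ t ih =>
    rw [show 2 * (e + (t + 1)) = 2 * (e + t) + 1 + 1 by ring,
      Finset.prod_Ico_succ_top (by omega), Finset.prod_Ico_succ_top (by omega), ih,
      Finset.prod_range_succ, Finset.prod_range_succ,
      show 2 * (e + t) + 1 + 1 = 2 * (e + 1) + 2 * t by ring,
      show 2 * (e + t) + 1 = 2 * e + 2 * t + 1 by ring]
    ring

theorem prod_Ico_odd_even (f : ℕ → K) (e t : ℕ) :
    ∏ k ∈ Finset.Ico (2 * e + 1) (2 * (e + 1 + t)), f k =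
      (∏ j ∈ Finset.range t, f (2 * (e + 1) + 2 * j)) *
        ∏ j ∈ Finset.range (t + 1), f (2 * e + 2 * j + 1) := by
  rw [show 2 * (e + 1 + t) = 2 * (e + t) + 1 + 1 by ring, Finset.prod_Ico_succ_top (by omega),
    prod_Ico_odd_odd, Finset.prod_range_succ _ t, show 2 * (e + t) + 1 = 2 * e + 2 * t + 1 by ring]
  ring

theorem prod_range_add_one (t : ℕ) : ∏ j ∈ Finset.range t, ((j : K) + 1) = t ! := by
  rw [← Finset.prod_range_add_one_eq_factorial]
  push_cast
  rfl

theorem factorial_eq_poch_one (t : ℕ) : (t ! : K) = poch 1 t := by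
  rw [← prod_range_add_one]
  exact Finset.prod_congr rfl fun i _ => add_comm _ _

theorem factorial_add (e t : ℕ) : ((e + t)! : K) = (e ! : K) * poch ((e : K) + 1) t := by
  rw [factorial_eq_poch_one, factorial_eq_poch_one, poch_add, add_comm (1 : K)]

theorem prod_neg_poch (a : K) (t : ℕ) :
    ∏ j ∈ Finset.range t, (-(a + (j : K))) = (-1) ^ t * poch a t := by
  rw [Finset.prod_neg, Finset.card_range]
  rfl

variable [CharZero K]

theorem prod_biLow_even (ρ₁ ρ₂ r₁ r₂ : K) (e t : ℕ) :
    ∏ j ∈ Finset.range t, biLow ρ₁ ρ₂ r₁ r₂ (2 * e + 2 * j) =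
      poch (ρ₁ - r₁ + 1 / 2 + e) t * poch (ρ₂ - r₁ + 1 / 2 + e) t := by
  rw [poch, poch, ← Finset.prod_mul_distrib]
  refine Finset.prod_congr rfl fun j _ => ?_
  rw [← mul_add, biLow_even]
  push_cast
  ring

theorem prod_biLow_odd (ρ₁ ρ₂ r₁ r₂ : K) (e t : ℕ) :
    ∏ j ∈ Finset.range t, biLow ρ₁ ρ₂ r₁ r₂ (2 * e + 2 * j + 1) =
      poch ((e : K) + 1) t * poch (1 - r₁ - r₂ + e) t := by
  rw [poch, poch, ← Finset.prod_mul_distrib]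
  refine Finset.prod_congr rfl fun j _ => ?_
  rw [← mul_add, biLow_odd]
  push_cast
  ring

/-- The gaps between an even-indexed eigenvalue and the preceding ones. -/
theorem prod_biEig_even (g : K) (e : ℕ) :
    ∏ k ∈ Finset.range (2 * e), (biEig g (2 * e) - biEig g k) = e ! * poch (g + 1 + e) e := by
  rw [prod_range_even_odd]
  congr 1
  · rw [← prod_range_add_one, ← Finset.prod_range_reflect]
    refine Finset.prod_congr rfl fun j hj => ?_
    have hj := Finset.mem_range.mp hj
    obtain ⟨t, rfl⟩ : ∃ t, e = j + 1 + t := ⟨e - (j + 1), by omega⟩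
    rw [show j + 1 + t - 1 - j = t by omega, biEig_even, biEig_even]
    push_cast
    ring
  · refine Finset.prod_congr rfl fun j _ => ?_
    rw [biEig_even, biEig_odd]
    ring

/-- The gaps between an odd-indexed eigenvalue and the preceding ones. -/
theorem prod_biEig_odd (g : K) (e : ℕ) :
    ∏ k ∈ Finset.range (2 * e + 1), (biEig g (2 * e + 1) - biEig g k) =
      -(e ! * poch (g + 1 + e) (e + 1)) := by
  rw [Finset.prod_range_succ, prod_range_even_odd]
  have h1 : ∏ j ∈ Finset.range e, (biEig g (2 * e + 1) - biEig g (2 * j)) =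
      (-1) ^ e * poch (g + 1 + e) e := by
    rw [← prod_neg_poch]
    refine Finset.prod_congr rfl fun j _ => ?_
    rw [biEig_odd, biEig_even]
    ring
  have h2 : ∏ j ∈ Finset.range e, (biEig g (2 * e + 1) - biEig g (2 * j + 1)) =
      (-1) ^ e * (e ! : K) := by
    rw [← prod_range_add_one, ← Finset.prod_range_reflect (fun j : ℕ => (j : K) + 1),
      ← Finset.card_range e, ← Finset.prod_const, Finset.card_range, ← Finset.prod_mul_distrib]
    refine Finset.prod_congr rfl fun j hj => ?_
    have hj := Finset.mem_range.mp hj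
    obtain ⟨t, rfl⟩ : ∃ t, e = j + 1 + t := ⟨e - (j + 1), by omega⟩
    rw [show j + 1 + t - 1 - j = t by omega, biEig_odd, biEig_odd]
    push_cast
    ring
  rw [h1, h2, biEig_odd, biEig_even, poch_succ]
  have hsq : ((-1 : K) ^ e) * (-1) ^ e = 1 := by rw [← mul_pow]; simp
  linear_combination (-(poch (g + 1 + e) e * e ! * (g + 1 + e + e))) * hsq

theorem prod_biEig_even_succ (g : K) (e t : ℕ) :
    ∏ j ∈ Finset.range t, (biEig g (2 * e) - biEig g (2 * e + 2 * j + 1)) =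
      poch (g + 1 + 2 * e) t := by
  refine Finset.prod_congr rfl fun j _ => ?_
  rw [← mul_add, biEig_even, biEig_odd]
  push_cast
  ring

theorem prod_biEig_even_succ_succ (g : K) (e t : ℕ) :
    ∏ j ∈ Finset.range t, (biEig g (2 * e) - biEig g (2 * e + 2 * j + 1 + 1)) =
      (-1) ^ t * (t ! : K) := by
  rw [factorial_eq_poch_one, ← prod_neg_poch]
  refine Finset.prod_congr rfl fun j _ => ?_
  rw [show 2 * e + 2 * j + 1 + 1 = 2 * (e + j + 1) by ring, biEig_even, biEig_even]
  push_cast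
  ring

theorem prod_biEig_odd_succ (g : K) (e t : ℕ) :
    ∏ j ∈ Finset.range t, (biEig g (2 * e + 1) - biEig g (2 * e + 2 * j + 1 + 1)) =
      (-1) ^ t * poch (g + 1 + 2 * e + 1) t := by
  rw [← prod_neg_poch]
  refine Finset.prod_congr rfl fun j _ => ?_
  rw [show 2 * e + 2 * j + 1 + 1 = 2 * (e + j + 1) by ring, biEig_even, biEig_odd]
  push_cast
  ring

theorem prod_biEig_odd_succ_succ (g : K) (e t : ℕ) :
    ∏ j ∈ Finset.range t, (biEig g (2 * e + 1) - biEig g (2 * (e + 1) + 2 * j + 1)) =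
      (t ! : K) := by
  rw [factorial_eq_poch_one]
  refine Finset.prod_congr rfl fun j _ => ?_
  rw [show 2 * (e + 1) + 2 * j + 1 = 2 * (e + 1 + j) + 1 by ring, biEig_odd, biEig_odd]
  push_cast
  ring

theorem prod_biLow_range_even (ρ₁ ρ₂ r₁ r₂ : K) (e : ℕ) :
    ∏ k ∈ Finset.range (2 * e), biLow ρ₁ ρ₂ r₁ r₂ k =
      poch (ρ₁ - r₁ + 1 / 2) e * poch (ρ₂ - r₁ + 1 / 2) e * (e ! * poch (1 - r₁ - r₂) e) := by
  have h1 := prod_biLow_even ρ₁ ρ₂ r₁ r₂ 0 e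
  have h2 := prod_biLow_odd ρ₁ ρ₂ r₁ r₂ 0 e
  simp only [mul_zero, zero_add, Nat.cast_zero, add_zero] at h1 h2
  rw [prod_range_even_odd, h1, h2, factorial_eq_poch_one]

theorem prod_biLow_range_odd (ρ₁ ρ₂ r₁ r₂ : K) (e : ℕ) :
    ∏ k ∈ Finset.range (2 * e + 1), biLow ρ₁ ρ₂ r₁ r₂ k =
      poch (ρ₁ - r₁ + 1 / 2) (e + 1) * poch (ρ₂ - r₁ + 1 / 2) (e + 1) *
        (e ! * poch (1 - r₁ - r₂) e) := by
  rw [Finset.prod_range_succ, prod_biLow_range_even, biLow_even, poch_succ, poch_succ]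
  ring

variable {p₁ p₂ c : K} {S : ℕ}

theorem IsRegular.biLow_ne_zero (h : IsRegular p₁ p₂ c S) : ∀ k < S,
    biLow (c - p₁ + 1 / 2) (truncZ p₁ p₂ S + p₂ - 1 / 4) (1 / 2 - p₁)
      (truncZ p₁ p₂ S - p₂ + 1 / 4) k ≠ 0 := by
  intro k hk
  have hneg : ∀ {i j : ℕ}, i < j → -(j : K) + i ≠ 0 := fun {i j} hij h0 => by
    have : (i : K) = j := by linear_combination h0
    exact hij.ne (Nat.cast_injective this)
  obtain ⟨s, rfl | rfl⟩ := Nat.even_or_odd' S <;> obtain ⟨j, rfl | rfl⟩ := Nat.even_or_odd' k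
  · rw [biLow_even, truncZ_even]
    refine mul_ne_zero (fun h0 => h.c_ne j (by omega) (by linear_combination h0)) (fun h0 =>
      hneg (show j < s by omega) (by linear_combination h0))
  · rw [biLow_odd, truncZ_even]
    refine mul_ne_zero (Nat.cast_add_one_ne_zero j) (fun h0 => h.two_ne (s + j) (by omega)
      (by omega) (by push_cast; linear_combination h0))
  · rw [biLow_even, truncZ_odd]
    refine mul_ne_zero (fun h0 => h.c_ne j (by omega) (by linear_combination h0)) (fun h0 =>
      h.two_ne (s + j) (by omega) (by omega) (by push_cast; linear_combination h0))
  · rw [biLow_odd, truncZ_odd]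
    refine mul_ne_zero (Nat.cast_add_one_ne_zero j) (fun h0 => hneg (show j < s by omega)
      (by linear_combination h0))

/-- The eigenvalues of degrees up to `N` are pairwise different. Two of equal parity differ by a
nonzero integer, two of different parity by one of the numbers in the hypothesis. -/
theorem biEig_ne {N : ℕ} (hG : ∀ k : ℕ, k < N → c + 2 * p₂ + 1 / 2 + (k : K) ≠ 0) {n m : ℕ}
    (hn : n ≤ N) (hm : m ≤ N) (hnm : n ≠ m) :
    biEig (c + 2 * p₂ - 1 / 2) n ≠ biEig (c + 2 * p₂ - 1 / 2) m := by
  intro h0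
  obtain ⟨a, rfl | rfl⟩ := Nat.even_or_odd' n <;> obtain ⟨b, rfl | rfl⟩ := Nat.even_or_odd' m
  · rw [biEig_even, biEig_even] at h0
    exact hnm (by rw [Nat.cast_injective h0])
  · rw [biEig_even, biEig_odd] at h0
    exact hG (a + b) (by omega) (by push_cast; linear_combination h0)
  · rw [biEig_odd, biEig_even] at h0
    exact hG (a + b) (by omega) (by push_cast; linear_combination -h0)
  · rw [biEig_odd, biEig_odd] at h0
    have : (a : K) = b := by linear_combination -h0
    exact hnm (by rw [Nat.cast_injective this])

/-- The parameter `g` of the first factor does not depend on `z₂`. -/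
theorem truncParam_gap (p₁ p₂ c z : K) :
    c - p₁ + 1 / 2 + (z + p₂ - 1 / 4) - (1 / 2 - p₁) - (z - p₂ + 1 / 4) =
      c + 2 * p₂ - 1 / 2 := by ring

/-- The denominator in the prefactor of the first factor. It does not depend on `z₂`. -/
theorem firstBI_denominator_ne_zero {N : ℕ}
    (hG : ∀ k : ℕ, k < N → c + 2 * p₂ + 1 / 2 + (k : K) ≠ 0) {n : ℕ} (hn : n ≤ N) (z : K) :
    poch (((n / 2 : ℕ) : K) + (c - p₁ + 1 / 2 + (z + p₂ - 1 / 4) - (1 / 2 - p₁) -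
      (z - p₂ + 1 / 4)) + 1) (n / 2 + n % 2) ≠ 0 := by
  refine poch_ne_zero fun i hi h0 => hG (n / 2 + i) (by omega) ?_
  rw [truncParam_gap] at h0
  push_cast
  linear_combination h0

theorem IsRegular.firstBI_orthogonal (h : IsRegular p₁ p₂ c S) {N n m : ℕ}
    (hG : ∀ k : ℕ, k < N → c + 2 * p₂ + 1 / 2 + (k : K) ≠ 0) (hn : n ≤ N) (hm : m ≤ N)
    (hnm : n ≠ m) :
    ∑ k ∈ Finset.range (S + 1), weight1 p₁ p₂ c (S - k) S *
      firstBI p₁ p₂ c n (truncZ p₁ p₂ S) (gridPt (1 / 2 - p₁) k) *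
      firstBI p₁ p₂ c m (truncZ p₁ p₂ S) (gridPt (1 / 2 - p₁) k) = 0 := by
  refine h.isBalanced.orthogonal h.isTruncated ?_
  rw [truncParam_gap]
  exact biEig_ne hG hn hm hnm

/-- The norm as the value at the last grid point times explicit products. The weight of the last
grid point is one. -/
theorem IsRegular.firstBI_norm_prod (h : IsRegular p₁ p₂ c S) {n : ℕ} (hn : n ≤ S)
    (hG : ∀ k : ℕ, k < S → c + 2 * p₂ + 1 / 2 + (k : K) ≠ 0) :
    ∑ k ∈ Finset.range (S + 1), weight1 p₁ p₂ c (S - k) S *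
      firstBI p₁ p₂ c n (truncZ p₁ p₂ S) (gridPt (1 / 2 - p₁) k) *
      firstBI p₁ p₂ c n (truncZ p₁ p₂ S) (gridPt (1 / 2 - p₁) k) =
    firstBI p₁ p₂ c n (truncZ p₁ p₂ S) (gridPt (1 / 2 - p₁) S) *
      newton (1 / 2 - p₁) S (gridPt (1 / 2 - p₁) S) *
        ((∏ k ∈ Finset.Ico n S, (biEig (c + 2 * p₂ - 1 / 2) n -
          biEig (c + 2 * p₂ - 1 / 2) (k + 1))) / ∏ k ∈ Finset.Ico n S,
            biLow (c - p₁ + 1 / 2) (truncZ p₁ p₂ S + p₂ - 1 / 4) (1 / 2 - p₁)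
              (truncZ p₁ p₂ S - p₂ + 1 / 4) k) := by
  have h1 := h.isBalanced.norm h.isTruncated hn (firstBI_denominator_ne_zero hG hn _)
    (fun k hk hkn => by
      rw [truncParam_gap]
      exact biEig_ne hG hn hk (Ne.symm hkn)) h.biLow_ne_zero
  rw [truncParam_gap, Nat.sub_self, weight1_zero, one_mul, Finset.prod_div_distrib] at h1
  exact h1

theorem IsRegular.firstBI_last_even {s n : ℕ} (h : IsRegular p₁ p₂ c (2 * s)) (hn : n ≤ 2 * s)
    (hG : ∀ k : ℕ, k < 2 * s → c + 2 * p₂ + 1 / 2 + (k : K) ≠ 0) :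
    firstBI p₁ p₂ c n (truncZ p₁ p₂ (2 * s)) (gridPt (1 / 2 - p₁) (2 * s)) =
      (-1) ^ n * ((∏ k ∈ Finset.range n, biLow (-(1 / 2 - p₁)) (2 * p₂ + s + p₁ - 1 / 2) (s + p₁)
        (-(c - p₁ + 1 / 2)) k) /
        ∏ k ∈ Finset.range n, (biEig (c + 2 * p₂ - 1 / 2) n - biEig (c + 2 * p₂ - 1 / 2) k)) := by
  have h1 := h.isTruncated.bannaiIto_last_even (even_two_mul s)
    (firstBI_denominator_ne_zero hG hn _) (fun k hk => by
      rw [truncParam_gap]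
      exact biEig_ne hG hn (by omega) hk.ne')
  rw [truncParam_gap, Finset.prod_div_distrib, truncZ_even,
    show -(1 / 4 - (s : K) - p₁ - p₂ - p₂ + 1 / 4) = 2 * p₂ + s + p₁ - 1 / 2 by ring,
    show -(1 / 4 - (s : K) - p₁ - p₂ + p₂ - 1 / 4) = s + p₁ by ring] at h1
  rw [truncZ_even]
  exact h1

theorem IsRegular.firstBI_last_odd {s n : ℕ} (h : IsRegular p₁ p₂ c (2 * s + 1))
    (hn : n ≤ 2 * s + 1) (hG : ∀ k : ℕ, k < 2 * s + 1 → c + 2 * p₂ + 1 / 2 + (k : K) ≠ 0) :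
    firstBI p₁ p₂ c n (truncZ p₁ p₂ (2 * s + 1)) (gridPt (1 / 2 - p₁) (2 * s + 1)) =
      (∏ k ∈ Finset.range n, biLow (c - p₁ + 1 / 2) (s + p₁ + 2 * p₂) (s + p₁ + 1 / 2)
        (1 / 2 - p₁) k) /
        ∏ k ∈ Finset.range n, (biEig (c + 2 * p₂ - 1 / 2) n - biEig (c + 2 * p₂ - 1 / 2) k) := by
  have h1 := h.isTruncated.bannaiIto_last_odd (by simp)
    (firstBI_denominator_ne_zero hG hn _) (fun k hk => by
      rw [truncParam_gap]
      exact biEig_ne hG hn (by omega) hk.ne')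
  rw [truncParam_gap, Finset.prod_div_distrib, truncZ_odd,
    show (s : K) + p₁ + p₂ + 1 / 4 - p₂ + 1 / 4 = s + p₁ + 1 / 2 by ring,
    show (s : K) + p₁ + p₂ + 1 / 4 + p₂ - 1 / 4 = s + p₁ + 2 * p₂ by ring] at h1
  rw [truncZ_odd, firstBI, show (s : K) + p₁ + p₂ + 1 / 4 - p₂ + 1 / 4 = s + p₁ + 1 / 2 by ring,
    show (s : K) + p₁ + p₂ + 1 / 4 + p₂ - 1 / 4 = s + p₁ + 2 * p₂ by ring]
  exact h1

theorem newton_last_even (p : K) (s : ℕ) :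
    newton (1 / 2 - p) (2 * s) (gridPt (1 / 2 - p) (2 * s)) = s ! * poch (2 * p + s) s := by
  rw [newton_even_eq_poch, gridPt_even, show 1 / 2 - p - 1 / 2 - (s : K) - (1 / 2 - p) + 1 / 2 =
    -s by ring, show -(1 / 2 - p - 1 / 2 - (s : K)) - (1 / 2 - p) + 1 / 2 = 2 * p + s by ring,
    poch_neg_nat_self]
  have hsq : ((-1 : K) ^ s) * (-1) ^ s = 1 := by rw [← mul_pow]; simp
  linear_combination (s ! * poch (2 * p + s) s) * hsq

theorem newton_last_odd (p : K) (s : ℕ) :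
    newton (1 / 2 - p) (2 * s + 1) (gridPt (1 / 2 - p) (2 * s + 1)) =
      s ! * poch (2 * p + s) (s + 1) := by
  rw [gridPt_odd_eq_neg, newton_succ, newton_even_neg, newton_last_even, gridPt_even, poch_succ]
  ring

end Norms

/-! The closed form of the norms, by evaluating the products in `IsRegular.firstBI_norm_prod` in
each of the four parity cases. -/

section NormCases

variable {K : Type*} [Field K] [CharZero K] {p₁ p₂ c : K}

theorem IsRegular.firstBI_norm_even_even {e s : ℕ} (h : IsRegular p₁ p₂ c (2 * s))
    (hn : 2 * e ≤ 2 * s) (hG : ∀ k : ℕ, k < 2 * s → c + 2 * p₂ + 1 / 2 + (k : K) ≠ 0) :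
    ∑ k ∈ Finset.range (2 * s + 1), weight1 p₁ p₂ c (2 * s - k) (2 * s) *
      firstBI p₁ p₂ c (2 * e) (truncZ p₁ p₂ (2 * s)) (gridPt (1 / 2 - p₁) k) *
      firstBI p₁ p₂ c (2 * e) (truncZ p₁ p₂ (2 * s)) (gridPt (1 / 2 - p₁) k) =
    uniNormEE p₁ p₂ c e s := by
  have hb := Finset.prod_ne_zero_iff.mpr fun k (hk : k ∈ Finset.Ico (2 * e) (2 * s)) =>
    h.biLow_ne_zero k (Finset.mem_Ico.mp hk).2
  have hd := firstBI_denominator_ne_zero hG hn (p₁ := p₁) (truncZ p₁ p₂ (2 * s))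
  obtain ⟨t, rfl⟩ : ∃ t, s = e + t := ⟨s - e, by omega⟩
  have hlow : ∏ k ∈ Finset.Ico (2 * e) (2 * (e + t)), biLow (c - p₁ + 1 / 2)
      (truncZ p₁ p₂ (2 * (e + t)) + p₂ - 1 / 4) (1 / 2 - p₁)
      (truncZ p₁ p₂ (2 * (e + t)) - p₂ + 1 / 4) k =
      poch (c + 1 / 2 + e) t * ((-1) ^ t * (t ! : K)) *
        (poch ((e : K) + 1) t * poch (2 * p₁ + 2 * p₂ + ((e + t : ℕ) : K) + e) t) := by
    rw [← poch_neg_nat_self, truncZ_even, prod_Ico_even_even, prod_biLow_even, prod_biLow_odd]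
    push_cast
    congr 3 <;> ring
  have hgap : ∏ k ∈ Finset.Ico (2 * e) (2 * (e + t)), (biEig (c + 2 * p₂ - 1 / 2) (2 * e) -
      biEig (c + 2 * p₂ - 1 / 2) (k + 1)) =
      poch (c + 2 * p₂ + 1 / 2 + 2 * e) t * ((-1) ^ t * (t ! : K)) := by
    rw [prod_Ico_even_even, prod_biEig_even_succ, prod_biEig_even_succ_succ,
      show c + 2 * p₂ - 1 / 2 + 1 = c + 2 * p₂ + 1 / 2 by ring]
  have hlast : firstBI p₁ p₂ c (2 * e) (truncZ p₁ p₂ (2 * (e + t)))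
      (gridPt (1 / 2 - p₁) (2 * (e + t))) =
      poch (-((e + t : ℕ) : K)) e * poch (2 * p₂) e *
          (e ! * poch (c - 2 * p₁ + 3 / 2 - ((e + t : ℕ) : K)) e) /
        (e ! * poch (c + 2 * p₂ + 1 / 2 + e) e) := by
    rw [h.firstBI_last_even hn hG, prod_biLow_range_even, prod_biEig_even, neg_one_pow_even,
      one_mul,
      show c + 2 * p₂ - 1 / 2 + 1 = c + 2 * p₂ + 1 / 2 by ring]
    congr 4 <;> ring
  rw [h.firstBI_norm_prod hn hG, hlow, hgap, hlast, newton_last_even]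
  rw [hlow] at hb
  rw [truncParam_gap, show (2 * e) / 2 = e by omega, show (2 * e) % 2 = 0 by omega,
    show (e : K) + (c + 2 * p₂ - 1 / 2) + 1 = c + 2 * p₂ + 1 / 2 + e by ring, add_zero] at hd
  have he : (e ! : K) ≠ 0 := Nat.cast_ne_zero.mpr (Nat.factorial_ne_zero e)
  have ht : (t ! : K) ≠ 0 := Nat.cast_ne_zero.mpr (Nat.factorial_ne_zero t)
  rw [uniNormEE]
  rw [show e + t - e = t by omega, factorial_add]
  simp only [mul_ne_zero_iff] at hb
  obtain ⟨⟨h1, h2, h3⟩, h4, h5⟩ := hb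
  -- With the Pochhammer symbols as atoms the identity is a cancellation of common factors.
  generalize poch (c + 1 / 2 + e) t = A at *
  generalize poch ((e : K) + 1) t = B at *
  generalize poch (2 * p₁ + 2 * p₂ + ((e + t : ℕ) : K) + e) t = C at *
  generalize poch (c + 2 * p₂ + 1 / 2 + e) e = D at *
  field_simp

theorem IsRegular.firstBI_norm_odd_even {e s : ℕ} (h : IsRegular p₁ p₂ c (2 * s))
    (hn : 2 * e + 1 ≤ 2 * s) (hG : ∀ k : ℕ, k < 2 * s → c + 2 * p₂ + 1 / 2 + (k : K) ≠ 0) :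
    ∑ k ∈ Finset.range (2 * s + 1), weight1 p₁ p₂ c (2 * s - k) (2 * s) *
      firstBI p₁ p₂ c (2 * e + 1) (truncZ p₁ p₂ (2 * s)) (gridPt (1 / 2 - p₁) k) *
      firstBI p₁ p₂ c (2 * e + 1) (truncZ p₁ p₂ (2 * s)) (gridPt (1 / 2 - p₁) k) =
    uniNormOE p₁ p₂ c e s := by
  have hb := Finset.prod_ne_zero_iff.mpr fun k (hk : k ∈ Finset.Ico (2 * e + 1) (2 * s)) =>
    h.biLow_ne_zero k (Finset.mem_Ico.mp hk).2
  have hd := firstBI_denominator_ne_zero hG hn (p₁ := p₁) (truncZ p₁ p₂ (2 * s))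
  obtain ⟨t, rfl⟩ : ∃ t, s = e + 1 + t := ⟨s - (e + 1), by omega⟩
  have hlow : ∏ k ∈ Finset.Ico (2 * e + 1) (2 * (e + 1 + t)), biLow (c - p₁ + 1 / 2)
      (truncZ p₁ p₂ (2 * (e + 1 + t)) + p₂ - 1 / 4) (1 / 2 - p₁)
      (truncZ p₁ p₂ (2 * (e + 1 + t)) - p₂ + 1 / 4) k =
      poch (c + 1 / 2 + e + 1) t * ((-1) ^ t * (t ! : K)) *
        (poch ((e : K) + 1) (t + 1) *
          poch (2 * p₁ + 2 * p₂ + ((e + 1 + t : ℕ) : K) + e) (t + 1)) := by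
    rw [← poch_neg_nat_self, truncZ_even, prod_Ico_odd_even, prod_biLow_even, prod_biLow_odd]
    push_cast
    congr 3 <;> ring
  have hgap : ∏ k ∈ Finset.Ico (2 * e + 1) (2 * (e + 1 + t)),
      (biEig (c + 2 * p₂ - 1 / 2) (2 * e + 1) - biEig (c + 2 * p₂ - 1 / 2) (k + 1)) =
      (t ! : K) * ((-1) ^ (t + 1) * poch (c + 2 * p₂ + 1 / 2 + 2 * e + 1) (t + 1)) := by
    rw [prod_Ico_odd_even, prod_biEig_odd_succ_succ, prod_biEig_odd_succ,
      show c + 2 * p₂ - 1 / 2 + 1 = c + 2 * p₂ + 1 / 2 by ring]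
  have hlast : firstBI p₁ p₂ c (2 * e + 1) (truncZ p₁ p₂ (2 * (e + 1 + t)))
      (gridPt (1 / 2 - p₁) (2 * (e + 1 + t))) =
      poch (-((e + 1 + t : ℕ) : K)) (e + 1) * poch (2 * p₂) (e + 1) *
          (e ! * poch (c - 2 * p₁ + 3 / 2 - ((e + 1 + t : ℕ) : K)) e) /
        (e ! * poch (c + 2 * p₂ + 1 / 2 + e) (e + 1)) := by
    rw [h.firstBI_last_even hn hG, prod_biLow_range_odd, prod_biEig_odd, neg_one_pow_odd,
      neg_one_mul, div_neg, neg_neg,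
      show c + 2 * p₂ - 1 / 2 + 1 = c + 2 * p₂ + 1 / 2 by ring]
    congr 4 <;> ring
  rw [h.firstBI_norm_prod hn hG, hlow, hgap, hlast, newton_last_even]
  rw [hlow] at hb
  rw [truncParam_gap, show (2 * e + 1) / 2 = e by omega, show (2 * e + 1) % 2 = 1 by omega,
    show (e : K) + (c + 2 * p₂ - 1 / 2) + 1 = c + 2 * p₂ + 1 / 2 + e by ring] at hd
  have he : (e ! : K) ≠ 0 := Nat.cast_ne_zero.mpr (Nat.factorial_ne_zero e)
  have ht : (t ! : K) ≠ 0 := Nat.cast_ne_zero.mpr (Nat.factorial_ne_zero t)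
  rw [uniNormOE]
  rw [show e + 1 + t - e = t + 1 by omega, show t + 1 - 1 = t by omega,
    show (((e + 1 + t : ℕ)) ! : K) = e ! * poch ((e : K) + 1) (t + 1) by
      rw [← factorial_add, show e + 1 + t = e + (t + 1) by ring]]
  simp only [mul_ne_zero_iff] at hb
  obtain ⟨⟨h1, h2, h3⟩, h4, h5⟩ := hb
  generalize poch (c + 1 / 2 + e + 1) t = A at *
  generalize poch ((e : K) + 1) (t + 1) = B at *
  generalize poch (2 * p₁ + 2 * p₂ + ((e + 1 + t : ℕ) : K) + e) (t + 1) = C at *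
  generalize poch (c + 2 * p₂ + 1 / 2 + e) (e + 1) = D at *
  field_simp
  ring

theorem IsRegular.firstBI_norm_even_odd {e s : ℕ} (h : IsRegular p₁ p₂ c (2 * s + 1))
    (hn : 2 * e ≤ 2 * s + 1) (hG : ∀ k : ℕ, k < 2 * s + 1 → c + 2 * p₂ + 1 / 2 + (k : K) ≠ 0) :
    ∑ k ∈ Finset.range (2 * s + 1 + 1), weight1 p₁ p₂ c (2 * s + 1 - k) (2 * s + 1) *
      firstBI p₁ p₂ c (2 * e) (truncZ p₁ p₂ (2 * s + 1)) (gridPt (1 / 2 - p₁) k) *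
      firstBI p₁ p₂ c (2 * e) (truncZ p₁ p₂ (2 * s + 1)) (gridPt (1 / 2 - p₁) k) =
    uniNormEO p₁ p₂ c e s := by
  have hb := Finset.prod_ne_zero_iff.mpr fun k (hk : k ∈ Finset.Ico (2 * e) (2 * s + 1)) =>
    h.biLow_ne_zero k (Finset.mem_Ico.mp hk).2
  have hd := firstBI_denominator_ne_zero hG hn (p₁ := p₁) (truncZ p₁ p₂ (2 * s + 1))
  obtain ⟨t, rfl⟩ : ∃ t, s = e + t := ⟨s - e, by omega⟩
  have hlow : ∏ k ∈ Finset.Ico (2 * e) (2 * (e + t) + 1), biLow (c - p₁ + 1 / 2)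
      (truncZ p₁ p₂ (2 * (e + t) + 1) + p₂ - 1 / 4) (1 / 2 - p₁)
      (truncZ p₁ p₂ (2 * (e + t) + 1) - p₂ + 1 / 4) k =
      poch (c + 1 / 2 + e) (t + 1) * poch (2 * p₁ + 2 * p₂ + ((e + t : ℕ) : K) + e) (t + 1) *
        (poch ((e : K) + 1) t * ((-1) ^ t * (t ! : K))) := by
    rw [← poch_neg_nat_self, truncZ_odd, prod_Ico_even_odd, prod_biLow_even, prod_biLow_odd]
    push_cast
    congr 3 <;> ring
  have hgap : ∏ k ∈ Finset.Ico (2 * e) (2 * (e + t) + 1), (biEig (c + 2 * p₂ - 1 / 2) (2 * e) -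
      biEig (c + 2 * p₂ - 1 / 2) (k + 1)) =
      poch (c + 2 * p₂ + 1 / 2 + 2 * e) (t + 1) * ((-1) ^ t * (t ! : K)) := by
    rw [prod_Ico_even_odd, prod_biEig_even_succ, prod_biEig_even_succ_succ,
      show c + 2 * p₂ - 1 / 2 + 1 = c + 2 * p₂ + 1 / 2 by ring]
  have hlast : firstBI p₁ p₂ c (2 * e) (truncZ p₁ p₂ (2 * (e + t) + 1))
      (gridPt (1 / 2 - p₁) (2 * (e + t) + 1)) =
      poch (c - 2 * p₁ + 1 / 2 - ((e + t : ℕ) : K)) e * poch (2 * p₂) e *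
          (e ! * poch (-((e + t : ℕ) : K)) e) /
        (e ! * poch (c + 2 * p₂ + 1 / 2 + e) e) := by
    rw [h.firstBI_last_odd hn hG, prod_biLow_range_even, prod_biEig_even,
      show c + 2 * p₂ - 1 / 2 + 1 = c + 2 * p₂ + 1 / 2 by ring]
    congr 4 <;> ring
  rw [h.firstBI_norm_prod hn hG, hlow, hgap, hlast, newton_last_odd]
  rw [hlow] at hb
  rw [truncParam_gap, show (2 * e) / 2 = e by omega, show (2 * e) % 2 = 0 by omega,
    show (e : K) + (c + 2 * p₂ - 1 / 2) + 1 = c + 2 * p₂ + 1 / 2 + e by ring, add_zero] at hd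
  have he : (e ! : K) ≠ 0 := Nat.cast_ne_zero.mpr (Nat.factorial_ne_zero e)
  have ht : (t ! : K) ≠ 0 := Nat.cast_ne_zero.mpr (Nat.factorial_ne_zero t)
  rw [uniNormEO]
  rw [show e + t - e = t by omega, factorial_add]
  simp only [mul_ne_zero_iff] at hb
  obtain ⟨⟨h1, h2⟩, h4, h5, h6⟩ := hb
  generalize poch (c + 1 / 2 + e) (t + 1) = A at *
  generalize poch ((e : K) + 1) t = B at *
  generalize poch (2 * p₁ + 2 * p₂ + ((e + t : ℕ) : K) + e) (t + 1) = C at *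
  generalize poch (c + 2 * p₂ + 1 / 2 + e) e = D at *
  field_simp

theorem IsRegular.firstBI_norm_odd_odd {e s : ℕ} (h : IsRegular p₁ p₂ c (2 * s + 1))
    (hn : 2 * e + 1 ≤ 2 * s + 1) (hG : ∀ k : ℕ, k < 2 * s + 1 → c + 2 * p₂ + 1 / 2 + (k : K) ≠ 0) :
    ∑ k ∈ Finset.range (2 * s + 1 + 1), weight1 p₁ p₂ c (2 * s + 1 - k) (2 * s + 1) *
      firstBI p₁ p₂ c (2 * e + 1) (truncZ p₁ p₂ (2 * s + 1)) (gridPt (1 / 2 - p₁) k) *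
      firstBI p₁ p₂ c (2 * e + 1) (truncZ p₁ p₂ (2 * s + 1)) (gridPt (1 / 2 - p₁) k) =
    uniNormOO p₁ p₂ c e s := by
  have hb := Finset.prod_ne_zero_iff.mpr fun k (hk : k ∈ Finset.Ico (2 * e + 1) (2 * s + 1)) =>
    h.biLow_ne_zero k (Finset.mem_Ico.mp hk).2
  have hd := firstBI_denominator_ne_zero hG hn (p₁ := p₁) (truncZ p₁ p₂ (2 * s + 1))
  obtain ⟨t, rfl⟩ : ∃ t, s = e + t := ⟨s - e, by omega⟩
  have hlow : ∏ k ∈ Finset.Ico (2 * e + 1) (2 * (e + t) + 1), biLow (c - p₁ + 1 / 2)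
      (truncZ p₁ p₂ (2 * (e + t) + 1) + p₂ - 1 / 4) (1 / 2 - p₁)
      (truncZ p₁ p₂ (2 * (e + t) + 1) - p₂ + 1 / 4) k =
      poch (c + 1 / 2 + e + 1) t * poch (2 * p₁ + 2 * p₂ + ((e + t : ℕ) : K) + e + 1) t *
        (poch ((e : K) + 1) t * ((-1) ^ t * (t ! : K))) := by
    rw [← poch_neg_nat_self, truncZ_odd, prod_Ico_odd_odd, prod_biLow_even, prod_biLow_odd]
    push_cast
    congr 3 <;> ring
  have hgap : ∏ k ∈ Finset.Ico (2 * e + 1) (2 * (e + t) + 1),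
      (biEig (c + 2 * p₂ - 1 / 2) (2 * e + 1) - biEig (c + 2 * p₂ - 1 / 2) (k + 1)) =
      (t ! : K) * ((-1) ^ t * poch (c + 2 * p₂ + 1 / 2 + 2 * e + 1) t) := by
    rw [prod_Ico_odd_odd, prod_biEig_odd_succ_succ, prod_biEig_odd_succ,
      show c + 2 * p₂ - 1 / 2 + 1 = c + 2 * p₂ + 1 / 2 by ring]
  have hlast : firstBI p₁ p₂ c (2 * e + 1) (truncZ p₁ p₂ (2 * (e + t) + 1))
      (gridPt (1 / 2 - p₁) (2 * (e + t) + 1)) =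
      -(poch (c - 2 * p₁ + 1 / 2 - ((e + t : ℕ) : K)) (e + 1) * poch (2 * p₂) (e + 1) *
          (e ! * poch (-((e + t : ℕ) : K)) e)) /
        (e ! * poch (c + 2 * p₂ + 1 / 2 + e) (e + 1)) := by
    rw [h.firstBI_last_odd hn hG, prod_biLow_range_odd, prod_biEig_odd, div_neg, ← neg_div,
      show c + 2 * p₂ - 1 / 2 + 1 = c + 2 * p₂ + 1 / 2 by ring]
    congr 5 <;> ring
  rw [h.firstBI_norm_prod hn hG, hlow, hgap, hlast, newton_last_odd]
  rw [hlow] at hb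
  rw [truncParam_gap, show (2 * e + 1) / 2 = e by omega, show (2 * e + 1) % 2 = 1 by omega,
    show (e : K) + (c + 2 * p₂ - 1 / 2) + 1 = c + 2 * p₂ + 1 / 2 + e by ring] at hd
  have he : (e ! : K) ≠ 0 := Nat.cast_ne_zero.mpr (Nat.factorial_ne_zero e)
  have ht : (t ! : K) ≠ 0 := Nat.cast_ne_zero.mpr (Nat.factorial_ne_zero t)
  rw [uniNormOO]
  rw [show e + t - e = t by omega, factorial_add]
  simp only [mul_ne_zero_iff] at hb
  obtain ⟨⟨h1, h2⟩, h4, h5, h6⟩ := hb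
  generalize poch (c + 1 / 2 + e + 1) t = A at *
  generalize poch ((e : K) + 1) t = B at *
  generalize poch (2 * p₁ + 2 * p₂ + ((e + t : ℕ) : K) + e + 1) t = C at *
  generalize poch (c + 2 * p₂ + 1 / 2 + e) (e + 1) = D at *
  field_simp

end NormCases

/-! ### Dependence of the univariate norms on the size of the grid -/

section NormRatios

variable {K : Type*} [Field K] {p₁ p₂ p₃ c : K}

theorem IsRegular.poch_two {S i k : ℕ} (h : IsRegular p₁ p₂ c S) (hi : S / 2 ≤ i)
    (hk : i + k ≤ S) {x : K} (hx : x = 2 * p₁ + 2 * p₂ + i) : poch x k ≠ 0 :=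
  poch_ne_zero fun j hj h0 => h.two_ne (i + j) (by omega) (by omega) (by
    push_cast
    linear_combination h0 - hx)

theorem IsRegular.poch_c {S i k : ℕ} (h : IsRegular p₁ p₂ c S) (hk : i + k ≤ (S + 1) / 2)
    {x : K} (hx : x = c + 1 / 2 + i) : poch x k ≠ 0 :=
  poch_ne_zero fun j hj h0 => h.c_ne (i + j) (by omega) (by
    push_cast
    linear_combination h0 - hx)

theorem poch_shift_of_eq {a b x y : K} {n : ℕ} (h : b = a + 1) (hx : x = a) (hy : y = a + n) :
    x * poch b n = poch a n * y := by
  rw [h, hx, hy, poch_shift]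

theorem poch_succ_of_eq {a y : K} {n : ℕ} (hy : y = a + n) : poch a (n + 1) = poch a n * y := by
  rw [hy, poch_succ]

theorem poch_succ_left_of_eq {a b x : K} {n : ℕ} (h : b = a + 1) (hx : x = a) :
    poch a (n + 1) = x * poch b n := by
  rw [h, hx, poch_succ_left]

theorem mul_congr_eq {x y z w : K} (h : x = y) (h' : z = w) : x * z = y * w := by rw [h, h']

variable [CharZero K]

/-! In the following ratios, one step of `S` shifts the base or the length of each Pochhammer symbol
by at most one, so that all but a few linear factors cancel. -/

theorem uniNormEO_mul_eq {e t : ℕ} (h : IsRegular p₁ p₂ c (2 * (e + t) + 2))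
    (h' : IsRegular p₁ p₂ c (2 * (e + t) + 1)) (hG : poch (c + 2 * p₂ + 1 / 2 + e) e ≠ 0) :
    uniNormEO p₁ p₂ c e (e + t) * ((2 * p₁ + 2 * (e + t) + 1) * (e + t + 1) *
        (2 * p₁ + 2 * p₂ + (e + t) + e)) =
      uniNormEE p₁ p₂ c e (e + t + 1) * ((2 * p₁ + (e + t)) * (t + 1) *
        (2 * p₁ + 2 * p₂ + 2 * (e + t) + 1)) := by
  have hc : poch (c + 1 / 2 + e) (t + 1) ≠ 0 := h.poch_c (i := e) (by omega) rfl
  have hA := h.poch_two (i := e + t + 1 + e) (k := t + 1) (by omega) (by omega)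
    (show 2 * p₁ + 2 * p₂ + ((e + t + 1 : ℕ) : K) + e = _ by push_cast; ring)
  have hA' := h'.poch_two (i := e + t + e) (k := t + 1) (by omega) (by omega)
    (show 2 * p₁ + 2 * p₂ + ((e + t : ℕ) : K) + e = _ by push_cast; ring)
  have e1 : (2 * p₁ + (e + t)) * poch (2 * p₁ + ((e + t + 1 : ℕ) : K)) (e + t + 1) =
      poch (2 * p₁ + ((e + t : ℕ) : K)) (e + t + 1) * (2 * p₁ + 2 * (e + t) + 1) :=
    poch_shift_of_eq (by push_cast; ring) (by push_cast; ring) (by push_cast; ring)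
  have e2 : (-(e + t + 1)) * poch (-((e + t : ℕ) : K)) e =
      poch (-((e + t + 1 : ℕ) : K)) e * (-(t + 1)) :=
    poch_shift_of_eq (by push_cast; ring) (by push_cast; ring) (by push_cast; ring)
  have e3 : (2 * p₁ + 2 * p₂ + (e + t) + e) *
      poch (2 * p₁ + 2 * p₂ + ((e + t + 1 : ℕ) : K) + e) (t + 1) =
      poch (2 * p₁ + 2 * p₂ + ((e + t : ℕ) : K) + e) (t + 1) *
        (2 * p₁ + 2 * p₂ + 2 * (e + t) + 1) :=
    poch_shift_of_eq (by push_cast; ring) (by push_cast; ring) (by push_cast; ring)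
  have e4 : c - 2 * p₁ + 3 / 2 - ((e + t + 1 : ℕ) : K) = c - 2 * p₁ + 1 / 2 - (e + t : ℕ) := by
    push_cast
    ring
  rw [uniNormEO, uniNormEE, show e + t - e = t by omega, show e + t + 1 - e = t + 1 by omega, e4,
    div_mul_eq_mul_div, div_mul_eq_mul_div, div_eq_div_iff (mul_ne_zero (mul_ne_zero hG hc) hA')
      (mul_ne_zero (mul_ne_zero hG hc) hA)]
  linear_combination (-(poch (2 * p₂) e * e ! * poch (c - 2 * p₁ + 1 / 2 - (e + t : ℕ)) e *
    poch (c + 2 * p₂ + 1 / 2 + 2 * e) (t + 1) * (poch (c + 2 * p₂ + 1 / 2 + e) e *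
    poch (c + 1 / 2 + e) (t + 1)))) * mul_congr_eq (mul_congr_eq e1.symm e2) e3

theorem uniNormOO_mul_eq {e t : ℕ} (h : IsRegular p₁ p₂ c (2 * (e + t) + 2))
    (h' : IsRegular p₁ p₂ c (2 * (e + t) + 1))
    (hG : poch (c + 2 * p₂ + 1 / 2 + e) (e + 1) ≠ 0) :
    uniNormOO p₁ p₂ c e (e + t) * ((2 * p₁ + 2 * (e + t) + 1) * (-(e + t + 1)) *
        (c + 2 * p₂ + 1 / 2 + e + (e + t) + 1)) =
      uniNormOE p₁ p₂ c e (e + t + 1) * ((2 * p₁ + (e + t)) *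
        (c - 2 * p₁ + 1 / 2 - (e + t) + e) * (2 * p₁ + 2 * p₂ + 2 * (e + t) + 1)) := by
  have hc : poch (c + 1 / 2 + e + 1) t ≠ 0 :=
    h.poch_c (i := e + 1) (by omega) (by push_cast; ring)
  have hA := h.poch_two (i := e + t + 1 + e) (k := t + 1) (by omega) (by omega)
    (show 2 * p₁ + 2 * p₂ + ((e + t + 1 : ℕ) : K) + e = _ by push_cast; ring)
  have hA' := h'.poch_two (i := e + t + e + 1) (k := t) (by omega) (by omega)
    (show 2 * p₁ + 2 * p₂ + ((e + t : ℕ) : K) + e + 1 = _ by push_cast; ring)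
  have e1 : (2 * p₁ + (e + t)) * poch (2 * p₁ + ((e + t + 1 : ℕ) : K)) (e + t + 1) =
      poch (2 * p₁ + ((e + t : ℕ) : K)) (e + t + 1) * (2 * p₁ + 2 * (e + t) + 1) :=
    poch_shift_of_eq (by push_cast; ring) (by push_cast; ring) (by push_cast; ring)
  have e2 : poch (-((e + t + 1 : ℕ) : K)) (e + 1) = (-(e + t + 1)) * poch (-((e + t : ℕ) : K)) e :=
    poch_succ_left_of_eq (by push_cast; ring) (by push_cast; ring)
  have e3 : poch (2 * p₁ + 2 * p₂ + ((e + t + 1 : ℕ) : K) + e) (t + 1) =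
      poch (2 * p₁ + 2 * p₂ + ((e + t : ℕ) : K) + e + 1) t *
        (2 * p₁ + 2 * p₂ + 2 * (e + t) + 1) := by
    rw [show 2 * p₁ + 2 * p₂ + ((e + t + 1 : ℕ) : K) + e =
      2 * p₁ + 2 * p₂ + ((e + t : ℕ) : K) + e + 1 by push_cast; ring]
    exact poch_succ_of_eq (by push_cast; ring)
  have e4 : c - 2 * p₁ + 3 / 2 - ((e + t + 1 : ℕ) : K) = c - 2 * p₁ + 1 / 2 - (e + t : ℕ) := by
    push_cast
    ring
  have e5 : poch (c - 2 * p₁ + 1 / 2 - (e + t : ℕ)) (e + 1) =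
      poch (c - 2 * p₁ + 1 / 2 - (e + t : ℕ)) e * (c - 2 * p₁ + 1 / 2 - (e + t) + e) :=
    poch_succ_of_eq (by push_cast; ring)
  have e6 : poch (c + 2 * p₂ + 1 / 2 + 2 * e + 1) (t + 1) =
      poch (c + 2 * p₂ + 1 / 2 + 2 * e + 1) t * (c + 2 * p₂ + 1 / 2 + e + (e + t) + 1) :=
    poch_succ_of_eq (by ring)
  rw [uniNormOO, uniNormOE, show e + t - e = t by omega, show e + t + 1 - e - 1 = t by omega,
    show e + t + 1 - e = t + 1 by omega, e4, e2, e3, e5, e6,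
    div_mul_eq_mul_div, div_mul_eq_mul_div, div_eq_div_iff (mul_ne_zero (mul_ne_zero hG hc) hA')
      (mul_ne_zero (mul_ne_zero hG hc) (e3 ▸ hA))]
  linear_combination (poch (-((e + t : ℕ) : K)) e * (e + t + 1) * poch (2 * p₂) (e + 1) * e ! *
    (poch (c - 2 * p₁ + 1 / 2 - (e + t : ℕ)) e * (c - 2 * p₁ + 1 / 2 - (e + t) + e)) *
    (poch (c + 2 * p₂ + 1 / 2 + 2 * e + 1) t * (c + 2 * p₂ + 1 / 2 + e + (e + t) + 1)) *
    (poch (c + 2 * p₂ + 1 / 2 + e) (e + 1) * poch (c + 1 / 2 + e + 1) t) *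
    (poch (2 * p₁ + 2 * p₂ + ((e + t : ℕ) : K) + e + 1) t *
        (2 * p₁ + 2 * p₂ + 2 * (e + t) + 1))) * e1.symm

theorem uniNormEE_mul_eq {e t : ℕ} (h : IsRegular p₁ p₂ c (2 * (e + t) + 1))
    (hG : poch (c + 2 * p₂ + 1 / 2 + e) e ≠ 0) :
    uniNormEE p₁ p₂ c e (e + t) * ((2 * p₁ + 2 * (e + t)) * (c + 2 * p₂ + 1 / 2 + e + (e + t)) *
        (c - 2 * p₁ + 1 / 2 - (e + t))) =
      uniNormEO p₁ p₂ c e (e + t) * ((c - 2 * p₁ + 1 / 2 - (e + t) + e) *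
        (c + 1 / 2 + (e + t)) * (2 * p₁ + 2 * p₂ + 2 * (e + t))) := by
  have hc : poch (c + 1 / 2 + e) (t + 1) ≠ 0 := h.poch_c (i := e) (by omega) rfl
  have hA := h.poch_two (i := e + t + e) (k := t + 1) (by omega) (by omega)
    (show 2 * p₁ + 2 * p₂ + ((e + t : ℕ) : K) + e = _ by push_cast; ring)
  have hc' := poch_ne_zero_of_le (Nat.le_succ t) hc
  have hA' := poch_ne_zero_of_le (Nat.le_succ t) hA
  have e1 : poch (2 * p₁ + ((e + t : ℕ) : K)) (e + t + 1) =
      poch (2 * p₁ + ((e + t : ℕ) : K)) (e + t) * (2 * p₁ + 2 * (e + t)) :=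
    poch_succ_of_eq (by push_cast; ring)
  have e2 : poch (c + 1 / 2 + e) (t + 1) = poch (c + 1 / 2 + e) t * (c + 1 / 2 + (e + t)) :=
    poch_succ_of_eq (by ring)
  have e3 : poch (2 * p₁ + 2 * p₂ + ((e + t : ℕ) : K) + e) (t + 1) =
      poch (2 * p₁ + 2 * p₂ + ((e + t : ℕ) : K) + e) t * (2 * p₁ + 2 * p₂ + 2 * (e + t)) :=
    poch_succ_of_eq (by push_cast; ring)
  have e5 : (c - 2 * p₁ + 1 / 2 - (e + t)) * poch (c - 2 * p₁ + 3 / 2 - (e + t : ℕ)) e =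
      poch (c - 2 * p₁ + 1 / 2 - (e + t : ℕ)) e * (c - 2 * p₁ + 1 / 2 - (e + t) + e) :=
    poch_shift_of_eq (by push_cast; ring) (by push_cast; ring) (by push_cast; ring)
  have e6 : poch (c + 2 * p₂ + 1 / 2 + 2 * e) (t + 1) =
      poch (c + 2 * p₂ + 1 / 2 + 2 * e) t * (c + 2 * p₂ + 1 / 2 + e + (e + t)) :=
    poch_succ_of_eq (by ring)
  rw [uniNormEO, uniNormEE, show e + t - e = t by omega,
    div_mul_eq_mul_div, div_mul_eq_mul_div, div_eq_div_iff
      (mul_ne_zero (mul_ne_zero hG hc') hA') (mul_ne_zero (mul_ne_zero hG hc) hA),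
    e1, e2, e3, e6]
  linear_combination (poch (2 * p₁ + ((e + t : ℕ) : K)) (e + t) * (2 * p₁ + 2 * (e + t)) *
    poch (-((e + t : ℕ) : K)) e * poch (2 * p₂) e * e ! *
    (poch (c + 2 * p₂ + 1 / 2 + 2 * e) t * (c + 2 * p₂ + 1 / 2 + e + (e + t))) *
    (poch (c + 2 * p₂ + 1 / 2 + e) e * (poch (c + 1 / 2 + e) t * (c + 1 / 2 + (e + t)))) *
    (poch (2 * p₁ + 2 * p₂ + ((e + t : ℕ) : K) + e) t *
        (2 * p₁ + 2 * p₂ + 2 * (e + t)))) * e5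

theorem uniNormOE_mul_eq {e t : ℕ} (h : IsRegular p₁ p₂ c (2 * (e + 1 + t) + 1))
    (h' : IsRegular p₁ p₂ c (2 * (e + 1 + t)))
    (hG : poch (c + 2 * p₂ + 1 / 2 + e) (e + 1) ≠ 0) :
    uniNormOE p₁ p₂ c e (e + 1 + t) * ((2 * p₁ + 2 * (e + 1 + t)) *
        (2 * p₁ + 2 * p₂ + (e + 1 + t) + e) * (c - 2 * p₁ + 1 / 2 - (e + 1 + t))) =
      uniNormOO p₁ p₂ c e (e + 1 + t) * ((-(e + 1 + t) + e) *
        (c + 1 / 2 + (e + 1 + t)) * (2 * p₁ + 2 * p₂ + 2 * (e + 1 + t))) := by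
  have hc : poch (c + 1 / 2 + e + 1) (t + 1) ≠ 0 :=
    h.poch_c (i := e + 1) (by omega) (by push_cast; ring)
  have hA := h.poch_two (i := e + 1 + t + e + 1) (k := t + 1) (by omega) (by omega)
    (show 2 * p₁ + 2 * p₂ + ((e + 1 + t : ℕ) : K) + e + 1 = _ by push_cast; ring)
  have hA' := h'.poch_two (i := e + 1 + t + e) (k := t + 1) (by omega) (by omega)
    (show 2 * p₁ + 2 * p₂ + ((e + 1 + t : ℕ) : K) + e = _ by push_cast; ring)
  have hc' := poch_ne_zero_of_le (Nat.le_succ t) hc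
  have e1 : poch (2 * p₁ + ((e + 1 + t : ℕ) : K)) (e + 1 + t + 1) =
      poch (2 * p₁ + ((e + 1 + t : ℕ) : K)) (e + 1 + t) * (2 * p₁ + 2 * (e + 1 + t)) :=
    poch_succ_of_eq (by push_cast; ring)
  have e2 : poch (c + 1 / 2 + e + 1) (t + 1) =
      poch (c + 1 / 2 + e + 1) t * (c + 1 / 2 + (e + 1 + t)) :=
    poch_succ_of_eq (by ring)
  have e3 : (2 * p₁ + 2 * p₂ + (e + 1 + t) + e) *
      poch (2 * p₁ + 2 * p₂ + ((e + 1 + t : ℕ) : K) + e + 1) (t + 1) =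
      poch (2 * p₁ + 2 * p₂ + ((e + 1 + t : ℕ) : K) + e) (t + 1) *
        (2 * p₁ + 2 * p₂ + 2 * (e + 1 + t)) :=
    poch_shift_of_eq (by push_cast; ring) (by push_cast; ring) (by push_cast; ring)
  have e4 : poch (-((e + 1 + t : ℕ) : K)) (e + 1) =
      poch (-((e + 1 + t : ℕ) : K)) e * (-(e + 1 + t) + e) :=
    poch_succ_of_eq (by push_cast; ring)
  have e5 : poch (c - 2 * p₁ + 1 / 2 - (e + 1 + t : ℕ)) (e + 1) =
      (c - 2 * p₁ + 1 / 2 - (e + 1 + t)) * poch (c - 2 * p₁ + 3 / 2 - (e + 1 + t : ℕ)) e :=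
    poch_succ_left_of_eq (by push_cast; ring) (by push_cast; ring)
  rw [uniNormOE, uniNormOO, show e + 1 + t - e - 1 = t by omega,
    show e + 1 + t - e = t + 1 by omega,
    div_mul_eq_mul_div, div_mul_eq_mul_div, div_eq_div_iff
      (mul_ne_zero (mul_ne_zero hG hc') hA') (mul_ne_zero (mul_ne_zero hG hc) hA),
    e1, e2, e4, e5]
  linear_combination (-(poch (2 * p₁ + ((e + 1 + t : ℕ) : K)) (e + 1 + t) *
    (2 * p₁ + 2 * (e + 1 + t)) *
    (poch (-((e + 1 + t : ℕ) : K)) e * (-(e + 1 + t) + e)) * poch (2 * p₂) (e + 1) * e ! *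
    ((c - 2 * p₁ + 1 / 2 - (e + 1 + t)) * poch (c - 2 * p₁ + 3 / 2 - (e + 1 + t : ℕ)) e) *
    poch (c + 2 * p₂ + 1 / 2 + 2 * e + 1) (t + 1) *
    (poch (c + 2 * p₂ + 1 / 2 + e) (e + 1) *
      (poch (c + 1 / 2 + e + 1) t * (c + 1 / 2 + (e + 1 + t)))))) * e3

end NormRatios

/-! ### The second weight as a weight of the second factor -/

section SecondWeights

variable {K : Type*} [Field K] {p₁ p₂ p₃ c : K}

/-- The parameters for which no denominator of the bivariate polynomials, weights and norms
of size `N` vanishes. -/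
structure IsAdmissible (p₁ p₂ p₃ c : K) (N : ℕ) : Prop where
  c_ne : ∀ k : ℕ, k < (N + 1) / 2 → c + 1 / 2 + (k : K) ≠ 0
  one_ne : ∀ k : ℕ, k < N → 2 * p₁ + (k : K) ≠ 0
  two_ne : ∀ k : ℕ, k < N → 2 * p₁ + 2 * p₂ + (k : K) ≠ 0
  three_ne : ∀ k : ℕ, N / 2 ≤ k → k < N → 2 * p₁ + 2 * p₂ + 2 * p₃ + 1 / 2 + (k : K) ≠ 0
  c_two_ne : ∀ k : ℕ, k < N → c + 2 * p₂ + 1 / 2 + (k : K) ≠ 0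
  c_three_ne : ∀ k : ℕ, k < N → c + 2 * p₂ + 2 * p₃ + 1 + (k : K) ≠ 0

theorem IsAdmissible.isRegular {N S : ℕ} (h : IsAdmissible p₁ p₂ p₃ c N) (hS : S ≤ N) :
    IsRegular p₁ p₂ c S where
  c_ne k hk := h.c_ne k (by omega)
  one_ne k hk := h.one_ne k (by omega)
  two_ne k _ hk := h.two_ne k (by omega)

theorem poch_last_ne_zero {a : K} {n : ℕ} (h : poch a (n + 1) ≠ 0) : a + n ≠ 0 := by
  rw [poch_succ] at h
  exact right_ne_zero_of_mul h

theorem choose_mul_eq (j t : ℕ) :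
    ((j + t).choose j : K) * (j + t + 1) = ((j + t + 1).choose j : K) * (t + 1) := by
  have h := Nat.choose_mul_succ_eq (j + t) j
  rw [show j + t + 1 - j = t + 1 by omega] at h
  have h' := congrArg (Nat.cast (R := K)) h
  push_cast at h'
  exact h'

theorem choose_succ_mul_eq (j t : ℕ) :
    ((j + t + 1).choose (j + 1) : K) * (j + 1) = ((j + t).choose j : K) * (j + t + 1) := by
  have h := Nat.add_one_mul_choose_eq (j + t) j
  have h' := congrArg (Nat.cast (R := K)) h
  push_cast at h'
  linear_combination -h'

theorem choose_succ_mul_eq' (j t : ℕ) :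
    ((j + t + 1).choose (j + 1) : K) * (j + 1) = ((j + t + 1).choose j : K) * (t + 1) := by
  rw [choose_succ_mul_eq, choose_mul_eq]

variable [CharZero K]

/-- The parameters of the second factor are regular: the conditions `c_two_ne`, `two_ne` and
`three_ne` take the place of `c_ne`, `one_ne` and `two_ne`. -/
theorem IsAdmissible.isRegular_second {N n : ℕ} (h : IsAdmissible p₁ p₂ p₃ c N) (hn : n ≤ N)
    {q₁ q₂ d : K} (hq₁ : q₁ = p₁ + p₂ + n / 2) (hq₂ : q₂ = p₃ + 1 / 4)
    (hd : d = c + n + 2 * p₂) : IsRegular q₁ q₂ d (N - n) where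
  c_ne k hk h0 := h.c_two_ne (n + k) (by omega) (by
    subst hd
    push_cast
    linear_combination h0)
  one_ne k hk h0 := h.two_ne (n + k) (by omega) (by
    subst hq₁
    push_cast
    linear_combination h0)
  two_ne k hk hk' h0 := h.three_ne (n + k) (by omega) (by omega) (by
    subst hq₁ hq₂
    push_cast
    linear_combination h0)

/-! Ratios of consecutive values of the second weight. The size of the grid is written as a sum, to
avoid subtractions of natural numbers. -/

theorem weight2OE_mul_eq {j t : ℕ} (hC : poch (1 / 2 - c - (j + t + 1 : ℕ)) j ≠ 0)
    (hQ : poch (1 - 2 * p₁ - 2 * p₂ - 2 * (j + t + 1 : ℕ)) (2 * j + 1) ≠ 0)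
    (hT : poch (1 / 2 - 2 * p₁ - 2 * p₂ - 2 * p₃ - 2 * (j + t + 1 : ℕ)) (j + 1) ≠ 0)
    (hU : poch (1 - 2 * p₁ - 2 * (j + t + 1 : ℕ) + 2 * j) (t + 1) ≠ 0)
    (hV : poch (2 - 2 * p₁ - 2 * (j + t + 1 : ℕ) + 2 * j) (t + 1) ≠ 0) :
    weight2OE p₁ p₂ p₃ c j (j + t + 1) * ((1 - 2 * p₁ - 2 * p₂ - 2 * (j + t + 1) + 2 * j) *
        (1 / 2 - 2 * p₁ - 2 * p₂ - 2 * p₃ - 2 * (j + t + 1) + j) *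
        (1 - 2 * p₁ - 2 * (j + t + 1) + 2 * j + (t + 1))) =
      weight2EE p₁ p₂ p₃ c j (j + t + 1) * ((t + 1) * (1 / 2 + 2 * p₃ + j) *
        (1 - 2 * p₁ - 2 * (j + t + 1) + 2 * j)) := by
  have hf : ((j + t)! : K) ≠ 0 := Nat.cast_ne_zero.mpr (Nat.factorial_ne_zero _)
  have hm : ((j : K) + t + 1) ≠ 0 := by exact_mod_cast Nat.succ_ne_zero (j + t)
  have e1 := choose_mul_eq (K := K) j t
  have e2 : (1 - 2 * p₁ - 2 * (j + t + 1) + 2 * j) *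
      poch (2 - 2 * p₁ - 2 * (j + t + 1 : ℕ) + 2 * j) (t + 1) =
      poch (1 - 2 * p₁ - 2 * (j + t + 1 : ℕ) + 2 * j) (t + 1) *
        (1 - 2 * p₁ - 2 * (j + t + 1) + 2 * j + (t + 1)) :=
    poch_shift_of_eq (by ring) (by push_cast; ring) (by push_cast; ring)
  have e3 : poch (1 - 2 * p₁ - 2 * p₂ - 2 * (j + t + 1 : ℕ)) (2 * j + 1) =
      poch (1 - 2 * p₁ - 2 * p₂ - 2 * (j + t + 1 : ℕ)) (2 * j) *
        (1 - 2 * p₁ - 2 * p₂ - 2 * (j + t + 1) + 2 * j) :=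
    poch_succ_of_eq (by push_cast; ring)
  have e4 : poch (1 / 2 - 2 * p₁ - 2 * p₂ - 2 * p₃ - 2 * (j + t + 1 : ℕ)) (j + 1) =
      poch (1 / 2 - 2 * p₁ - 2 * p₂ - 2 * p₃ - 2 * (j + t + 1 : ℕ)) j *
        (1 / 2 - 2 * p₁ - 2 * p₂ - 2 * p₃ - 2 * (j + t + 1) + j) :=
    poch_succ_of_eq (by push_cast; ring)
  have e5 := poch_succ (1 / 2 + 2 * p₃) j
  have e6 : ((j + t + 1)! : K) = (j + t + 1) * (j + t)! := by
    rw [Nat.factorial_succ]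
    push_cast
    ring
  have hQ' := poch_ne_zero_of_le (Nat.le_succ _) hQ
  have hT' := poch_ne_zero_of_le (Nat.le_succ _) hT
  rw [weight2OE, weight2EE, show j + t + 1 - 1 = j + t by omega,
    show j + t + 1 - j = t + 1 by omega, e6, div_mul_eq_mul_div, div_mul_eq_mul_div,
    div_eq_div_iff
      (mul_ne_zero (mul_ne_zero (mul_ne_zero (mul_ne_zero hf hC) hQ) hT) hV)
      (mul_ne_zero (mul_ne_zero (mul_ne_zero (mul_ne_zero (mul_ne_zero hm hf) hC) hQ') hT') hU),
    e3, e4, e5]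
  linear_combination ((-1) ^ j * poch (3 / 2 + c - 2 * p₁ - (j + t + 1 : ℕ)) j *
    poch (1 - 2 * p₁ - 2 * p₂ - 2 * (j + t + 1 : ℕ)) j *
    (poch (1 / 2 + 2 * p₃) j * (1 / 2 + 2 * p₃ + j)) * (j + t)! *
    poch (1 / 2 - c - (j + t + 1 : ℕ)) j *
    (poch (1 - 2 * p₁ - 2 * p₂ - 2 * (j + t + 1 : ℕ)) (2 * j) *
        (1 - 2 * p₁ - 2 * p₂ - 2 * (j + t + 1) + 2 * j)) *
    (poch (1 / 2 - 2 * p₁ - 2 * p₂ - 2 * p₃ - 2 * (j + t + 1 : ℕ)) j *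
        (1 / 2 - 2 * p₁ - 2 * p₂ - 2 * p₃ - 2 * (j + t + 1) + j))) * mul_congr_eq e1 e2.symm

theorem weight2EE_succ_mul_eq {j t : ℕ} (hC : poch (1 / 2 - c - (j + t + 1 : ℕ)) (j + 1) ≠ 0)
    (hQ : poch (1 - 2 * p₁ - 2 * p₂ - 2 * (j + t + 1 : ℕ)) (2 * j + 2) ≠ 0)
    (hT : poch (1 / 2 - 2 * p₁ - 2 * p₂ - 2 * p₃ - 2 * (j + t + 1 : ℕ)) (j + 1) ≠ 0)
    (hV : poch (2 - 2 * p₁ - 2 * (j + t + 1 : ℕ) + 2 * j) (t + 1) ≠ 0) :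
    weight2EE p₁ p₂ p₃ c (j + 1) (j + t + 1) * ((j + 1) * (1 / 2 - c - (j + t + 1) + j) *
        (1 - 2 * p₁ - 2 * p₂ - 2 * (j + t + 1) + (2 * j + 1))) =
      weight2OE p₁ p₂ p₃ c j (j + t + 1) * (-((1 - 2 * p₁ - 2 * p₂ - 2 * (j + t + 1) + j) *
        (2 - 2 * p₁ - 2 * (j + t + 1) + 2 * j)) * (3 / 2 + c - 2 * p₁ - (j + t + 1) + j)) := by
  have hf : ((j + t)! : K) ≠ 0 := Nat.cast_ne_zero.mpr (Nat.factorial_ne_zero _)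
  have hm : ((j : K) + t + 1) ≠ 0 := by exact_mod_cast Nat.succ_ne_zero (j + t)
  have e1 := choose_succ_mul_eq (K := K) j t
  have e2 : poch (2 - 2 * p₁ - 2 * (j + t + 1 : ℕ) + 2 * j) (t + 1) =
      (2 - 2 * p₁ - 2 * (j + t + 1) + 2 * j) *
        poch (1 - 2 * p₁ - 2 * (j + t + 1 : ℕ) + 2 * (j + 1 : ℕ)) t :=
    poch_succ_left_of_eq (by push_cast; ring) (by push_cast; ring)
  have e3 : poch (1 - 2 * p₁ - 2 * p₂ - 2 * (j + t + 1 : ℕ)) (2 * j + 2) =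
      poch (1 - 2 * p₁ - 2 * p₂ - 2 * (j + t + 1 : ℕ)) (2 * j + 1) *
        (1 - 2 * p₁ - 2 * p₂ - 2 * (j + t + 1) + (2 * j + 1)) :=
    poch_succ_of_eq (by push_cast; ring)
  have e4 : poch (1 / 2 - c - (j + t + 1 : ℕ)) (j + 1) =
      poch (1 / 2 - c - (j + t + 1 : ℕ)) j * (1 / 2 - c - (j + t + 1) + j) :=
    poch_succ_of_eq (by push_cast; ring)
  have e5 : poch (1 - 2 * p₁ - 2 * p₂ - 2 * (j + t + 1 : ℕ)) (j + 1) =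
      poch (1 - 2 * p₁ - 2 * p₂ - 2 * (j + t + 1 : ℕ)) j *
        (1 - 2 * p₁ - 2 * p₂ - 2 * (j + t + 1) + j) :=
    poch_succ_of_eq (by push_cast; ring)
  have e6 : ((j + t + 1)! : K) = (j + t + 1) * (j + t)! := by
    rw [Nat.factorial_succ]
    push_cast
    ring
  have e7 : poch (3 / 2 + c - 2 * p₁ - (j + t + 1 : ℕ)) (j + 1) =
      poch (3 / 2 + c - 2 * p₁ - (j + t + 1 : ℕ)) j * (3 / 2 + c - 2 * p₁ - (j + t + 1) + j) :=
    poch_succ_of_eq (by push_cast; ring)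
  have hQ' := poch_ne_zero_of_le (Nat.le_succ _) hQ
  have hC' := poch_ne_zero_of_le (Nat.le_succ _) hC
  have hU := right_ne_zero_of_mul (e2 ▸ hV)
  rw [weight2OE, weight2EE, show j + t + 1 - 1 = j + t by omega,
    show j + t + 1 - j = t + 1 by omega, show j + t + 1 - (j + 1) = t by omega,
    show 2 * (j + 1) = 2 * j + 2 by ring, e6, div_mul_eq_mul_div, div_mul_eq_mul_div,
    div_eq_div_iff
      (mul_ne_zero (mul_ne_zero (mul_ne_zero (mul_ne_zero (mul_ne_zero hm hf) hC) hQ) hT) hU)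
      (mul_ne_zero (mul_ne_zero (mul_ne_zero (mul_ne_zero hf hC') hQ') hT) hV),
    e2, e3, e4, e5, e7, pow_succ]
  linear_combination (-((-1) ^ j * (poch (3 / 2 + c - 2 * p₁ - (j + t + 1 : ℕ)) j *
      (3 / 2 + c - 2 * p₁ - (j + t + 1) + j)) *
    (poch (1 - 2 * p₁ - 2 * p₂ - 2 * (j + t + 1 : ℕ)) j *
        (1 - 2 * p₁ - 2 * p₂ - 2 * (j + t + 1) + j)) *
    poch (1 / 2 + 2 * p₃) (j + 1) * (j + t)! *
    (poch (1 / 2 - c - (j + t + 1 : ℕ)) j * (1 / 2 - c - (j + t + 1) + j)) *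
    (poch (1 - 2 * p₁ - 2 * p₂ - 2 * (j + t + 1 : ℕ)) (2 * j + 1) *
        (1 - 2 * p₁ - 2 * p₂ - 2 * (j + t + 1) + (2 * j + 1))) *
    poch (1 / 2 - 2 * p₁ - 2 * p₂ - 2 * p₃ - 2 * (j + t + 1 : ℕ)) (j + 1) *
    ((2 - 2 * p₁ - 2 * (j + t + 1) + 2 * j) *
        poch (1 - 2 * p₁ - 2 * (j + t + 1 : ℕ) + 2 * (j + 1 : ℕ)) t))) * e1

theorem weight2OO_mul_eq {j t : ℕ} (hC : poch (-(1 / 2) - c - (j + t : ℕ)) (j + 1) ≠ 0)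
    (hQ : poch (-2 * p₁ - 2 * p₂ - 2 * (j + t : ℕ)) (2 * j + 1) ≠ 0)
    (hT : poch (-(1 / 2) - 2 * p₁ - 2 * p₂ - 2 * p₃ - 2 * (j + t : ℕ)) (j + 1) ≠ 0)
    (hU : poch (-2 * p₁ - 2 * (j + t : ℕ) + 2 * j) (t + 1) ≠ 0) :
    weight2OO p₁ p₂ p₃ c j (j + t) * ((-(1 / 2) - c - (j + t) + j) *
        (-2 * p₁ - 2 * p₂ - 2 * (j + t) + 2 * j) *
        (-(1 / 2) - 2 * p₁ - 2 * p₂ - 2 * p₃ - 2 * (j + t) + j)) =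
      weight2EO p₁ p₂ p₃ c j (j + t) * (-((1 / 2 + 2 * p₃ + j) *
        (-2 * p₁ - 2 * (j + t) + 2 * j)) * (1 / 2 + c - 2 * p₁ - (j + t) + j)) := by
  have hf : ((j + t)! : K) ≠ 0 := Nat.cast_ne_zero.mpr (Nat.factorial_ne_zero _)
  have e2 : poch (-2 * p₁ - 2 * (j + t : ℕ) + 2 * j) (t + 1) =
      (-2 * p₁ - 2 * (j + t) + 2 * j) * poch (1 - 2 * p₁ - 2 * (j + t : ℕ) + 2 * j) t :=
    poch_succ_left_of_eq (by ring) (by push_cast; ring)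
  have e3 : poch (-2 * p₁ - 2 * p₂ - 2 * (j + t : ℕ)) (2 * j + 1) =
      poch (-2 * p₁ - 2 * p₂ - 2 * (j + t : ℕ)) (2 * j) *
        (-2 * p₁ - 2 * p₂ - 2 * (j + t) + 2 * j) :=
    poch_succ_of_eq (by push_cast; ring)
  have e4 : poch (-(1 / 2) - c - (j + t : ℕ)) (j + 1) =
      poch (-(1 / 2) - c - (j + t : ℕ)) j * (-(1 / 2) - c - (j + t) + j) :=
    poch_succ_of_eq (by push_cast; ring)
  have e5 := poch_succ (1 / 2 + 2 * p₃) j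
  have e6 : poch (-(1 / 2) - 2 * p₁ - 2 * p₂ - 2 * p₃ - 2 * (j + t : ℕ)) (j + 1) =
      poch (-(1 / 2) - 2 * p₁ - 2 * p₂ - 2 * p₃ - 2 * (j + t : ℕ)) j *
        (-(1 / 2) - 2 * p₁ - 2 * p₂ - 2 * p₃ - 2 * (j + t) + j) :=
    poch_succ_of_eq (by push_cast; ring)
  have e7 : poch (1 / 2 + c - 2 * p₁ - (j + t : ℕ)) (j + 1) =
      poch (1 / 2 + c - 2 * p₁ - (j + t : ℕ)) j * (1 / 2 + c - 2 * p₁ - (j + t) + j) :=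
    poch_succ_of_eq (by push_cast; ring)
  have hQ' := poch_ne_zero_of_le (Nat.le_succ _) hQ
  have hC' := poch_ne_zero_of_le (Nat.le_succ _) hC
  have hT' := poch_ne_zero_of_le (Nat.le_succ _) hT
  have hV := right_ne_zero_of_mul (e2 ▸ hU)
  rw [weight2OO, weight2EO, show j + t - j = t by omega, show j + t + 1 - j = t + 1 by omega,
    div_mul_eq_mul_div, div_mul_eq_mul_div,
    div_eq_div_iff
      (mul_ne_zero (mul_ne_zero (mul_ne_zero (mul_ne_zero hf hC) hQ) hT) hV)
      (mul_ne_zero (mul_ne_zero (mul_ne_zero (mul_ne_zero hf hC') hQ') hT') hU),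
    e2, e3, e4, e5, e6, e7]
  ring

theorem weight2EO_succ_mul_eq {j t : ℕ} (hC : poch (-(1 / 2) - c - (j + t + 1 : ℕ)) (j + 1) ≠ 0)
    (hQ : poch (-2 * p₁ - 2 * p₂ - 2 * (j + t + 1 : ℕ)) (2 * j + 2) ≠ 0)
    (hT : poch (-(1 / 2) - 2 * p₁ - 2 * p₂ - 2 * p₃ - 2 * (j + t + 1 : ℕ)) (j + 1) ≠ 0)
    (hU : poch (1 - 2 * p₁ - 2 * (j + t + 1 : ℕ) + 2 * j) (t + 1) ≠ 0)
    (hV : poch (-2 * p₁ - 2 * (j + t + 1 : ℕ) + 2 * (j + 1 : ℕ)) (t + 1) ≠ 0) :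
    weight2EO p₁ p₂ p₃ c (j + 1) (j + t + 1) * ((j + 1) *
        (-2 * p₁ - 2 * p₂ - 2 * (j + t + 1) + (2 * j + 1)) *
        (1 - 2 * p₁ - 2 * (j + t + 1) + 2 * j + (t + 1))) =
      weight2OO p₁ p₂ p₃ c j (j + t + 1) * ((t + 1) *
        (-2 * p₁ - 2 * p₂ - 2 * (j + t + 1) + j) * (1 - 2 * p₁ - 2 * (j + t + 1) + 2 * j)) := by
  have hf : ((j + t + 1)! : K) ≠ 0 := Nat.cast_ne_zero.mpr (Nat.factorial_ne_zero _)
  have e1 := choose_succ_mul_eq' (K := K) j t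
  have e2 : (1 - 2 * p₁ - 2 * (j + t + 1) + 2 * j) *
      poch (-2 * p₁ - 2 * (j + t + 1 : ℕ) + 2 * (j + 1 : ℕ)) (t + 1) =
      poch (1 - 2 * p₁ - 2 * (j + t + 1 : ℕ) + 2 * j) (t + 1) *
        (1 - 2 * p₁ - 2 * (j + t + 1) + 2 * j + (t + 1)) :=
    poch_shift_of_eq (by push_cast; ring) (by push_cast; ring) (by push_cast; ring)
  have e3 : poch (-2 * p₁ - 2 * p₂ - 2 * (j + t + 1 : ℕ)) (2 * j + 2) =
      poch (-2 * p₁ - 2 * p₂ - 2 * (j + t + 1 : ℕ)) (2 * j + 1) *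
        (-2 * p₁ - 2 * p₂ - 2 * (j + t + 1) + (2 * j + 1)) :=
    poch_succ_of_eq (by push_cast; ring)
  have e5 : poch (-2 * p₁ - 2 * p₂ - 2 * (j + t + 1 : ℕ)) (j + 1) =
      poch (-2 * p₁ - 2 * p₂ - 2 * (j + t + 1 : ℕ)) j *
        (-2 * p₁ - 2 * p₂ - 2 * (j + t + 1) + j) :=
    poch_succ_of_eq (by push_cast; ring)
  have hQ' := poch_ne_zero_of_le (Nat.le_succ _) hQ
  rw [weight2OO, weight2EO, show j + t + 1 - j = t + 1 by omega,
    show j + t + 1 + 1 - (j + 1) = t + 1 by omega,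
    show 2 * (j + 1) = 2 * j + 2 by ring, div_mul_eq_mul_div, div_mul_eq_mul_div,
    div_eq_div_iff
      (mul_ne_zero (mul_ne_zero (mul_ne_zero (mul_ne_zero hf hC) hQ) hT) hV)
      (mul_ne_zero (mul_ne_zero (mul_ne_zero (mul_ne_zero hf hC) hQ') hT) hU),
    e3, e5]
  linear_combination ((-1) ^ (j + 1) * poch (1 / 2 + c - 2 * p₁ - (j + t + 1 : ℕ)) (j + 1) *
    (poch (-2 * p₁ - 2 * p₂ - 2 * (j + t + 1 : ℕ)) j *
        (-2 * p₁ - 2 * p₂ - 2 * (j + t + 1) + j)) *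
    poch (1 / 2 + 2 * p₃) (j + 1) * (j + t + 1)! *
    poch (-(1 / 2) - c - (j + t + 1 : ℕ)) (j + 1) *
    (poch (-2 * p₁ - 2 * p₂ - 2 * (j + t + 1 : ℕ)) (2 * j + 1) *
        (-2 * p₁ - 2 * p₂ - 2 * (j + t + 1) + (2 * j + 1))) *
    poch (-(1 / 2) - 2 * p₁ - 2 * p₂ - 2 * p₃ - 2 * (j + t + 1 : ℕ)) (j + 1)) *
    mul_congr_eq e1 e2.symm

end SecondWeights

section Steps

variable {K : Type*} [Field K] {p₁ p₂ p₃ c : K}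

theorem ne_zero_of_eq {a b : K} (hb : b ≠ 0) (h : a = b) : a ≠ 0 := h ▸ hb

/-- If `w`, `n` and `v` are solutions of first-order recursions whose ratios satisfy
`(w' / w) * (n' / n) = v' / v`, then `w n = W₀ v` propagates one step. The factor `α` cancels
between the first two ratios and is allowed to vanish. -/
theorem mul_eq_of_ratios {w w' n n' v v' W₀ A B T S X Z α : K} (hA : A ≠ 0) (hB : B ≠ 0)
    (h2 : w' * (A * T) = w * (B * α * S)) (h3 : n' * (B * α * Z) = n * (A * X))
    (h1 : v' * (Z * T) = v * (X * S) ∧ Z * T ≠ 0) (h0 : w * n = W₀ * v) :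
    w' * n' = W₀ * v' := by
  refine mul_right_cancel₀ (mul_ne_zero (mul_ne_zero hA hB) h1.2) ?_
  linear_combination n' * B * Z * h2 + w * S * B * h3 + A * B * X * S * h0 - W₀ * A * B * h1.1

theorem IsAdmissible.poch_one {N m k : ℕ} (h : IsAdmissible p₁ p₂ p₃ c N) {a : K}
    (ha : a = 1 - 2 * p₁ - m) (hm : m ≤ N) (hk : k ≤ m) : poch a k ≠ 0 :=
  poch_ne_zero_of_reflect ha hk fun i hi => h.one_ne _ (by omega)

theorem IsAdmissible.poch_two {N k : ℕ} (h : IsAdmissible p₁ p₂ p₃ c N) {a : K}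
    (ha : a = 1 - (2 * p₁ + 2 * p₂) - N) (hk : k ≤ N) : poch a k ≠ 0 :=
  poch_ne_zero_of_reflect ha hk fun i hi => h.two_ne _ (by omega)

theorem IsAdmissible.poch_three {N k : ℕ} (h : IsAdmissible p₁ p₂ p₃ c N) {a : K}
    (ha : a = 1 - (2 * p₁ + 2 * p₂ + 2 * p₃ + 1 / 2) - N) (hk : k + N / 2 ≤ N) : poch a k ≠ 0 :=
  poch_ne_zero_of_reflect ha (by omega) fun i hi => h.three_ne _ (by omega) (by omega)

theorem IsAdmissible.poch_c_two {N i k : ℕ} (h : IsAdmissible p₁ p₂ p₃ c N) {a : K}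
    (ha : a = c + 2 * p₂ + 1 / 2 + i) (hk : i + k ≤ N) : poch a k ≠ 0 :=
  poch_ne_zero fun l hl h0 => h.c_two_ne (i + l) (by omega) (by
    push_cast
    linear_combination h0 - ha)

theorem IsAdmissible.poch_c_three {N i k : ℕ} (h : IsAdmissible p₁ p₂ p₃ c N) {a : K}
    (ha : a = c + 2 * p₂ + 2 * p₃ + 1 + i) (hk : i + k ≤ N) : poch a k ≠ 0 :=
  poch_ne_zero fun l hl h0 => h.c_three_ne (i + l) (by omega) (by
    push_cast
    linear_combination h0 - ha)

theorem IsAdmissible.odd_factor_ne_zero {N m : ℕ} (h : IsAdmissible p₁ p₂ p₃ c N)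
    (hm : 2 * m + 1 < N) :
    (2 * p₁ + m) * (2 * p₁ + 2 * p₂ + 2 * m + 1) ≠ 0 ∧ 2 * p₁ + 2 * m + 1 ≠ 0 :=
  ⟨mul_ne_zero (h.one_ne m (by omega))
    (ne_zero_of_eq (h.two_ne (2 * m + 1) hm) (by push_cast; ring)),
    ne_zero_of_eq (h.one_ne (2 * m + 1) hm) (by push_cast; ring)⟩

theorem IsAdmissible.even_factor_ne_zero {N m : ℕ} (h : IsAdmissible p₁ p₂ p₃ c N)
    (hm : 2 * m < N) :
    (c + 1 / 2 + m) * (2 * p₁ + 2 * p₂ + 2 * m) ≠ 0 ∧ 2 * p₁ + 2 * m ≠ 0 :=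
  ⟨mul_ne_zero (h.c_ne m (by omega))
    (ne_zero_of_eq (h.two_ne (2 * m) hm) (by push_cast; ring)),
    ne_zero_of_eq (h.one_ne (2 * m) hm) (by push_cast; ring)⟩

variable [CharZero K]

/-! The next eight lemmas give the ratios of consecutive values of the second weight and of the
norm of the first factor, as `S = N - s` drops by one. Their common factors depend only on
`m = S / 2` and the parity of `S`. -/

theorem IsAdmissible.weight2OE_ratio {j m : ℕ} (h : IsAdmissible p₁ p₂ p₃ c (2 * (j + m + 1))) :
    weight2OE p₁ p₂ p₃ c j (j + m + 1) * ((2 * p₁ + m) * (2 * p₁ + 2 * p₂ + 2 * m + 1) *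
        (1 / 2 - 2 * p₁ - 2 * p₂ - 2 * p₃ - 2 * (j + m + 1) + j)) =
      weight2EE p₁ p₂ p₃ c j (j + m + 1) *
        ((2 * p₁ + 2 * m + 1) * -(m + 1) * (1 / 2 + 2 * p₃ + j)) := by
  linear_combination weight2OE_mul_eq (p₁ := p₁) (p₂ := p₂) (p₃ := p₃) (c := c) (j := j)
    (t := m) ((h.isRegular le_rfl).poch_c_even (by omega))
    (h.poch_two (by push_cast; ring) (by omega)) (h.poch_three (by push_cast; ring) (by omega))
    (h.poch_one (m := 2 * m + 2) (by push_cast; ring) (by omega) (by omega))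
    (h.poch_one (m := 2 * m + 1) (by push_cast; ring) (by omega) (by omega))

theorem IsAdmissible.weight2EE_succ_ratio {j m : ℕ}
    (h : IsAdmissible p₁ p₂ p₃ c (2 * (j + m + 1))) :
    weight2EE p₁ p₂ p₃ c (j + 1) (j + m + 1) *
        ((c + 1 / 2 + m) * (2 * p₁ + 2 * p₂ + 2 * m) * (j + 1)) =
      weight2OE p₁ p₂ p₃ c j (j + m + 1) * ((2 * p₁ + 2 * m) * (c - 2 * p₁ + 1 / 2 - m) *
        (1 - 2 * p₁ - 2 * p₂ - 2 * (j + m + 1) + j)) := by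
  linear_combination weight2EE_succ_mul_eq (p₁ := p₁) (p₂ := p₂) (p₃ := p₃) (c := c)
    (j := j) (t := m) ((h.isRegular le_rfl).poch_c_even (by omega))
    (h.poch_two (by push_cast; ring) (by omega)) (h.poch_three (by push_cast; ring) (by omega))
    (h.poch_one (m := 2 * m + 1) (by push_cast; ring) (by omega) (by omega))

theorem IsAdmissible.weight2OO_ratio {j m : ℕ} (h : IsAdmissible p₁ p₂ p₃ c (2 * (j + m) + 1)) :
    weight2OO p₁ p₂ p₃ c j (j + m) * ((c + 1 / 2 + m) * (2 * p₁ + 2 * p₂ + 2 * m) *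
        (-(1 / 2) - 2 * p₁ - 2 * p₂ - 2 * p₃ - 2 * (j + m) + j)) =
      weight2EO p₁ p₂ p₃ c j (j + m) *
        ((2 * p₁ + 2 * m) * (c - 2 * p₁ + 1 / 2 - m) * (1 / 2 + 2 * p₃ + j)) := by
  linear_combination weight2OO_mul_eq (p₁ := p₁) (p₂ := p₂) (p₃ := p₃) (c := c)
    (j := j) (t := m) ((h.isRegular le_rfl).poch_c_odd (by omega))
    (h.poch_two (by push_cast; ring) (by omega)) (h.poch_three (by push_cast; ring) (by omega))
    (h.poch_one (m := 2 * m + 1) (by push_cast; ring) (by omega) (by omega))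

theorem IsAdmissible.weight2EO_succ_ratio {j m : ℕ}
    (h : IsAdmissible p₁ p₂ p₃ c (2 * (j + m + 1) + 1)) :
    weight2EO p₁ p₂ p₃ c (j + 1) (j + m + 1) *
        ((2 * p₁ + m) * (2 * p₁ + 2 * p₂ + 2 * m + 1) * (j + 1)) =
      weight2OO p₁ p₂ p₃ c j (j + m + 1) * ((2 * p₁ + 2 * m + 1) * -(m + 1) *
        (-2 * p₁ - 2 * p₂ - 2 * (j + m + 1) + j)) := by
  linear_combination weight2EO_succ_mul_eq (p₁ := p₁) (p₂ := p₂) (p₃ := p₃) (c := c)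
    (j := j) (t := m) ((h.isRegular le_rfl).poch_c_odd (by omega))
    (h.poch_two (by push_cast; ring) (by omega)) (h.poch_three (by push_cast; ring) (by omega))
    (h.poch_one (m := 2 * m + 2) (by push_cast; ring) (by omega) (by omega))
    (h.poch_one (m := 2 * m + 1) (by push_cast; ring) (by omega) (by omega))

theorem IsAdmissible.uniNormEO_ratio {N e t m : ℕ} (h : IsAdmissible p₁ p₂ p₃ c N)
    (hm : m = e + t) (hN : 2 * m + 2 ≤ N) :
    uniNormEO p₁ p₂ c e m *
        ((2 * p₁ + 2 * m + 1) * -(m + 1) * (2 * p₁ + 2 * p₂ + m + e)) =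
      uniNormEE p₁ p₂ c e (m + 1) *
        ((2 * p₁ + m) * (2 * p₁ + 2 * p₂ + 2 * m + 1) * -(t + 1)) := by
  subst hm
  push_cast
  linear_combination -uniNormEO_mul_eq (p₁ := p₁) (p₂ := p₂) (c := c) (e := e) (t := t)
    (h.isRegular hN) (h.isRegular (by omega)) (h.poch_c_two rfl (by omega))

theorem IsAdmissible.uniNormOO_ratio {N e t m : ℕ} (h : IsAdmissible p₁ p₂ p₃ c N)
    (hm : m = e + t) (hN : 2 * m + 2 ≤ N) :
    uniNormOO p₁ p₂ c e m *
        ((2 * p₁ + 2 * m + 1) * -(m + 1) * (c + 2 * p₂ + 1 / 2 + e + m + 1)) =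
      uniNormOE p₁ p₂ c e (m + 1) * ((2 * p₁ + m) * (2 * p₁ + 2 * p₂ + 2 * m + 1) *
        (c - 2 * p₁ + 1 / 2 - m + e)) := by
  subst hm
  push_cast
  linear_combination uniNormOO_mul_eq (p₁ := p₁) (p₂ := p₂) (c := c) (e := e) (t := t)
    (h.isRegular hN) (h.isRegular (by omega)) (h.poch_c_two rfl (by omega))

theorem IsAdmissible.uniNormEE_ratio {N e t m : ℕ} (h : IsAdmissible p₁ p₂ p₃ c N)
    (hm : m = e + t) (hN : 2 * m + 1 ≤ N) :
    uniNormEE p₁ p₂ c e m *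
        ((2 * p₁ + 2 * m) * (c - 2 * p₁ + 1 / 2 - m) * (c + 2 * p₂ + 1 / 2 + e + m)) =
      uniNormEO p₁ p₂ c e m *
        ((c + 1 / 2 + m) * (2 * p₁ + 2 * p₂ + 2 * m) * (c - 2 * p₁ + 1 / 2 - m + e)) := by
  subst hm
  push_cast
  linear_combination uniNormEE_mul_eq (p₁ := p₁) (p₂ := p₂) (c := c) (e := e) (t := t)
    (h.isRegular hN) (h.poch_c_two rfl (by omega))

theorem IsAdmissible.uniNormOE_ratio {N e t m : ℕ} (h : IsAdmissible p₁ p₂ p₃ c N)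
    (hm : m = e + 1 + t) (hN : 2 * m + 1 ≤ N) :
    uniNormOE p₁ p₂ c e m *
        ((2 * p₁ + 2 * m) * (c - 2 * p₁ + 1 / 2 - m) * (2 * p₁ + 2 * p₂ + m + e)) =
      uniNormOO p₁ p₂ c e m *
        ((c + 1 / 2 + m) * (2 * p₁ + 2 * p₂ + 2 * m) * (-m + e)) := by
  subst hm
  push_cast
  linear_combination uniNormOE_mul_eq (p₁ := p₁) (p₂ := p₂) (c := c) (e := e) (t := t)
    (h.isRegular hN) (h.isRegular (by omega)) (h.poch_c_two rfl (by omega))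

/-! The ratios of consecutive values of the univariate weight, in the form in which they are
compared with the products of the ratios above. -/

theorem IsRegular.weight1EE_ratio {r s : ℕ} (h : IsRegular p₁ p₂ c (2 * s)) (hr : r + 1 ≤ s)
    {Z T X S : K} (hZ : Z = -(1 / 2 - c - s + r)) (hT : T = r + 1)
    (hX : X = 3 / 2 + c - 2 * p₁ - s + r) (hS : S = 1 - 2 * p₁ - 2 * s + r) :
    weight1EE p₁ p₂ c (r + 1) s * (Z * T) = weight1OE p₁ p₂ c r s * (X * S) ∧ Z * T ≠ 0 := by
  subst hZ hT hX hS
  have hc := h.poch_c_even hr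
  exact ⟨by linear_combination -weight1EE_succ hc (h.poch_one hr (by omega)) (h.poch_two_even hr),
    mul_ne_zero (neg_ne_zero.mpr (poch_last_ne_zero hc)) (Nat.cast_add_one_ne_zero r)⟩

theorem IsRegular.weight1EO_ratio {r s : ℕ} (h : IsRegular p₁ p₂ c (2 * s + 1)) (hr : r + 1 ≤ s)
    {Z T X S : K} (hZ : Z = -(1 - 2 * p₁ - s + r)) (hT : T = r + 1) (hX : X = -s + r)
    (hS : S = -2 * p₁ - 2 * s + r) :
    weight1EO p₁ p₂ c (r + 1) s * (Z * T) = weight1OO p₁ p₂ c r s * (X * S) ∧ Z * T ≠ 0 := by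
  subst hZ hT hX hS
  have ho := h.poch_one hr (by omega)
  refine ⟨?_,
    mul_ne_zero (neg_ne_zero.mpr (poch_last_ne_zero ho)) (Nat.cast_add_one_ne_zero r)⟩
  linear_combination -weight1EO_succ (h.poch_c_odd (by omega)) ho (h.poch_two_odd (by omega))

theorem IsRegular.weight1OE_ratio {r s : ℕ} (h : IsRegular p₁ p₂ c (2 * s)) (hr : r + 1 ≤ s)
    {Z T X S : K} (hZ : Z = -(1 - 2 * p₁ - s + r)) (hT : T = 1 - 2 * p₁ - 2 * p₂ - 2 * s + r)
    (hX : X = -s + r) (hS : S = 2 * p₂ + r) :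
    weight1OE p₁ p₂ c r s * (Z * T) = weight1EE p₁ p₂ c r s * (X * S) ∧ Z * T ≠ 0 := by
  subst hZ hT hX hS
  have ho := h.poch_one hr (by omega)
  have ht := h.poch_two_even hr
  exact ⟨by linear_combination -weight1OE_eq (h.poch_c_even (by omega)) ho ht,
    mul_ne_zero (neg_ne_zero.mpr (poch_last_ne_zero ho)) (poch_last_ne_zero ht)⟩

theorem IsRegular.weight1OO_ratio {r s : ℕ} (h : IsRegular p₁ p₂ c (2 * s + 1)) (hr : r ≤ s)
    {Z T X S : K} (hZ : Z = -(-(1 / 2) - c - s + r)) (hT : T = -2 * p₁ - 2 * p₂ - 2 * s + r)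
    (hX : X = 1 / 2 + c - 2 * p₁ - s + r) (hS : S = 2 * p₂ + r) :
    weight1OO p₁ p₂ c r s * (Z * T) = weight1EO p₁ p₂ c r s * (X * S) ∧ Z * T ≠ 0 := by
  subst hZ hT hX hS
  have hc := h.poch_c_odd (n := r + 1) (by omega)
  have ht := h.poch_two_odd (n := r + 1) (by omega)
  exact ⟨by linear_combination -weight1OO_eq hc (h.poch_one hr (by omega)) ht,
    mul_ne_zero (neg_ne_zero.mpr (poch_last_ne_zero hc)) (poch_last_ne_zero ht)⟩

end Steps

section SecondWeightFormula

variable {K : Type*} [Field K] {p₁ p₂ p₃ c : K}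

theorem weight2_even_even (s N : ℕ) :
    weight2 p₁ p₂ p₃ c (2 * s) (2 * N) = weight2EE p₁ p₂ p₃ c s N := by
  simp [weight2]

theorem weight2_odd_even (s N : ℕ) :
    weight2 p₁ p₂ p₃ c (2 * s + 1) (2 * N) = weight2OE p₁ p₂ p₃ c s N := by
  simp [weight2, show (2 * s + 1) / 2 = s by omega, show (2 * s + 1) % 2 = 1 by omega]

theorem weight2_even_odd (s N : ℕ) :
    weight2 p₁ p₂ p₃ c (2 * s) (2 * N + 1) = weight2EO p₁ p₂ p₃ c s N := by
  simp [weight2, show (2 * N + 1) / 2 = N by omega, show (2 * N + 1) % 2 = 1 by omega]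

theorem weight2_odd_odd (s N : ℕ) :
    weight2 p₁ p₂ p₃ c (2 * s + 1) (2 * N + 1) = weight2OO p₁ p₂ p₃ c s N := by
  simp [weight2, show (2 * N + 1) / 2 = N by omega, show (2 * N + 1) % 2 = 1 by omega,
    show (2 * s + 1) / 2 = s by omega, show (2 * s + 1) % 2 = 1 by omega]

variable [CharZero K]

/-- The second weight times the squared norm of the first factor is, up to a constant, the
univariate weight for the parameters of the second factor. Both sides satisfy the same first-order
recursion in `s`, so the proof is an induction that matches ratios in each parity case. -/
theorem IsAdmissible.weight2_mul_uniNorm {N n : ℕ} (h : IsAdmissible p₁ p₂ p₃ c N) (s : ℕ)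
    (hs : s + n ≤ N) :
    weight2 p₁ p₂ p₃ c s N * uniNorm p₁ p₂ c n (N - s) =
      weight2 p₁ p₂ p₃ c 0 N * uniNorm p₁ p₂ c n N *
        weight1 (p₁ + p₂ + n / 2) (p₃ + 1 / 4) (c + n + 2 * p₂) s (N - n) := by
  induction s with
  | zero => rw [weight1_zero, Nat.sub_zero, mul_one]
  | succ s ih =>
    replace ih := ih (by omega)
    generalize weight2 p₁ p₂ p₃ c 0 N * uniNorm p₁ p₂ c n N = W₀ at *
    have hq := h.isRegular_second (n := n) (by omega) rfl rfl rfl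
    obtain ⟨M, rfl | rfl⟩ := Nat.even_or_odd' N <;> obtain ⟨j, rfl | rfl⟩ := Nat.even_or_odd' s <;>
      obtain ⟨e, rfl | rfl⟩ := Nat.even_or_odd' n
    · obtain ⟨t, rfl⟩ : ∃ t, M = j + (e + t) + 1 := ⟨M - (j + e + 1), by omega⟩
      rw [show 2 * (j + (e + t) + 1) - 2 * e = 2 * (j + t + 1) by omega] at hq
      rw [show 2 * (j + (e + t) + 1) - 2 * j = 2 * (e + t + 1) by omega,
        show 2 * (j + (e + t) + 1) - 2 * e = 2 * (j + t + 1) by omega, weight2_even_even,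
        uniNorm_even_even, weight1_even_even] at ih
      rw [show 2 * (j + (e + t) + 1) - (2 * j + 1) = 2 * (e + t) + 1 by omega,
        show 2 * (j + (e + t) + 1) - 2 * e = 2 * (j + t + 1) by omega, weight2_odd_even,
        uniNorm_even_odd, weight1_odd_even]
      obtain ⟨hA, hB⟩ := h.odd_factor_ne_zero (m := e + t) (by omega)
      exact mul_eq_of_ratios hA hB h.weight2OE_ratio (h.uniNormEO_ratio rfl (by omega))
        (hq.weight1OE_ratio (by omega) (by push_cast; ring) (by push_cast; ring)
          (by push_cast; ring) (by ring)) ih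
    · obtain ⟨t, rfl⟩ : ∃ t, M = j + (e + t) + 1 := ⟨M - (j + e + 1), by omega⟩
      rw [show 2 * (j + (e + t) + 1) - (2 * e + 1) = 2 * (j + t) + 1 by omega] at hq
      rw [show 2 * (j + (e + t) + 1) - 2 * j = 2 * (e + t + 1) by omega,
        show 2 * (j + (e + t) + 1) - (2 * e + 1) = 2 * (j + t) + 1 by omega, weight2_even_even,
        uniNorm_odd_even, weight1_even_odd] at ih
      rw [show 2 * (j + (e + t) + 1) - (2 * j + 1) = 2 * (e + t) + 1 by omega,
        show 2 * (j + (e + t) + 1) - (2 * e + 1) = 2 * (j + t) + 1 by omega, weight2_odd_even,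
        uniNorm_odd_odd, weight1_odd_odd]
      obtain ⟨hA, hB⟩ := h.odd_factor_ne_zero (m := e + t) (by omega)
      exact mul_eq_of_ratios hA hB h.weight2OE_ratio (h.uniNormOO_ratio rfl (by omega))
        (hq.weight1OO_ratio (by omega) (by push_cast; ring) (by push_cast; ring)
          (by push_cast; ring) (by ring)) ih
    · obtain ⟨t, rfl⟩ : ∃ t, M = j + (e + t) + 1 := ⟨M - (j + e + 1), by omega⟩
      rw [show 2 * (j + (e + t) + 1) - 2 * e = 2 * (j + t + 1) by omega] at hq
      rw [show 2 * (j + (e + t) + 1) - (2 * j + 1) = 2 * (e + t) + 1 by omega,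
        show 2 * (j + (e + t) + 1) - 2 * e = 2 * (j + t + 1) by omega, weight2_odd_even,
        uniNorm_even_odd, weight1_odd_even] at ih
      rw [show 2 * j + 1 + 1 = 2 * (j + 1) by ring,
        show 2 * (j + (e + t) + 1) - 2 * (j + 1) = 2 * (e + t) by omega,
        show 2 * (j + (e + t) + 1) - 2 * e = 2 * (j + t + 1) by omega, weight2_even_even,
        uniNorm_even_even, weight1_even_even]
      obtain ⟨hA, hB⟩ := h.even_factor_ne_zero (m := e + t) (by omega)
      exact mul_eq_of_ratios hA hB h.weight2EE_succ_ratio (h.uniNormEE_ratio rfl (by omega))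
        (hq.weight1EE_ratio (by omega) (by push_cast; ring) (by ring)
          (by push_cast; ring) (by push_cast; ring)) ih
    · obtain ⟨t, rfl⟩ : ∃ t, M = j + (e + 1 + t) + 1 := ⟨M - (j + e + 2), by omega⟩
      rw [show 2 * (j + (e + 1 + t) + 1) - (2 * e + 1) = 2 * (j + t + 1) + 1 by omega] at hq
      rw [show 2 * (j + (e + 1 + t) + 1) - (2 * j + 1) = 2 * (e + 1 + t) + 1 by omega,
        show 2 * (j + (e + 1 + t) + 1) - (2 * e + 1) = 2 * (j + t + 1) + 1 by omega,
        weight2_odd_even, uniNorm_odd_odd, weight1_odd_odd] at ih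
      rw [show 2 * j + 1 + 1 = 2 * (j + 1) by ring,
        show 2 * (j + (e + 1 + t) + 1) - 2 * (j + 1) = 2 * (e + 1 + t) by omega,
        show 2 * (j + (e + 1 + t) + 1) - (2 * e + 1) = 2 * (j + t + 1) + 1 by omega,
        weight2_even_even, uniNorm_odd_even, weight1_even_odd]
      obtain ⟨hA, hB⟩ := h.even_factor_ne_zero (m := e + 1 + t) (by omega)
      exact mul_eq_of_ratios hA hB h.weight2EE_succ_ratio (h.uniNormOE_ratio rfl (by omega))
        (hq.weight1EO_ratio (by omega) (by push_cast; ring) (by ring)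
          (by push_cast; ring) (by push_cast; ring)) ih
    · obtain ⟨t, rfl⟩ : ∃ t, M = j + (e + t) := ⟨M - (j + e), by omega⟩
      rw [show 2 * (j + (e + t)) + 1 - 2 * e = 2 * (j + t) + 1 by omega] at hq
      rw [show 2 * (j + (e + t)) + 1 - 2 * j = 2 * (e + t) + 1 by omega,
        show 2 * (j + (e + t)) + 1 - 2 * e = 2 * (j + t) + 1 by omega, weight2_even_odd,
        uniNorm_even_odd, weight1_even_odd] at ih
      rw [show 2 * (j + (e + t)) + 1 - (2 * j + 1) = 2 * (e + t) by omega,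
        show 2 * (j + (e + t)) + 1 - 2 * e = 2 * (j + t) + 1 by omega, weight2_odd_odd,
        uniNorm_even_even, weight1_odd_odd]
      obtain ⟨hA, hB⟩ := h.even_factor_ne_zero (m := e + t) (by omega)
      exact mul_eq_of_ratios hA hB h.weight2OO_ratio (h.uniNormEE_ratio rfl (by omega))
        (hq.weight1OO_ratio (by omega) (by push_cast; ring) (by push_cast; ring)
          (by push_cast; ring) (by ring)) ih
    · obtain ⟨t, rfl⟩ : ∃ t, M = j + (e + 1 + t) := ⟨M - (j + e + 1), by omega⟩
      rw [show 2 * (j + (e + 1 + t)) + 1 - (2 * e + 1) = 2 * (j + t + 1) by omega] at hq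
      rw [show 2 * (j + (e + 1 + t)) + 1 - 2 * j = 2 * (e + 1 + t) + 1 by omega,
        show 2 * (j + (e + 1 + t)) + 1 - (2 * e + 1) = 2 * (j + t + 1) by omega, weight2_even_odd,
        uniNorm_odd_odd, weight1_even_even] at ih
      rw [show 2 * (j + (e + 1 + t)) + 1 - (2 * j + 1) = 2 * (e + 1 + t) by omega,
        show 2 * (j + (e + 1 + t)) + 1 - (2 * e + 1) = 2 * (j + t + 1) by omega, weight2_odd_odd,
        uniNorm_odd_even, weight1_odd_even]
      obtain ⟨hA, hB⟩ := h.even_factor_ne_zero (m := e + 1 + t) (by omega)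
      exact mul_eq_of_ratios hA hB h.weight2OO_ratio (h.uniNormOE_ratio rfl (by omega))
        (hq.weight1OE_ratio (by omega) (by push_cast; ring) (by push_cast; ring)
          (by push_cast; ring) (by ring)) ih
    · obtain ⟨t, rfl⟩ : ∃ t, M = j + (e + t) + 1 := ⟨M - (j + e + 1), by omega⟩
      rw [show 2 * (j + (e + t) + 1) + 1 - 2 * e = 2 * (j + t + 1) + 1 by omega] at hq
      rw [show 2 * (j + (e + t) + 1) + 1 - (2 * j + 1) = 2 * (e + t + 1) by omega,
        show 2 * (j + (e + t) + 1) + 1 - 2 * e = 2 * (j + t + 1) + 1 by omega, weight2_odd_odd,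
        uniNorm_even_even, weight1_odd_odd] at ih
      rw [show 2 * j + 1 + 1 = 2 * (j + 1) by ring,
        show 2 * (j + (e + t) + 1) + 1 - 2 * (j + 1) = 2 * (e + t) + 1 by omega,
        show 2 * (j + (e + t) + 1) + 1 - 2 * e = 2 * (j + t + 1) + 1 by omega, weight2_even_odd,
        uniNorm_even_odd, weight1_even_odd]
      obtain ⟨hA, hB⟩ := h.odd_factor_ne_zero (m := e + t) (by omega)
      exact mul_eq_of_ratios hA hB h.weight2EO_succ_ratio (h.uniNormEO_ratio rfl (by omega))
        (hq.weight1EO_ratio (by omega) (by push_cast; ring) (by ring)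
          (by push_cast; ring) (by push_cast; ring)) ih
    · obtain ⟨t, rfl⟩ : ∃ t, M = j + (e + t) + 1 := ⟨M - (j + e + 1), by omega⟩
      rw [show 2 * (j + (e + t) + 1) + 1 - (2 * e + 1) = 2 * (j + t + 1) by omega] at hq
      rw [show 2 * (j + (e + t) + 1) + 1 - (2 * j + 1) = 2 * (e + t + 1) by omega,
        show 2 * (j + (e + t) + 1) + 1 - (2 * e + 1) = 2 * (j + t + 1) by omega, weight2_odd_odd,
        uniNorm_odd_even, weight1_odd_even] at ih
      rw [show 2 * j + 1 + 1 = 2 * (j + 1) by ring,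
        show 2 * (j + (e + t) + 1) + 1 - 2 * (j + 1) = 2 * (e + t) + 1 by omega,
        show 2 * (j + (e + t) + 1) + 1 - (2 * e + 1) = 2 * (j + t + 1) by omega, weight2_even_odd,
        uniNorm_odd_odd, weight1_even_even]
      obtain ⟨hA, hB⟩ := h.odd_factor_ne_zero (m := e + t) (by omega)
      exact mul_eq_of_ratios hA hB h.weight2EO_succ_ratio (h.uniNormOO_ratio rfl (by omega))
        (hq.weight1EE_ratio (by omega) (by push_cast; ring) (by ring)
          (by push_cast; ring) (by push_cast; ring)) ih

end SecondWeightFormula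

/-! ### Closed form of the bivariate norms -/

section BivariateNorms

variable {K : Type*} [Field K] {p₁ p₂ p₃ c : K}

theorem pochZ_natCast (a : K) (n : ℕ) : pochZ a (n : ℤ) = poch a n := rfl

/-- The symbol `pochZ a (t - 1)` in terms of `poch a t`. For `t = 0` it is the symbol of index `-1`,
which is `1 / (a - 1)`. -/
theorem pochZ_sub_one_mul {a y : K} {t : ℕ} (hy : y = a + t - 1)
    (ha : t = 0 → a - 1 ≠ 0) : pochZ a ((t : ℤ) - 1) * y = poch a t := by
  subst hy
  cases t with
  | zero =>
    have h : pochZ a (((0 : ℕ) : ℤ) - 1) = (a - 1)⁻¹ := by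
      change (∏ i ∈ Finset.range (0 + 1), (a - ((i : K) + 1)))⁻¹ = _
      simp
    rw [h]
    simpa [poch] using inv_mul_cancel₀ (ha rfl)
  | succ t =>
    rw [show ((t + 1 : ℕ) : ℤ) - 1 = (t : ℤ) by push_cast; ring, pochZ_natCast, poch_succ]
    push_cast
    ring

/-- Reversal of the order of the factors, with `b = 1 - a - n`. -/
theorem poch_reflect {a b : K} {n : ℕ} (h : a + b + n = 1) : poch a n = (-1) ^ n * poch b n := by
  rw [← prod_neg_poch, poch, ← Finset.prod_range_reflect]
  refine Finset.prod_congr rfl fun i hi => ?_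
  have hi := Finset.mem_range.mp hi
  obtain ⟨k, rfl⟩ : ∃ k, n = i + 1 + k := ⟨n - (i + 1), by omega⟩
  rw [show i + 1 + k - 1 - i = k by omega]
  push_cast at h
  linear_combination h

theorem poch_reflect_add {a b : K} {n k l m : ℕ} (h : a + b + n = 1) (hn : n = k + l)
    (hm : m = n) : poch a n = (-1) ^ k * (-1) ^ l * poch b m := by
  rw [poch_reflect h, hn, pow_add, hm, hn]

theorem poch_reflect_of_eq {a b : K} {n m : ℕ} (h : a + b + n = 1) (hm : m = n) :
    poch a n = (-1) ^ n * poch b m := by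
  rw [poch_reflect h, hm]

theorem poch_congr {a b : K} {m n : ℕ} (h : a = b) (h' : m = n) : poch a m = poch b n := by
  rw [h, h']

theorem poch_mul_of_eq {a b a' : K} {m k n : ℕ} (ha : a' = a) (hb : b = a + m) (hn : m + k = n) :
    poch a m * poch b k = poch a' n := by
  rw [ha, ← hn, poch_add, hb]

theorem poch_mul_succ_of_eq {a b a' y : K} {m k n : ℕ} (ha : a' = a) (hb : b = a + m)
    (hn : m + k = n + 1) (hy : y = a + n) : poch a m * poch b k = poch a' n * y := by
  rw [poch_mul_of_eq rfl hb hn, poch_succ, ha, hy]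

theorem poch_mul_eq_poch_mul {a b a' b' : K} {m k m' k' : ℕ} (ha : a' = a) (hb : b = a + m)
    (hb' : b' = a + m') (h : m + k = m' + k') :
    poch a m * poch b k = poch a' m' * poch b' k' := by
  rw [poch_mul_of_eq rfl hb h, ha, poch_mul_of_eq rfl hb' rfl]

/-! The univariate norms and the second weight at `s = 0`, with their signs and numerators set apart
as they are matched in `norm_mul_norm_eq`. -/

theorem uniNormEE_eq (e s : ℕ) : uniNormEE p₁ p₂ c e s = 1 *
    (poch (2 * p₁ + s) s * poch (-(s : K)) e * poch (2 * p₂) e * e ! *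
      poch (c - 2 * p₁ + 3 / 2 - s) e * poch (c + 2 * p₂ + 1 / 2 + 2 * e) (s - e)) /
    (poch (c + 2 * p₂ + 1 / 2 + e) e * poch (c + 1 / 2 + e) (s - e) *
      poch (2 * p₁ + 2 * p₂ + s + e) (s - e)) := by
  rw [uniNormEE, one_mul]

theorem uniNormOE_eq (e s : ℕ) : uniNormOE p₁ p₂ c e s = -1 *
    (poch (2 * p₁ + s) s * poch (-(s : K)) (e + 1) * poch (2 * p₂) (e + 1) * e ! *
      poch (c - 2 * p₁ + 3 / 2 - s) e * poch (c + 2 * p₂ + 1 / 2 + 2 * e + 1) (s - e)) /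
    (poch (c + 2 * p₂ + 1 / 2 + e) (e + 1) * poch (c + 1 / 2 + e + 1) (s - e - 1) *
      poch (2 * p₁ + 2 * p₂ + s + e) (s - e)) := by
  rw [uniNormOE, neg_one_mul]

theorem uniNormEO_eq (e s : ℕ) : uniNormEO p₁ p₂ c e s = 1 *
    (poch (2 * p₁ + s) (s + 1) * poch (-(s : K)) e * poch (2 * p₂) e * e ! *
      poch (c - 2 * p₁ + 1 / 2 - s) e * poch (c + 2 * p₂ + 1 / 2 + 2 * e) (s - e + 1)) /
    (poch (c + 2 * p₂ + 1 / 2 + e) e * poch (c + 1 / 2 + e) (s - e + 1) *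
      poch (2 * p₁ + 2 * p₂ + s + e) (s - e + 1)) := by
  rw [uniNormEO, one_mul]

theorem uniNormOO_eq (e s : ℕ) : uniNormOO p₁ p₂ c e s = -1 *
    (poch (2 * p₁ + s) (s + 1) * poch (-(s : K)) e * poch (2 * p₂) (e + 1) * e ! *
      poch (c - 2 * p₁ + 1 / 2 - s) (e + 1) * poch (c + 2 * p₂ + 1 / 2 + 2 * e + 1) (s - e)) /
    (poch (c + 2 * p₂ + 1 / 2 + e) (e + 1) * poch (c + 1 / 2 + e + 1) (s - e) *
      poch (2 * p₁ + 2 * p₂ + s + e + 1) (s - e)) := by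
  rw [uniNormOO, neg_one_mul]

theorem weight2EE_zero (M : ℕ) : weight2EE p₁ p₂ p₃ c 0 M =
    1 / ((M ! : K) * poch (1 - 2 * p₁ - 2 * M) M) := by
  simp [weight2EE, poch_zero]

theorem weight2EO_zero (M : ℕ) : weight2EO p₁ p₂ p₃ c 0 M =
    1 / ((M ! : K) * poch (-2 * p₁ - 2 * M) (M + 1)) := by
  simp [weight2EO, poch_zero]

/-- The cancellations in the product of the norm of the first factor and the norm of the second
factor; they are the same for all parities. The variables stand for the Pochhammer symbols and
factorials in the closed forms. -/
theorem norm_mul_norm_eq {w u u' H F U X Y₁ P e a₀ G₂ Ge C Z Z' Y₂ R f a₁ D₂₂ Df G₃ Bt R' GM a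
    D₁ D₂ tf C' Ge' G₃' Df' T ε τ σ₁ σ₂ y : K}
    (hw : w = 1 / (F * U)) (hu : u = σ₁ * (X * Y₁ * P * e * a₀ * G₂) / (Ge * C * Z))
    (hu' : u' = σ₂ * (Z' * Y₂ * R * f * a₁ * D₂₂) / (Df * G₃ * Bt))
    (hH : H = (e * f * P * R' * GM * a * D₁ * D₂) /
      (tf * C' * Ge' ^ 2 * G₃' * Df' ^ 2 * T))
    (hZ : Z' = Z) (hR : R' = R) (hC : C' = C) (hGe : Ge' = Ge) (hDf : Df' = Df)
    (hU : U = ε * τ * X) (hT : T = τ * Bt) (hY : σ₁ * σ₂ * (Y₁ * Y₂ * tf) = ε * F)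
    (ha : a₀ * a₁ = a) (hA : Ge * G₂ = GM * y) (hB : G₃' * y = G₃) (hD : Df * D₂₂ = D₂ * D₁)
    (hF₀ : F ≠ 0) (hU₀ : U ≠ 0) (hGe₀ : Ge ≠ 0) (hC₀ : C ≠ 0) (hZ₀ : Z ≠ 0) (hDf₀ : Df ≠ 0)
    (hG₃₀ : G₃ ≠ 0) (hBt₀ : Bt ≠ 0) (htf₀ : tf ≠ 0) : w * u * u' = H := by
  have hG₃' : G₃' ≠ 0 := left_ne_zero_of_mul (hB ▸ hG₃₀)
  have hτ : τ ≠ 0 := right_ne_zero_of_mul (left_ne_zero_of_mul (hU ▸ hU₀))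
  have hT₀ : T ≠ 0 := hT ▸ mul_ne_zero hτ hBt₀
  subst hZ hR hC hGe hDf
  rw [hw, hu, hu', hH, div_mul_div_comm, div_mul_div_comm, div_eq_div_iff
    (mul_ne_zero (mul_ne_zero (mul_ne_zero hF₀ hU₀) (mul_ne_zero (mul_ne_zero hGe₀ hC₀) hZ₀))
      (mul_ne_zero (mul_ne_zero hDf₀ hG₃₀) hBt₀))
    (mul_ne_zero (mul_ne_zero (mul_ne_zero (mul_ne_zero (mul_ne_zero htf₀ hC₀) (pow_ne_zero 2 hGe₀))
      hG₃') (pow_ne_zero 2 hDf₀)) hT₀), hU, hT, ← ha, ← hB]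
  linear_combination (X * P * e * f * R' * a₀ * a₁ * Z' * C' * Ge' * τ * Bt * Df' * G₃') *
    mul_congr_eq (mul_congr_eq hY hA) hD

variable [CharZero K]

/-- The two truncating factors in a product of norms combine to a quotient of factorials. -/
theorem poch_neg_mul (k l t : ℕ) :
    poch (-((k + l + t : ℕ) : K)) k * poch (-((l + t : ℕ) : K)) l * t ! =
      (-1) ^ (k + l) * (k + l + t)! := by
  have h1 : poch (-((k + l + t : ℕ) : K)) (k + l + t) = poch (-((k + l + t : ℕ) : K)) k *
      poch (-((l + t : ℕ) : K)) l * poch (-(t : K)) t := by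
    rw [add_assoc k l t, poch_add, poch_add, ← mul_assoc]
    congr 2 <;> congr 1 <;> push_cast <;> ring
  rw [poch_neg_nat_self, poch_neg_nat_self, pow_add] at h1
  have hsq : ((-1 : K) ^ t) * (-1) ^ t = 1 := by rw [← mul_pow]; simp
  linear_combination (-(-1) ^ t) * h1 +
    ((-1) ^ (k + l) * (k + l + t)! - poch (-((k + l + t : ℕ) : K)) k *
      poch (-((l + t : ℕ) : K)) l * t !) * hsq

theorem IsAdmissible.poch_three_up {N i k : ℕ} (h : IsAdmissible p₁ p₂ p₃ c N) {a : K}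
    (ha : a = 2 * p₁ + 2 * p₂ + 2 * p₃ + 1 / 2 + i) (hi : N / 2 ≤ i) (hk : i + k ≤ N) :
    poch a k ≠ 0 :=
  poch_ne_zero fun j hj h0 => h.three_ne (i + j) (by omega) (by omega) (by
    push_cast
    linear_combination h0 - ha)

theorem factorial_cast_ne_zero (n : ℕ) : (n ! : K) ≠ 0 :=
  Nat.cast_ne_zero.mpr (Nat.factorial_ne_zero n)

/-! The closed form of the product of the two norms in the eight parity cases of the two degrees and
of `N`. In each of them the factors are matched with the variables of `norm_mul_norm_eq`. The size
`N` is written in terms of the degrees and the number `t` of steps that remain. -/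

theorem IsAdmissible.normEEE_eq {e f t : ℕ}
    (h : IsAdmissible p₁ p₂ p₃ c (2 * (e + f + t))) {q₁ q₂ d : K}
    (hq₁ : q₁ = p₁ + p₂ + e) (hq₂ : q₂ = p₃ + 1 / 4)
    (hd : d = c + 2 * e + 2 * p₂) :
    weight2EE p₁ p₂ p₃ c 0 (e + f + t) * uniNormEE p₁ p₂ c e (e + f + t) *
        uniNormEE q₁ q₂ d f (f + t) =
      normEEE p₁ p₂ p₃ c e f (e + f + t) := by
  have hH := normEEE.eq_1 p₁ p₂ p₃ c e f (e + f + t)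
  rw [show (e + f + t) - e - f = t by omega,
    show ((e + f + t : ℕ) : ℤ) - e - f = ((t : ℕ) : ℤ) by push_cast; ring,
    show ((e + f + t : ℕ) : ℤ) - e = ((f + t : ℕ) : ℤ) by push_cast; ring,
    show (e : ℤ) + (f : ℤ) = ((e + f : ℕ) : ℤ) by push_cast; ring] at hH
  simp only [pochZ_natCast] at hH
  have hy := poch_neg_mul (K := K) e f t
  exact norm_mul_norm_eq (weight2EE_zero _) (uniNormEE_eq _ _) (uniNormEE_eq _ _) hH
    (poch_congr (by subst hq₁; push_cast; ring) (by omega))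
    (poch_congr (by subst hq₂; ring) rfl) (poch_congr (by ring) (by omega))
    (poch_congr (by ring) rfl) (poch_congr (by subst hd hq₂; ring) rfl)
    (poch_reflect_add (k := e + f) (l := t) (by push_cast; ring) (by omega) rfl)
    (poch_reflect_of_eq (by subst hq₁ hq₂; push_cast; ring) (by omega))
    (by linear_combination hy)
    (poch_mul_of_eq (by push_cast; ring) (by subst hq₁ hd; push_cast; ring) (by omega))
    ((poch_mul_of_eq (by ring) (by ring) (by omega)).trans (mul_one _).symm)
    ((mul_one _).trans (poch_congr (by subst hd; ring) (by omega)))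
    (poch_mul_eq_poch_mul (by subst hd hq₂; ring) (by ring)
      (by subst hd hq₂; push_cast; ring) (by omega))
    (factorial_cast_ne_zero _)
    (h.poch_one (m := 2 * (e + f + t)) (by push_cast; ring) (by omega) (by omega))
    (h.poch_c_two (i := e) (by ring) (by omega))
    ((h.isRegular le_rfl).poch_c (i := e) (by omega) (by ring))
    ((h.isRegular le_rfl).poch_two (i := e + f + t + e) (by omega) (by omega)
      (by push_cast; ring))
    (h.poch_c_three (i := 2 * e + 0 + f) (by subst hd hq₂; push_cast; ring) (by omega))
    (h.poch_c_two (i := 2 * e + 0 + f) (by subst hd; push_cast; ring) (by omega))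
    (h.poch_three_up (i := 2 * e + 0 + (f + t) + f) (by subst hq₁ hq₂; push_cast; ring)
      (by omega) (by omega))
    (factorial_cast_ne_zero _)

theorem IsAdmissible.normOEE_eq {e f t : ℕ}
    (h : IsAdmissible p₁ p₂ p₃ c (2 * (e + 1 + f + t))) {q₁ q₂ d : K}
    (hq₁ : q₁ = p₁ + p₂ + e + 1 / 2) (hq₂ : q₂ = p₃ + 1 / 4)
    (hd : d = c + 2 * e + 2 * p₂ + 1) :
    weight2EE p₁ p₂ p₃ c 0 (e + 1 + f + t) * uniNormOE p₁ p₂ c e (e + 1 + f + t) *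
        uniNormEO q₁ q₂ d f (f + t) =
      normOEE p₁ p₂ p₃ c e f (e + 1 + f + t) := by
  have hH := normOEE.eq_1 p₁ p₂ p₃ c e f (e + 1 + f + t)
  rw [show (e + 1 + f + t) - e - f - 1 = t by omega,
    show ((e + 1 + f + t : ℕ) : ℤ) - e - f - 1 = ((t : ℕ) : ℤ) by push_cast; ring,
    show ((e + 1 + f + t : ℕ) : ℤ) - e - f = ((t + 1 : ℕ) : ℤ) by push_cast; ring,
    show ((e + 1 + f + t : ℕ) : ℤ) - e - 1 = ((f + t : ℕ) : ℤ) by push_cast; ring,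
    show (e : ℤ) + (f : ℤ) = ((e + f : ℕ) : ℤ) by push_cast; ring,
    show (e : ℤ) + 1 = ((e + 1 : ℕ) : ℤ) by push_cast; ring] at hH
  simp only [pochZ_natCast] at hH
  have hy := poch_neg_mul (K := K) (e + 1) f t
  exact norm_mul_norm_eq (weight2EE_zero _) (uniNormOE_eq _ _) (uniNormEO_eq _ _) hH
    (poch_congr (by subst hq₁; push_cast; ring) (by omega))
    (poch_congr (by subst hq₂; ring) rfl) (poch_congr (by ring) (by omega))
    (poch_congr (by ring) rfl) (poch_congr (by subst hd hq₂; ring) rfl)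
    (poch_reflect_add (k := e + f) (l := t + 1) (by push_cast; ring) (by omega) rfl)
    (poch_reflect_of_eq (by subst hq₁ hq₂; push_cast; ring) (by omega))
    (by linear_combination -hy)
    (poch_mul_of_eq (by push_cast; ring) (by subst hq₁ hd; push_cast; ring) (by omega))
    (poch_mul_succ_of_eq (y := c + 2 * p₂ + 1 / 2 + e + (e + 1 + f + t : ℕ)) (by ring)
      (by push_cast; ring) (by omega) (by push_cast; ring))
    ((poch_succ_of_eq (by push_cast; ring)).symm.trans (poch_congr (by subst hd; ring) (by omega)))
    (poch_mul_eq_poch_mul (by subst hd hq₂; ring) (by ring)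
      (by subst hd hq₂; push_cast; ring) (by omega))
    (factorial_cast_ne_zero _)
    (h.poch_one (m := 2 * (e + 1 + f + t)) (by push_cast; ring) (by omega) (by omega))
    (h.poch_c_two (i := e) (by ring) (by omega))
    ((h.isRegular le_rfl).poch_c (i := e + 1) (by omega) (by push_cast; ring))
    ((h.isRegular le_rfl).poch_two (i := e + 1 + f + t + e) (by omega) (by omega)
      (by push_cast; ring))
    (h.poch_c_three (i := 2 * e + 1 + f) (by subst hd hq₂; push_cast; ring) (by omega))
    (h.poch_c_two (i := 2 * e + 1 + f) (by subst hd; push_cast; ring) (by omega))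
    (h.poch_three_up (i := 2 * e + 1 + (f + t) + f) (by subst hq₁ hq₂; push_cast; ring)
      (by omega) (by omega))
    (factorial_cast_ne_zero _)

theorem IsAdmissible.normEOE_eq {e f t : ℕ}
    (h : IsAdmissible p₁ p₂ p₃ c (2 * (e + (f + 1) + t))) {q₁ q₂ d : K}
    (hq₁ : q₁ = p₁ + p₂ + e) (hq₂ : q₂ = p₃ + 1 / 4)
    (hd : d = c + 2 * e + 2 * p₂) :
    weight2EE p₁ p₂ p₃ c 0 (e + (f + 1) + t) * uniNormEE p₁ p₂ c e (e + (f + 1) + t) *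
        uniNormOE q₁ q₂ d f (f + 1 + t) =
      normEOE p₁ p₂ p₃ c e f (e + (f + 1) + t) := by
  have hH := normEOE.eq_1 p₁ p₂ p₃ c e f (e + (f + 1) + t)
  rw [show (e + (f + 1) + t) - e - f - 1 = t by omega,
    show ((e + (f + 1) + t : ℕ) : ℤ) - e - f - 1 = ((t : ℕ) : ℤ) by push_cast; ring,
    show ((e + (f + 1) + t : ℕ) : ℤ) - e - f = ((t + 1 : ℕ) : ℤ) by push_cast; ring,
    show ((e + (f + 1) + t : ℕ) : ℤ) - e = ((f + 1 + t : ℕ) : ℤ) by push_cast; ring,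
    show (e : ℤ) + (f : ℤ) = ((e + f : ℕ) : ℤ) by push_cast; ring,
    show (f : ℤ) + 1 = ((f + 1 : ℕ) : ℤ) by push_cast; ring] at hH
  simp only [pochZ_natCast] at hH
  have hy := poch_neg_mul (K := K) e (f + 1) t
  exact norm_mul_norm_eq (weight2EE_zero _) (uniNormEE_eq _ _) (uniNormOE_eq _ _) hH
    (poch_congr (by subst hq₁; push_cast; ring) (by omega))
    (poch_congr (by subst hq₂; ring) rfl) (poch_congr (by ring) (by omega))
    (poch_congr (by ring) rfl) (poch_congr (by subst hd hq₂; ring) rfl)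
    (poch_reflect_add (k := e + f) (l := t + 1) (by push_cast; ring) (by omega) rfl)
    (poch_reflect_of_eq (by subst hq₁ hq₂; push_cast; ring) (by omega))
    (by linear_combination -hy)
    (poch_mul_of_eq (by push_cast; ring) (by subst hq₁ hd; push_cast; ring) (by omega))
    ((poch_mul_of_eq (by ring) (by ring) (by omega)).trans (mul_one _).symm)
    ((mul_one _).trans (poch_congr (by subst hd; ring) (by omega)))
    (poch_mul_eq_poch_mul (by subst hd hq₂; ring) (by push_cast; ring)
      (by subst hd hq₂; push_cast; ring) (by omega))
    (factorial_cast_ne_zero _)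
    (h.poch_one (m := 2 * (e + (f + 1) + t)) (by push_cast; ring) (by omega) (by omega))
    (h.poch_c_two (i := e) (by ring) (by omega))
    ((h.isRegular le_rfl).poch_c (i := e) (by omega) (by ring))
    ((h.isRegular le_rfl).poch_two (i := e + (f + 1) + t + e) (by omega) (by omega)
      (by push_cast; ring))
    (h.poch_c_three (i := 2 * e + 0 + f) (by subst hd hq₂; push_cast; ring) (by omega))
    (h.poch_c_two (i := 2 * e + 0 + f + 1) (by subst hd; push_cast; ring) (by omega))
    (h.poch_three_up (i := 2 * e + 0 + (f + 1 + t) + f) (by subst hq₁ hq₂; push_cast; ring)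
      (by omega) (by omega))
    (factorial_cast_ne_zero _)

theorem IsAdmissible.normOOE_eq {e f t : ℕ}
    (h : IsAdmissible p₁ p₂ p₃ c (2 * (e + 1 + f + t))) {q₁ q₂ d : K}
    (hq₁ : q₁ = p₁ + p₂ + e + 1 / 2) (hq₂ : q₂ = p₃ + 1 / 4)
    (hd : d = c + 2 * e + 2 * p₂ + 1) :
    weight2EE p₁ p₂ p₃ c 0 (e + 1 + f + t) * uniNormOE p₁ p₂ c e (e + 1 + f + t) *
        uniNormOO q₁ q₂ d f (f + t) =
      normOOE p₁ p₂ p₃ c e f (e + 1 + f + t) := by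
  have hH := normOOE.eq_1 p₁ p₂ p₃ c e f (e + 1 + f + t)
  rw [show (e + 1 + f + t) - e - f - 1 = t by omega,
    show ((e + 1 + f + t : ℕ) : ℤ) - e - f - 2 = (t : ℤ) - 1 by push_cast; ring,
    show ((e + 1 + f + t : ℕ) : ℤ) - e - f - 1 = ((t : ℕ) : ℤ) by push_cast; ring,
    show ((e + 1 + f + t : ℕ) : ℤ) - e - f = ((t + 1 : ℕ) : ℤ) by push_cast; ring,
    show ((e + 1 + f + t : ℕ) : ℤ) - e - 1 = ((f + t : ℕ) : ℤ) by push_cast; ring,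
    show (e : ℤ) + (f : ℤ) + 1 = ((e + f + 1 : ℕ) : ℤ) by push_cast; ring,
    show (e : ℤ) + 1 = ((e + 1 : ℕ) : ℤ) by push_cast; ring,
    show (f : ℤ) + 1 = ((f + 1 : ℕ) : ℤ) by push_cast; ring] at hH
  simp only [pochZ_natCast] at hH
  have hy := poch_neg_mul (K := K) (e + 1) f t
  exact norm_mul_norm_eq (weight2EE_zero _) (uniNormOE_eq _ _) (uniNormOO_eq _ _) hH
    (poch_congr (by subst hq₁; push_cast; ring) (by omega))
    (poch_congr (by subst hq₂; ring) rfl) (poch_congr (by ring) (by omega))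
    (poch_congr (by ring) rfl) (poch_congr (by subst hd hq₂; ring) rfl)
    (poch_reflect_add (k := e + f + 1) (l := t) (by push_cast; ring) (by omega) rfl)
    (poch_reflect_of_eq (by subst hq₁ hq₂; push_cast; ring) (by omega))
    (by linear_combination hy)
    (poch_mul_of_eq (by push_cast; ring) (by subst hq₁ hd; push_cast; ring) (by omega))
    (poch_mul_succ_of_eq (y := c + 2 * p₂ + 1 / 2 + e + (e + 1 + f + t : ℕ)) (by ring)
      (by push_cast; ring) (by omega) (by push_cast; ring))
    ((pochZ_sub_one_mul (a := c + 2 * e + f + 2 * p₂ + 5 / 2) (t := t)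
      (by push_cast; ring) fun ht h0 =>
      h.c_two_ne (2 * e + f + 1) (by omega) (by
        subst ht
        push_cast at h0 ⊢
        linear_combination h0)).trans
      (poch_congr (by subst hd; ring) (by omega)))
    (poch_mul_eq_poch_mul (by subst hd hq₂; ring) (by push_cast; ring)
      (by subst hd hq₂; push_cast; ring) (by omega))
    (factorial_cast_ne_zero _)
    (h.poch_one (m := 2 * (e + 1 + f + t)) (by push_cast; ring) (by omega) (by omega))
    (h.poch_c_two (i := e) (by ring) (by omega))
    ((h.isRegular le_rfl).poch_c (i := e + 1) (by omega) (by push_cast; ring))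
    ((h.isRegular le_rfl).poch_two (i := e + 1 + f + t + e) (by omega) (by omega)
      (by push_cast; ring))
    (h.poch_c_three (i := 2 * e + 1 + f) (by subst hd hq₂; push_cast; ring) (by omega))
    (h.poch_c_two (i := 2 * e + 1 + f + 1) (by subst hd; push_cast; ring) (by omega))
    (h.poch_three_up (i := 2 * e + 1 + (f + t) + f + 1) (by subst hq₁ hq₂; push_cast; ring)
      (by omega) (by omega))
    (factorial_cast_ne_zero _)

theorem IsAdmissible.normEEO_eq {e f t : ℕ}
    (h : IsAdmissible p₁ p₂ p₃ c (2 * (e + f + t) + 1)) {q₁ q₂ d : K}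
    (hq₁ : q₁ = p₁ + p₂ + e) (hq₂ : q₂ = p₃ + 1 / 4)
    (hd : d = c + 2 * e + 2 * p₂) :
    weight2EO p₁ p₂ p₃ c 0 (e + f + t) * uniNormEO p₁ p₂ c e (e + f + t) *
        uniNormEO q₁ q₂ d f (f + t) =
      normEEO p₁ p₂ p₃ c e f (e + f + t) := by
  have hH := normEEO.eq_1 p₁ p₂ p₃ c e f (e + f + t)
  rw [show (e + f + t) - e - f = t by omega,
    show ((e + f + t : ℕ) : ℤ) - e - f + 1 = ((t + 1 : ℕ) : ℤ) by push_cast; ring,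
    show ((e + f + t : ℕ) : ℤ) - e - f = ((t : ℕ) : ℤ) by push_cast; ring,
    show ((e + f + t : ℕ) : ℤ) - e + 1 = ((f + t + 1 : ℕ) : ℤ) by push_cast; ring,
    show (e : ℤ) + (f : ℤ) = ((e + f : ℕ) : ℤ) by push_cast; ring] at hH
  simp only [pochZ_natCast] at hH
  have hy := poch_neg_mul (K := K) e f t
  exact norm_mul_norm_eq (weight2EO_zero _) (uniNormEO_eq _ _) (uniNormEO_eq _ _) hH
    (poch_congr (by subst hq₁; push_cast; ring) (by omega))
    (poch_congr (by subst hq₂; ring) rfl) (poch_congr (by ring) (by omega))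
    (poch_congr (by ring) rfl) (poch_congr (by subst hd hq₂; ring) rfl)
    (poch_reflect_add (k := e + f) (l := t + 1) (by push_cast; ring) (by omega) rfl)
    (poch_reflect_of_eq (by subst hq₁ hq₂; push_cast; ring) (by omega))
    (by linear_combination hy)
    (poch_mul_of_eq (by push_cast; ring) (by subst hq₁ hd; push_cast; ring) (by omega))
    (poch_mul_succ_of_eq (y := c + 2 * p₂ + 1 / 2 + e + (e + f + t : ℕ)) (by ring)
      (by ring) (by omega) (by push_cast; ring))
    ((poch_succ_of_eq (by push_cast; ring)).symm.trans (poch_congr (by subst hd; ring) (by omega)))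
    (poch_mul_eq_poch_mul (by subst hd hq₂; ring) (by ring)
      (by subst hd hq₂; push_cast; ring) (by omega))
    (factorial_cast_ne_zero _)
    (h.poch_one (m := 2 * (e + f + t) + 1) (by push_cast; ring) (by omega) (by omega))
    (h.poch_c_two (i := e) (by ring) (by omega))
    ((h.isRegular le_rfl).poch_c (i := e) (by omega) (by ring))
    ((h.isRegular le_rfl).poch_two (i := e + f + t + e) (by omega) (by omega)
      (by push_cast; ring))
    (h.poch_c_three (i := 2 * e + 0 + f) (by subst hd hq₂; push_cast; ring) (by omega))
    (h.poch_c_two (i := 2 * e + 0 + f) (by subst hd; push_cast; ring) (by omega))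
    (h.poch_three_up (i := 2 * e + 0 + (f + t) + f) (by subst hq₁ hq₂; push_cast; ring)
      (by omega) (by omega))
    (factorial_cast_ne_zero _)

theorem IsAdmissible.normOEO_eq {e f t : ℕ}
    (h : IsAdmissible p₁ p₂ p₃ c (2 * (e + f + t) + 1)) {q₁ q₂ d : K}
    (hq₁ : q₁ = p₁ + p₂ + e + 1 / 2) (hq₂ : q₂ = p₃ + 1 / 4)
    (hd : d = c + 2 * e + 2 * p₂ + 1) :
    weight2EO p₁ p₂ p₃ c 0 (e + f + t) * uniNormOO p₁ p₂ c e (e + f + t) *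
        uniNormEE q₁ q₂ d f (f + t) =
      normOEO p₁ p₂ p₃ c e f (e + f + t) := by
  have hH := normOEO.eq_1 p₁ p₂ p₃ c e f (e + f + t)
  rw [show (e + f + t) - e - f = t by omega,
    show ((e + f + t : ℕ) : ℤ) - e - f - 1 = (t : ℤ) - 1 by push_cast; ring,
    show ((e + f + t : ℕ) : ℤ) - e - f = ((t : ℕ) : ℤ) by push_cast; ring,
    show ((e + f + t : ℕ) : ℤ) - e = ((f + t : ℕ) : ℤ) by push_cast; ring,
    show (e : ℤ) + (f : ℤ) + 1 = ((e + f + 1 : ℕ) : ℤ) by push_cast; ring,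
    show (e : ℤ) + 1 = ((e + 1 : ℕ) : ℤ) by push_cast; ring] at hH
  simp only [pochZ_natCast] at hH
  have hy := poch_neg_mul (K := K) e f t
  exact norm_mul_norm_eq (weight2EO_zero _) (uniNormOO_eq _ _) (uniNormEE_eq _ _) hH
    (poch_congr (by subst hq₁; push_cast; ring) (by omega))
    (poch_congr (by subst hq₂; ring) rfl) (poch_congr (by ring) (by omega))
    (poch_congr (by ring) rfl) (poch_congr (by subst hd hq₂; ring) rfl)
    (poch_reflect_add (k := e + f + 1) (l := t) (by push_cast; ring) (by omega) rfl)
    (poch_reflect_of_eq (by subst hq₁ hq₂; push_cast; ring) (by omega))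
    (by linear_combination -hy)
    (poch_mul_of_eq (by push_cast; ring) (by subst hq₁ hd; push_cast; ring) (by omega))
    (poch_mul_succ_of_eq (y := c + 2 * p₂ + 1 / 2 + e + (e + f + t : ℕ)) (by ring)
      (by push_cast; ring) (by omega) (by push_cast; ring))
    ((pochZ_sub_one_mul (a := c + 2 * e + f + 2 * p₂ + 3 / 2) (t := t)
      (by push_cast; ring) fun ht h0 =>
      h.c_two_ne (2 * e + f) (by omega) (by
        subst ht
        push_cast at h0 ⊢
        linear_combination h0)).trans
      (poch_congr (by subst hd; ring) (by omega)))
    (poch_mul_eq_poch_mul (by subst hd hq₂; ring) (by ring)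
      (by subst hd hq₂; push_cast; ring) (by omega))
    (factorial_cast_ne_zero _)
    (h.poch_one (m := 2 * (e + f + t) + 1) (by push_cast; ring) (by omega) (by omega))
    (h.poch_c_two (i := e) (by ring) (by omega))
    ((h.isRegular le_rfl).poch_c (i := e + 1) (by omega) (by push_cast; ring))
    ((h.isRegular le_rfl).poch_two (i := e + f + t + e + 1) (by omega) (by omega)
      (by push_cast; ring))
    (h.poch_c_three (i := 2 * e + 1 + f) (by subst hd hq₂; push_cast; ring) (by omega))
    (h.poch_c_two (i := 2 * e + 1 + f) (by subst hd; push_cast; ring) (by omega))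
    (h.poch_three_up (i := 2 * e + 1 + (f + t) + f) (by subst hq₁ hq₂; push_cast; ring)
      (by omega) (by omega))
    (factorial_cast_ne_zero _)

theorem IsAdmissible.normEOO_eq {e f t : ℕ}
    (h : IsAdmissible p₁ p₂ p₃ c (2 * (e + f + t) + 1)) {q₁ q₂ d : K}
    (hq₁ : q₁ = p₁ + p₂ + e) (hq₂ : q₂ = p₃ + 1 / 4)
    (hd : d = c + 2 * e + 2 * p₂) :
    weight2EO p₁ p₂ p₃ c 0 (e + f + t) * uniNormEO p₁ p₂ c e (e + f + t) *
        uniNormOO q₁ q₂ d f (f + t) =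
      normEOO p₁ p₂ p₃ c e f (e + f + t) := by
  have hH := normEOO.eq_1 p₁ p₂ p₃ c e f (e + f + t)
  rw [show (e + f + t) - e - f = t by omega,
    show ((e + f + t : ℕ) : ℤ) - e - f - 1 = (t : ℤ) - 1 by push_cast; ring,
    show ((e + f + t : ℕ) : ℤ) - e - f = ((t : ℕ) : ℤ) by push_cast; ring,
    show ((e + f + t : ℕ) : ℤ) - e + 1 = ((f + t + 1 : ℕ) : ℤ) by push_cast; ring,
    show (e : ℤ) + (f : ℤ) + 1 = ((e + f + 1 : ℕ) : ℤ) by push_cast; ring,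
    show (f : ℤ) + 1 = ((f + 1 : ℕ) : ℤ) by push_cast; ring] at hH
  simp only [pochZ_natCast] at hH
  have hy := poch_neg_mul (K := K) e f t
  exact norm_mul_norm_eq (weight2EO_zero _) (uniNormEO_eq _ _) (uniNormOO_eq _ _) hH
    (poch_congr (by subst hq₁; push_cast; ring) (by omega))
    (poch_congr (by subst hq₂; ring) rfl) (poch_congr (by ring) (by omega))
    (poch_congr (by ring) rfl) (poch_congr (by subst hd hq₂; ring) rfl)
    (poch_reflect_add (k := e + f + 1) (l := t) (by push_cast; ring) (by omega) rfl)
    (poch_reflect_of_eq (by subst hq₁ hq₂; push_cast; ring) (by omega))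
    (by linear_combination -hy)
    (poch_mul_of_eq (by push_cast; ring) (by subst hq₁ hd; push_cast; ring) (by omega))
    (poch_mul_succ_of_eq (y := c + 2 * p₂ + 1 / 2 + e + (e + f + t : ℕ)) (by ring)
      (by ring) (by omega) (by push_cast; ring))
    ((pochZ_sub_one_mul (a := c + 2 * e + f + 2 * p₂ + 3 / 2) (t := t)
      (by push_cast; ring) fun ht h0 =>
      h.c_two_ne (2 * e + f) (by omega) (by
        subst ht
        push_cast at h0 ⊢
        linear_combination h0)).trans
      (poch_congr (by subst hd; ring) (by omega)))
    (poch_mul_eq_poch_mul (by subst hd hq₂; ring) (by push_cast; ring)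
      (by subst hd hq₂; push_cast; ring) (by omega))
    (factorial_cast_ne_zero _)
    (h.poch_one (m := 2 * (e + f + t) + 1) (by push_cast; ring) (by omega) (by omega))
    (h.poch_c_two (i := e) (by ring) (by omega))
    ((h.isRegular le_rfl).poch_c (i := e) (by omega) (by ring))
    ((h.isRegular le_rfl).poch_two (i := e + f + t + e) (by omega) (by omega)
      (by push_cast; ring))
    (h.poch_c_three (i := 2 * e + 0 + f) (by subst hd hq₂; push_cast; ring) (by omega))
    (h.poch_c_two (i := 2 * e + 0 + f + 1) (by subst hd; push_cast; ring) (by omega))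
    (h.poch_three_up (i := 2 * e + 0 + (f + t) + f + 1) (by subst hq₁ hq₂; push_cast; ring)
      (by omega) (by omega))
    (factorial_cast_ne_zero _)

theorem IsAdmissible.normOOO_eq {e f t : ℕ}
    (h : IsAdmissible p₁ p₂ p₃ c (2 * (e + (f + 1) + t) + 1)) {q₁ q₂ d : K}
    (hq₁ : q₁ = p₁ + p₂ + e + 1 / 2) (hq₂ : q₂ = p₃ + 1 / 4)
    (hd : d = c + 2 * e + 2 * p₂ + 1) :
    weight2EO p₁ p₂ p₃ c 0 (e + (f + 1) + t) * uniNormOO p₁ p₂ c e (e + (f + 1) + t) *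
        uniNormOE q₁ q₂ d f (f + 1 + t) =
      normOOO p₁ p₂ p₃ c e f (e + (f + 1) + t) := by
  have hH := normOOO.eq_1 p₁ p₂ p₃ c e f (e + (f + 1) + t)
  rw [show (e + (f + 1) + t) - e - f - 1 = t by omega,
    show ((e + (f + 1) + t : ℕ) : ℤ) - e - f - 2 = (t : ℤ) - 1 by push_cast; ring,
    show ((e + (f + 1) + t : ℕ) : ℤ) - e - f = ((t + 1 : ℕ) : ℤ) by push_cast; ring,
    show ((e + (f + 1) + t : ℕ) : ℤ) - e = ((f + 1 + t : ℕ) : ℤ) by push_cast; ring,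
    show (e : ℤ) + (f : ℤ) + 1 = ((e + f + 1 : ℕ) : ℤ) by push_cast; ring,
    show (e : ℤ) + 1 = ((e + 1 : ℕ) : ℤ) by push_cast; ring,
    show (f : ℤ) + 1 = ((f + 1 : ℕ) : ℤ) by push_cast; ring] at hH
  simp only [pochZ_natCast] at hH
  have hy := poch_neg_mul (K := K) e (f + 1) t
  exact norm_mul_norm_eq (weight2EO_zero _) (uniNormOO_eq _ _) (uniNormOE_eq _ _) hH
    (poch_congr (by subst hq₁; push_cast; ring) (by omega))
    (poch_congr (by subst hq₂; ring) rfl) (poch_congr (by ring) (by omega))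
    (poch_congr (by ring) rfl) (poch_congr (by subst hd hq₂; ring) rfl)
    (poch_reflect_add (k := e + f + 1) (l := t + 1) (by push_cast; ring) (by omega) rfl)
    (poch_reflect_of_eq (by subst hq₁ hq₂; push_cast; ring) (by omega))
    (by linear_combination hy)
    (poch_mul_of_eq (by push_cast; ring) (by subst hq₁ hd; push_cast; ring) (by omega))
    (poch_mul_succ_of_eq (y := c + 2 * p₂ + 1 / 2 + e + (e + (f + 1) + t : ℕ)) (by ring)
      (by push_cast; ring) (by omega) (by push_cast; ring))
    ((pochZ_sub_one_mul (a := c + 2 * e + f + 2 * p₂ + 5 / 2) (t := t)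
      (by push_cast; ring) fun ht h0 =>
      h.c_two_ne (2 * e + f + 1) (by omega) (by
        subst ht
        push_cast at h0 ⊢
        linear_combination h0)).trans
      (poch_congr (by subst hd; ring) (by omega)))
    (poch_mul_eq_poch_mul (by subst hd hq₂; ring) (by push_cast; ring)
      (by subst hd hq₂; push_cast; ring) (by omega))
    (factorial_cast_ne_zero _)
    (h.poch_one (m := 2 * (e + (f + 1) + t) + 1) (by push_cast; ring) (by omega) (by omega))
    (h.poch_c_two (i := e) (by ring) (by omega))
    ((h.isRegular le_rfl).poch_c (i := e + 1) (by omega) (by push_cast; ring))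
    ((h.isRegular le_rfl).poch_two (i := e + (f + 1) + t + e + 1) (by omega) (by omega)
      (by push_cast; ring))
    (h.poch_c_three (i := 2 * e + 1 + f) (by subst hd hq₂; push_cast; ring) (by omega))
    (h.poch_c_two (i := 2 * e + 1 + f + 1) (by subst hd; push_cast; ring) (by omega))
    (h.poch_three_up (i := 2 * e + 1 + (f + 1 + t) + f) (by subst hq₁ hq₂; push_cast; ring)
      (by omega) (by omega))
    (factorial_cast_ne_zero _)

end BivariateNorms

/-! ### Bivariate orthogonality -/

section Bivariate

variable {K : Type*} [Field K] [CharZero K] {p₁ p₂ p₃ c : K} {N : ℕ}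

/-- Read off from the expansion in monic Newton polynomials. -/
theorem isMonicPolynomialFun_bannaiIto {n : ℕ} {ρ₁ ρ₂ r₁ r₂ : K}
    (hD : poch (((n / 2 : ℕ) : K) + (ρ₁ + ρ₂ - r₁ - r₂) + 1) (n / 2 + n % 2) ≠ 0) :
    IsMonicPolynomialFun (bannaiIto n ρ₁ ρ₂ r₁ r₂) n := by
  let Q : ℕ → Polynomial K := fun k =>
    ∏ i ∈ Finset.range k, (Polynomial.X - Polynomial.C (gridPt r₁ i))
  have hQm : ∀ k, (Q k).Monic := fun k =>
    Polynomial.monic_prod_of_monic _ _ fun i _ => Polynomial.monic_X_sub_C _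
  have hQd : ∀ k, (Q k).natDegree = k := fun k => by
    rw [Polynomial.natDegree_prod_of_monic _ _ fun i _ => Polynomial.monic_X_sub_C _]
    simp
  have hdeg : (∑ k ∈ Finset.range n,
      Polynomial.C (biCoeff n ρ₁ ρ₂ r₁ r₂ k) * Q k).degree < (Q n).degree := by
    rw [Polynomial.degree_eq_natDegree (hQm n).ne_zero, hQd]
    refine lt_of_le_of_lt (Polynomial.degree_sum_le _ _) ?_
    refine (Finset.sup_lt_iff (WithBot.bot_lt_coe n)).mpr fun k hk => ?_
    refine lt_of_le_of_lt Polynomial.degree_le_natDegree ?_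
    exact WithBot.coe_lt_coe.mpr (((Polynomial.natDegree_C_mul_le _ _).trans (hQd k).le).trans_lt
      (Finset.mem_range.mp hk))
  refine ⟨Q n + ∑ k ∈ Finset.range n, Polynomial.C (biCoeff n ρ₁ ρ₂ r₁ r₂ k) * Q k,
    (hQm n).add_of_left hdeg, ?_, fun x => ?_⟩
  · rw [Polynomial.natDegree_eq_of_degree_eq (Polynomial.degree_add_eq_left_of_degree_lt hdeg), hQd]
  · rw [bannaiIto_eq_sum, Finset.sum_range_succ, biCoeff_self hD, one_mul, Polynomial.eval_add,
      Polynomial.eval_finsetSum, add_comm]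
    simp [Q, newton, Polynomial.eval_prod]

/-- Univariate orthogonality for all degrees up to `N`. For degrees beyond the size `S` of the
grid both sides vanish. -/
theorem IsRegular.sum_firstBI_mul_firstBI {S n m : ℕ} (h : IsRegular p₁ p₂ c S) (hS : S ≤ N)
    (hG : ∀ k : ℕ, k < N → c + 2 * p₂ + 1 / 2 + (k : K) ≠ 0) (hn : n ≤ N) (hm : m ≤ N) :
    ∑ k ∈ Finset.range (S + 1), weight1 p₁ p₂ c (S - k) S *
      firstBI p₁ p₂ c n (truncZ p₁ p₂ S) (gridPt (1 / 2 - p₁) k) *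
      firstBI p₁ p₂ c m (truncZ p₁ p₂ S) (gridPt (1 / 2 - p₁) k) =
    if n = m then uniNorm p₁ p₂ c n S else 0 := by
  split_ifs with hnm
  · subst hnm
    have hG' : ∀ k : ℕ, k < S → c + 2 * p₂ + 1 / 2 + (k : K) ≠ 0 := fun k hk => hG k (by omega)
    rcases lt_or_ge S n with hlt | hle
    · rw [uniNorm_of_lt hlt]
      refine Finset.sum_eq_zero fun k hk => ?_
      have hz : firstBI p₁ p₂ c n (truncZ p₁ p₂ S) (gridPt (1 / 2 - p₁) k) = 0 :=
        h.isTruncated.bannaiIto_eq_zero hlt (fun j hj => by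
          rw [truncParam_gap]
          exact biEig_ne hG hn (by omega) hj.ne') (by have := Finset.mem_range.mp hk; omega)
      rw [hz, mul_zero]
    · obtain ⟨s, rfl | rfl⟩ := Nat.even_or_odd' S <;> obtain ⟨e, rfl | rfl⟩ := Nat.even_or_odd' n
      · rw [uniNorm_even_even]
        exact h.firstBI_norm_even_even hle hG'
      · rw [uniNorm_odd_even]
        exact h.firstBI_norm_odd_even hle hG'
      · rw [uniNorm_even_odd]
        exact h.firstBI_norm_even_odd hle hG'
      · rw [uniNorm_odd_odd]
        exact h.firstBI_norm_odd_odd hle hG'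
  · exact h.firstBI_orthogonal hG hn hm hnm

theorem gridZ2_eq_truncZ {s : ℕ} (hs : s ≤ N) : gridZ2 p₁ p₂ N s = truncZ p₁ p₂ (N - s) := by
  obtain ⟨t, rfl⟩ := Nat.exists_eq_add_of_le hs
  rw [gridZ2, truncZ, Nat.add_sub_cancel_left, ← add_assoc, pow_add, ← two_mul,
    neg_one_pow_even, one_mul]
  push_cast
  ring

/-- The points of the first and of the second grid, shifted by `1 / 4`, have this common form. -/
theorem half_neg_one_pow_eq_gridPt (p : K) (k : ℕ) :
    1 / 2 * ((-1) ^ k * (1 / 2 - k - 2 * p)) - 1 / 4 = gridPt (1 / 2 - p) k := by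
  obtain ⟨m, rfl | rfl⟩ := Nat.even_or_odd' k
  · rw [gridPt_even, neg_one_pow_even]
    push_cast
    ring
  · rw [gridPt_odd, neg_one_pow_odd]
    push_cast
    ring

theorem gridZ1_eq_gridPt {r s : ℕ} (h : r + s ≤ N) :
    gridZ1 p₁ N r s - 1 / 4 = gridPt (1 / 2 - p₁) (N - s - r) := by
  obtain ⟨t, rfl⟩ := Nat.exists_eq_add_of_le h
  rw [gridZ1, show r + s + t - s - r = t by omega, ← half_neg_one_pow_eq_gridPt, ← add_assoc,
    pow_add, ← two_mul, neg_one_pow_even, one_mul]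
  push_cast
  ring

theorem gridZ2_eq_gridPt {n s : ℕ} (h : n + s ≤ N) :
    (-1) ^ n * gridZ2 p₁ p₂ N s - 1 / 4 = gridPt (1 / 2 - (p₁ + p₂ + n / 2)) (N - n - s) := by
  obtain ⟨t, rfl⟩ := Nat.exists_eq_add_of_le h
  have hsq : ∀ j : ℕ, ((-1 : K) ^ j) * (-1) ^ j = 1 := fun j => by rw [← mul_pow]; simp
  rw [gridZ2, show n + s + t - n - s = t by omega, ← half_neg_one_pow_eq_gridPt, pow_add, pow_add,
    pow_add]
  push_cast
  linear_combination ((-1) ^ t * (1 / 2 * (s - (n + s + t) - 2 * p₁ - 2 * p₂ + 1 / 2))) *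
    mul_congr_eq (hsq n) (hsq s)

/-- The second factor is a first factor for shifted parameters. -/
theorem secondBI_eq_firstBI {n : ℕ} (hn : n ≤ N) (m : ℕ) (x : K) :
    secondBI p₁ p₂ p₃ c N n m x =
      firstBI (p₁ + p₂ + n / 2) (p₃ + 1 / 4) (c + n + 2 * p₂) m
        (truncZ (p₁ + p₂ + n / 2) (p₃ + 1 / 4) (N - n)) x := by
  obtain ⟨t, rfl⟩ := Nat.exists_eq_add_of_le hn
  have hz : truncZ (p₁ + p₂ + n / 2) (p₃ + 1 / 4) t =
      -((-1) ^ t * (((n : K) + t) / 2 + p₁ + p₂ + p₃)) := by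
    rw [truncZ]
    ring
  have hp : (-1 : K) ^ (n + (n + t)) = (-1) ^ t := by
    rw [← add_assoc, pow_add, ← two_mul, neg_one_pow_even, one_mul]
  rw [secondBI, firstBI, Nat.add_sub_cancel_left, hz, hp]
  push_cast
  congr 1 <;> ring

/-- The normalization constant is the second weight at `s = 0` times the norms of the two
factors. -/
theorem IsAdmissible.norm_eq {n m : ℕ} (h : IsAdmissible p₁ p₂ p₃ c N) (hnm : n + m ≤ N) :
    weight2 p₁ p₂ p₃ c 0 N * uniNorm p₁ p₂ c n N *
        uniNorm (p₁ + p₂ + n / 2) (p₃ + 1 / 4) (c + n + 2 * p₂) m (N - n) =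
      bivariateNorm p₁ p₂ p₃ c n m N := by
  have hq₁ : ∀ e : ℕ, p₁ + p₂ + ((2 * e : ℕ) : K) / 2 = p₁ + p₂ + e := fun e => by
    push_cast
    ring
  have hq₁' : ∀ e : ℕ, p₁ + p₂ + ((2 * e + 1 : ℕ) : K) / 2 = p₁ + p₂ + e + 1 / 2 := fun e => by
    push_cast
    ring
  have hd : ∀ e : ℕ, c + ((2 * e : ℕ) : K) + 2 * p₂ = c + 2 * e + 2 * p₂ := fun e => by
    push_cast
    ring
  have hd' : ∀ e : ℕ, c + ((2 * e + 1 : ℕ) : K) + 2 * p₂ = c + 2 * e + 2 * p₂ + 1 := fun e => by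
    push_cast
    ring
  have hE : ∀ k, (2 * k) / 2 = k := fun k => by omega
  have hO : ∀ k, (2 * k + 1) / 2 = k := fun k => by omega
  have hE' : ∀ k, (2 * k) % 2 = 0 := fun k => by omega
  have hO' : ∀ k, ¬ (2 * k + 1) % 2 = 0 := fun k => by omega
  have hw : ∀ M, weight2 p₁ p₂ p₃ c 0 (2 * M) = weight2EE p₁ p₂ p₃ c 0 M := weight2_even_even 0
  have hw' : ∀ M, weight2 p₁ p₂ p₃ c 0 (2 * M + 1) = weight2EO p₁ p₂ p₃ c 0 M := weight2_even_odd 0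
  rw [bivariateNorm]
  obtain ⟨M, rfl | rfl⟩ := Nat.even_or_odd' N <;> obtain ⟨e, rfl | rfl⟩ := Nat.even_or_odd' n <;>
    obtain ⟨f, rfl | rfl⟩ := Nat.even_or_odd' m
  · obtain ⟨t, rfl⟩ : ∃ t, M = e + f + t := ⟨M - (e + f), by omega⟩
    rw [show 2 * (e + f + t) - 2 * e = 2 * (f + t) by omega, hw,
      uniNorm_even_even, uniNorm_even_even, if_pos (hE' _), if_pos (hE' _), if_pos (hE' _), hE, hE,
      hE]
    exact h.normEEE_eq (hq₁ e) rfl (hd e)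
  · obtain ⟨t, rfl⟩ : ∃ t, M = e + (f + 1) + t := ⟨M - (e + f + 1), by omega⟩
    rw [show 2 * (e + (f + 1) + t) - 2 * e = 2 * (f + 1 + t) by omega, hw,
      uniNorm_even_even, uniNorm_odd_even, if_pos (hE' _), if_pos (hE' _), if_neg (hO' _), hE, hE,
      hO]
    exact h.normEOE_eq (hq₁ e) rfl (hd e)
  · obtain ⟨t, rfl⟩ : ∃ t, M = e + 1 + f + t := ⟨M - (e + f + 1), by omega⟩
    rw [show 2 * (e + 1 + f + t) - (2 * e + 1) = 2 * (f + t) + 1 by omega, hw,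
      uniNorm_odd_even, uniNorm_even_odd, if_pos (hE' _), if_neg (hO' _), if_pos (hE' _), hE, hE,
      hO]
    exact h.normOEE_eq (hq₁' e) rfl (hd' e)
  · obtain ⟨t, rfl⟩ : ∃ t, M = e + 1 + f + t := ⟨M - (e + f + 1), by omega⟩
    rw [show 2 * (e + 1 + f + t) - (2 * e + 1) = 2 * (f + t) + 1 by omega, hw,
      uniNorm_odd_even, uniNorm_odd_odd, if_pos (hE' _), if_neg (hO' _), if_neg (hO' _), hE, hO,
      hO]
    exact h.normOOE_eq (hq₁' e) rfl (hd' e)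
  · obtain ⟨t, rfl⟩ : ∃ t, M = e + f + t := ⟨M - (e + f), by omega⟩
    rw [show 2 * (e + f + t) + 1 - 2 * e = 2 * (f + t) + 1 by omega, hw',
      uniNorm_even_odd, uniNorm_even_odd, if_neg (hO' _), if_pos (hE' _), if_pos (hE' _), hE, hE,
      hO]
    exact h.normEEO_eq (hq₁ e) rfl (hd e)
  · obtain ⟨t, rfl⟩ : ∃ t, M = e + f + t := ⟨M - (e + f), by omega⟩
    rw [show 2 * (e + f + t) + 1 - 2 * e = 2 * (f + t) + 1 by omega, hw',
      uniNorm_even_odd, uniNorm_odd_odd, if_neg (hO' _), if_pos (hE' _), if_neg (hO' _), hE, hO,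
      hO]
    exact h.normEOO_eq (hq₁ e) rfl (hd e)
  · obtain ⟨t, rfl⟩ : ∃ t, M = e + f + t := ⟨M - (e + f), by omega⟩
    rw [show 2 * (e + f + t) + 1 - (2 * e + 1) = 2 * (f + t) by omega, hw',
      uniNorm_odd_odd, uniNorm_even_even, if_neg (hO' _), if_neg (hO' _), if_pos (hE' _), hE, hO,
      hO]
    exact h.normOEO_eq (hq₁' e) rfl (hd' e)
  · obtain ⟨t, rfl⟩ : ∃ t, M = e + (f + 1) + t := ⟨M - (e + f + 1), by omega⟩
    rw [show 2 * (e + (f + 1) + t) + 1 - (2 * e + 1) = 2 * (f + 1 + t) by omega, hw',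
      uniNorm_odd_odd, uniNorm_odd_even, if_neg (hO' _), if_neg (hO' _), if_neg (hO' _), hO, hO, hO]
    exact h.normOOO_eq (hq₁' e) rfl (hd' e)

/-- The sum over the first variable. -/
theorem IsAdmissible.sum_first (h : IsAdmissible p₁ p₂ p₃ c N) {n m s : ℕ} (hs : s ≤ N)
    (hn : n ≤ N) (hm : m ≤ N) :
    ∑ r ∈ Finset.range (N + 1), weight1 p₁ p₂ c r (N - s) *
        firstBI p₁ p₂ c n (gridZ2 p₁ p₂ N s) (gridZ1 p₁ N r s - 1 / 4) *
        firstBI p₁ p₂ c m (gridZ2 p₁ p₂ N s) (gridZ1 p₁ N r s - 1 / 4) =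
      if n = m then uniNorm p₁ p₂ c n (N - s) else 0 := by
  rw [← (h.isRegular (Nat.sub_le N s)).sum_firstBI_mul_firstBI (Nat.sub_le N s) h.c_two_ne hn hm,
    gridZ2_eq_truncZ hs,
    ← Finset.sum_subset (Finset.range_subset_range.mpr (show N - s + 1 ≤ N + 1 by omega))
      fun r _ hr => ?_]
  -- The grid `gridPt` runs through the points in the opposite order.
  · refine Eq.trans (Finset.sum_congr rfl fun r hr => ?_) (Finset.sum_range_reflect _ _)
    have hr := Finset.mem_range.mp hr
    rw [gridZ1_eq_gridPt (by omega), show N - s + 1 - 1 - r = N - s - r by omega,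
      show N - s - (N - s - r) = r by omega]
  -- The weight vanishes for `N - s < r`.
  · rw [Finset.mem_range, not_lt] at hr
    rw [weight1_of_lt (by omega), zero_mul, zero_mul]

/-- The sum over the second variable, after the sum over the first one. -/
theorem IsAdmissible.sum_second (h : IsAdmissible p₁ p₂ p₃ c N) {n m k : ℕ}
    (hm : n + m ≤ N) (hk : n + k ≤ N) :
    ∑ s ∈ Finset.range (N + 1), weight2 p₁ p₂ p₃ c s N * uniNorm p₁ p₂ c n (N - s) *
        secondBI p₁ p₂ p₃ c N n m ((-1) ^ n * gridZ2 p₁ p₂ N s - 1 / 4) *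
        secondBI p₁ p₂ p₃ c N n k ((-1) ^ n * gridZ2 p₁ p₂ N s - 1 / 4) =
      if m = k then bivariateNorm p₁ p₂ p₃ c n m N else 0 := by
  have hn : n ≤ N := by omega
  have hR := h.isRegular_second hn rfl rfl rfl
  have hG : ∀ i : ℕ, i < N - n →
      c + n + 2 * p₂ + 2 * (p₃ + 1 / 4) + 1 / 2 + (i : K) ≠ 0 := fun i hi h0 =>
    h.c_three_ne (n + i) (by omega) (by
      push_cast
      linear_combination h0)
  have hsum := hR.sum_firstBI_mul_firstBI le_rfl hG (show m ≤ N - n by omega)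
    (show k ≤ N - n by omega)
  have hnorm : (if m = k then bivariateNorm p₁ p₂ p₃ c n m N else 0) =
      weight2 p₁ p₂ p₃ c 0 N * uniNorm p₁ p₂ c n N *
        if m = k then uniNorm (p₁ + p₂ + n / 2) (p₃ + 1 / 4) (c + n + 2 * p₂) m (N - n)
        else 0 := by
    split_ifs
    · exact (h.norm_eq hm).symm
    · rw [mul_zero]
  rw [hnorm, ← hsum, Finset.mul_sum,
    ← Finset.sum_subset (Finset.range_subset_range.mpr (show N - n + 1 ≤ N + 1 by omega))
      fun s hsN hs => ?_]
  · refine Eq.trans (Finset.sum_congr rfl fun s hs => ?_) (Finset.sum_range_reflect _ _)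
    have hs := Finset.mem_range.mp hs
    rw [h.weight2_mul_uniNorm s (by omega), gridZ2_eq_gridPt (by omega), secondBI_eq_firstBI hn,
      secondBI_eq_firstBI hn, show N - n + 1 - 1 - s = N - n - s by omega,
      show N - n - (N - n - s) = s by omega]
    ring
  -- For `N - n < s` the first factor vanishes on its grid, and so does its norm.
  · rw [Finset.mem_range] at hsN
    rw [Finset.mem_range, not_lt] at hs
    rw [uniNorm_of_lt (by omega), mul_zero, zero_mul, zero_mul]

theorem IsAdmissible.sum_bivariateBI (h : IsAdmissible p₁ p₂ p₃ c N) {n₁ n₂ m₁ m₂ : ℕ}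
    (hn : n₁ + n₂ ≤ N) (hm : m₁ + m₂ ≤ N) :
    ∑ s ∈ Finset.range (N + 1), ∑ r ∈ Finset.range (N + 1),
        weight1 p₁ p₂ c r (N - s) * weight2 p₁ p₂ p₃ c s N *
          bivariateBI p₁ p₂ p₃ c N n₁ n₂ (gridZ1 p₁ N r s) (gridZ2 p₁ p₂ N s) *
          bivariateBI p₁ p₂ p₃ c N m₁ m₂ (gridZ1 p₁ N r s) (gridZ2 p₁ p₂ N s) =
      if n₁ = m₁ ∧ n₂ = m₂ then bivariateNorm p₁ p₂ p₃ c n₁ n₂ N else 0 := by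
  have hinner : ∀ s ∈ Finset.range (N + 1), ∑ r ∈ Finset.range (N + 1),
        weight1 p₁ p₂ c r (N - s) * weight2 p₁ p₂ p₃ c s N *
          bivariateBI p₁ p₂ p₃ c N n₁ n₂ (gridZ1 p₁ N r s) (gridZ2 p₁ p₂ N s) *
          bivariateBI p₁ p₂ p₃ c N m₁ m₂ (gridZ1 p₁ N r s) (gridZ2 p₁ p₂ N s) =
      weight2 p₁ p₂ p₃ c s N * (if n₁ = m₁ then uniNorm p₁ p₂ c n₁ (N - s) else 0) *
        secondBI p₁ p₂ p₃ c N n₁ n₂ ((-1) ^ n₁ * gridZ2 p₁ p₂ N s - 1 / 4) *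
        secondBI p₁ p₂ p₃ c N m₁ m₂ ((-1) ^ m₁ * gridZ2 p₁ p₂ N s - 1 / 4) := by
    intro s hs
    have hs := Finset.mem_range.mp hs
    rw [← h.sum_first (show s ≤ N by omega) (show n₁ ≤ N by omega) (show m₁ ≤ N by omega),
      Finset.mul_sum, Finset.sum_mul, Finset.sum_mul]
    refine Finset.sum_congr rfl fun r _ => ?_
    rw [bivariateBI, bivariateBI]
    ring
  rw [Finset.sum_congr rfl hinner]
  rcases eq_or_ne n₁ m₁ with rfl | hne
  · simpa using h.sum_second hn hm
  · simp [hne]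

end Bivariate

end BivariateBI

theorem mainTheorem1 {𝕜 : Type*} [RCLike 𝕜] (N : ℕ) (p₁ p₂ p₃ c : 𝕜)
    (hc : ∀ k : ℕ, k < (N + 1) / 2 → c + 1 / 2 + (k : 𝕜) ≠ 0)
    (h₁ : ∀ k : ℕ, k < N → 2 * p₁ + (k : 𝕜) ≠ 0)
    (h₁₂ : ∀ k : ℕ, k < N → 2 * p₁ + 2 * p₂ + (k : 𝕜) ≠ 0)
    (h₁₂₃ : ∀ k : ℕ, N / 2 ≤ k → k < N →
      2 * p₁ + 2 * p₂ + 2 * p₃ + 1 / 2 + (k : 𝕜) ≠ 0)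
    (hc₂ : ∀ k : ℕ, k < N → c + 2 * p₂ + 1 / 2 + (k : 𝕜) ≠ 0)
    (hc₂₃ : ∀ k : ℕ, k < N → c + 2 * p₂ + 2 * p₃ + 1 + (k : 𝕜) ≠ 0) :
    (∀ n₁ n₂ : ℕ, n₁ + n₂ ≤ N →
      (∀ z₂ : 𝕜, BivariateBI.IsMonicPolynomialFun (BivariateBI.firstBI p₁ p₂ c n₁ z₂) n₁) ∧
      BivariateBI.IsMonicPolynomialFun (BivariateBI.secondBI p₁ p₂ p₃ c N n₁ n₂) n₂) ∧
    (∀ n₁ n₂ m₁ m₂ : ℕ, n₁ + n₂ ≤ N → m₁ + m₂ ≤ N →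
      ∑ s ∈ Finset.range (N + 1), ∑ r ∈ Finset.range (N + 1),
        BivariateBI.weight1 p₁ p₂ c r (N - s) * BivariateBI.weight2 p₁ p₂ p₃ c s N *
          BivariateBI.bivariateBI p₁ p₂ p₃ c N n₁ n₂
            (BivariateBI.gridZ1 p₁ N r s) (BivariateBI.gridZ2 p₁ p₂ N s) *
          BivariateBI.bivariateBI p₁ p₂ p₃ c N m₁ m₂
            (BivariateBI.gridZ1 p₁ N r s) (BivariateBI.gridZ2 p₁ p₂ N s) =
      if n₁ = m₁ ∧ n₂ = m₂ then BivariateBI.bivariateNorm p₁ p₂ p₃ c n₁ n₂ N else 0) := by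
  have h : BivariateBI.IsAdmissible p₁ p₂ p₃ c N := ⟨hc, h₁, h₁₂, h₁₂₃, hc₂, hc₂₃⟩
  refine ⟨fun n₁ n₂ hn => ⟨fun z₂ => ?_, ?_⟩, fun n₁ n₂ m₁ m₂ hn hm => h.sum_bivariateBI hn hm⟩
  · exact BivariateBI.isMonicPolynomialFun_bannaiIto
      (BivariateBI.firstBI_denominator_ne_zero h.c_two_ne (by omega) z₂)
  · have hfun : BivariateBI.secondBI p₁ p₂ p₃ c N n₁ n₂ = _ :=
      funext fun x => BivariateBI.secondBI_eq_firstBI (show n₁ ≤ N by omega) n₂ x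
    rw [hfun]
    refine BivariateBI.isMonicPolynomialFun_bannaiIto
      (BivariateBI.firstBI_denominator_ne_zero (N := N - n₁) (fun k hk h0 => ?_)
        (show n₂ ≤ N - n₁ by omega) _)
    refine h.c_three_ne (n₁ + k) (by omega) ?_
    push_cast
    linear_combination h0
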